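/- Let $G$ be a locally compact (Hausdorff) group with left Haar measure, let $\lambda$ be its left regular representation on $L^2(G)$, let $VN(G)=\lambda(G)''$ be its group von Neumann algebra, and let $A(G)$ be its Fourier algebra, i.e. the predual of $VN(G)$, realised as the pointwise algebra of functions $u(s)=\sum_n\langle\lambda(s)\xi_n,\eta_n\rangle$ with $\xi_n,\eta_n\in L^2(G)$ and $\sum_n\|\xi_n\|\|\eta_n\|<\infty$, with norm $\|u\|_{A(G)}=\inf\sum_n\|\xi_n\|\|\eta_n\|$ and with the operator space structure it has as the predual of $VN(G)$. The Lebesgue–Fourier algebra is $S^1\!A(G)=A(G)\cap L^1(G)$ with pointwise operations and norm $\|u\|_{A(G)}+\|u\|_{L^1(G)}$; its operator space structure is inherited from the embedding $u\mapsto(u,u)$ into the operator space $\ell^1$-direct sum $A(G)\oplus_1L^1(G)$, the predual of $VN(G)\oplus_\infty L^\infty(G)$. For a Banach algebra $A$ (respectively, a Banach algebra $A$ that is also an operator space with completely bounded multiplication), let $\pi:A\widehat\otimes A\to A$ (respectively $\pi:A\widehat\otimes_{op}A\to A$) be the product map on the projective (respectively operator projective) tensor product, regarded as an $A$-bimodule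 by $a\cdot(b\otimes c)=ab\otimes c$, $(b\otimes c)\cdot a=b\otimes ca$; dual spaces carry the dual bimodule (and dual operator space) structures. $A$ is called approximately biflat (respectively operator approximately biflat) if there is a net of bounded (respectively completely bounded) $A$-bimodule maps $\theta_\delta:(A\widehat\otimes A)^*\to A^*$ (respectively $\theta_\delta:(A\widehat\otimes_{op}A)^*\to A^*$), not necessarily uniformly bounded, such that $\langle b,\theta_\delta(\pi^*\phi)\rangle\to\langle b,\phi\rangle$ for all $\phi\in A^*$ and $b\in A$. Theorem. Suppose that $S^1\!A(G)$ has an approximate identity (a net $(e_\lambda)$ in $S^1\!A(G)$, not necessarily bounded, with $\|e_\lambda u-u\|_{S^1\!A(G)}\to0$ for all $u\in S^1\!A(G)$), and let $H$ be an open subgroup of $G$. (a) If $S^1\!A(H)$ is approximately biflat, then so is $S^1\!A(G)$. (b) If $S^1\!A(H)$ is operator approximately biflat, then so is $S^1\!A(G)$. -/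

import Mathlib

open MeasureTheory Filter
open scoped ENNReal NNReal TensorProduct Topology

noncomputable section
namespace FourierSegal

section Fourier

variable (G : Type*) [Group G] [TopologicalSpace G] [IsTopologicalGroup G]
  [LocallyCompactSpace G] [MeasurableSpace G] [BorelSpace G]

/-- `L²(G)` with respect to left Haar measure. -/
abbrev L2 : Type _ := Lp ℂ 2 (Measure.haar : Measure G)

variable {G}

/-- The left regular representation, `(λ(s) f)(x) = f(s⁻¹ x)`. -/
def leftReg (s : G) : L2 G →L[ℂ] L2 G :=
  (Lp.compMeasurePreservingₗᵢ ℂ (fun x : G => s⁻¹ * x)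
    (measurePreserving_mul_left Measure.haar s⁻¹)).toContinuousLinearMap

/-- The vector functional `T ↦ ⟨T ξ, η⟩` (linear in `ξ`, conjugate linear in `η`). -/
def coeff (ξ η : L2 G) (T : L2 G →L[ℂ] L2 G) : ℂ := inner ℂ η (T ξ)

/-- `u(s) = ∑ₙ ⟨λ(s) ξₙ, ηₙ⟩` with `∑ₙ ‖ξₙ‖ ‖ηₙ‖ < ∞`. -/
def IsFourierRep (u : G → ℂ) (ξ η : ℕ → L2 G) : Prop :=
  (∑' n, ‖ξ n‖ₑ * ‖η n‖ₑ) ≠ ∞ ∧ ∀ s, u s = ∑' n, coeff (ξ n) (η n) (leftReg s)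

/-- The norm of the Fourier algebra, `‖u‖ = inf ∑ₙ ‖ξₙ‖ ‖ηₙ‖` over all expansions
`u(s) = ∑ₙ ⟨λ(s) ξₙ, ηₙ⟩`; it is `∞` exactly when `u ∉ A(G)`. -/
def fourierENorm (u : G → ℂ) : ℝ≥0∞ :=
  ⨅ (ξ : ℕ → L2 G) (η : ℕ → L2 G) (_ : IsFourierRep u ξ η), ∑' n, ‖ξ n‖ₑ * ‖η n‖ₑ

theorem norm_leftReg (s : G) (ξ : L2 G) : ‖leftReg s ξ‖ = ‖ξ‖ :=
  LinearIsometry.norm_map _ _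

theorem enorm_coeff_le (ξ η : L2 G) (s : G) : ‖coeff ξ η (leftReg s)‖ₑ ≤ ‖ξ‖ₑ * ‖η‖ₑ := by
  have h : ‖coeff ξ η (leftReg s)‖ ≤ ‖ξ‖ * ‖η‖ := by
    refine (norm_inner_le_norm (𝕜 := ℂ) η (leftReg s ξ)).trans ?_
    rw [norm_leftReg, mul_comm]
  simp only [← ofReal_norm, ← ENNReal.ofReal_mul (norm_nonneg _)]
  exact ENNReal.ofReal_le_ofReal h

theorem summable_of_enorm {ι : Type*} {f : ι → ℂ} {g : ι → ℝ≥0∞}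
    (hg : ∑' n, g n ≠ ∞) (h : ∀ n, ‖f n‖ₑ ≤ g n) : Summable f := by
  apply Summable.of_nnnorm
  have : ∑' n, ‖f n‖ₑ ≠ ∞ := ne_top_of_le_ne_top hg (ENNReal.tsum_le_tsum h)
  simpa [enorm] using ENNReal.tsum_coe_ne_top_iff_summable.1 this

theorem enorm_tsum_le {ι : Type*} (f : ι → ℂ) : ‖∑' n, f n‖ₑ ≤ ∑' n, ‖f n‖ₑ := by
  by_cases h : ∑' n, ‖f n‖ₑ = ∞
  · simp [h]
  · have hs : Summable fun n => ‖f n‖₊ := by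
      simpa [enorm] using ENNReal.tsum_coe_ne_top_iff_summable.1 h
    have := nnnorm_tsum_le hs
    simp only [enorm]
    rw [← ENNReal.coe_tsum hs]
    exact_mod_cast this

theorem fourierENorm_le {u : G → ℂ} {ξ η : ℕ → L2 G} (h : IsFourierRep u ξ η) :
    fourierENorm u ≤ ∑' n, ‖ξ n‖ₑ * ‖η n‖ₑ :=
  iInf_le_of_le ξ (iInf_le_of_le η (iInf_le _ h))

theorem exists_rep_lt {u : G → ℂ} {c : ℝ≥0∞} (h : fourierENorm u < c) :
    ∃ ξ η : ℕ → L2 G, IsFourierRep u ξ η ∧ ∑' n, ‖ξ n‖ₑ * ‖η n‖ₑ < c := by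
  simpa only [fourierENorm, iInf_lt_iff, exists_prop] using h

theorem enorm_apply_le (u : G → ℂ) (s : G) : ‖u s‖ₑ ≤ fourierENorm u := by
  refine le_iInf fun ξ => le_iInf fun η => le_iInf fun h => ?_
  rw [h.2 s]
  exact (enorm_tsum_le _).trans (ENNReal.tsum_le_tsum fun n => enorm_coeff_le _ _ s)

theorem fourierENorm_le_of_countable {ι : Type*} [Countable ι] {u : G → ℂ} (ξ η : ι → L2 G)
    (h : ∀ s, u s = ∑' i, coeff (ξ i) (η i) (leftReg s)) :
    fourierENorm u ≤ ∑' i, ‖ξ i‖ₑ * ‖η i‖ₑ := by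
  by_cases hfin : ∑' i, ‖ξ i‖ₑ * ‖η i‖ₑ = ∞
  · simp [hfin]
  obtain ⟨f, hf⟩ := exists_injective_nat ι
  have key : ∀ n ∉ Set.range f, Function.extend f ξ 0 n = 0 := by
    intro n hn
    rw [Function.extend_apply' _ _ _ (by simpa using hn)]; rfl
  have e1 : ∑' n, ‖Function.extend f ξ 0 n‖ₑ * ‖Function.extend f η 0 n‖ₑ
      = ∑' i, ‖ξ i‖ₑ * ‖η i‖ₑ := by
    rw [← hf.tsum_eq]
    · simp [hf.extend_apply]
    · intro n hn
      by_contra h'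
      exact hn (by simp [key n h'])
  rw [← e1]
  refine fourierENorm_le ⟨by rwa [e1], fun s => ?_⟩
  rw [h s, ← hf.tsum_eq (f := fun n => coeff (Function.extend f ξ 0 n) (Function.extend f η 0 n) (leftReg s))]
  · simp [hf.extend_apply]
  · intro n hn
    by_contra h'
    exact hn (by simp [key n h', coeff])

theorem fourierENorm_le_tsum {ι : Type*} [Countable ι] {u : G → ℂ} (v : ι → G → ℂ)
    (h : ∀ s, u s = ∑' i, v i s) : fourierENorm u ≤ ∑' i, fourierENorm (v i) := by
  by_cases hfin : ∑' i, fourierENorm (v i) = ∞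
  · simp [hfin]
  refine ENNReal.le_of_forall_pos_le_add fun ε hε _ => ?_
  obtain ⟨δ, hδ, hδε⟩ := ENNReal.exists_pos_sum_of_countable (ι := ι)
    (ENNReal.coe_ne_zero.2 hε.ne')
  have hlt : ∀ i, fourierENorm (v i) < fourierENorm (v i) + δ i := fun i =>
    ENNReal.lt_add_right (ENNReal.ne_top_of_tsum_ne_top hfin i)
      (ENNReal.coe_ne_zero.2 (hδ i).ne')
  choose ξ η hr hl using fun i => exists_rep_lt (hlt i)
  have hle : ∑' p : ι × ℕ, ‖ξ p.1 p.2‖ₑ * ‖η p.1 p.2‖ₑ ≤ ∑' i, fourierENorm (v i) + ε := by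
    rw [ENNReal.tsum_prod']
    calc _ ≤ ∑' i, (fourierENorm (v i) + δ i) := ENNReal.tsum_le_tsum fun i => (hl i).le
      _ = ∑' i, fourierENorm (v i) + ∑' i, (δ i : ℝ≥0∞) := ENNReal.tsum_add
      _ ≤ _ := by gcongr
  refine (fourierENorm_le_of_countable (fun p : ι × ℕ => ξ p.1 p.2) (fun p => η p.1 p.2)
    fun s => ?_).trans hle
  have hsum : Summable fun p : ι × ℕ => coeff (ξ p.1 p.2) (η p.1 p.2) (leftReg s) :=
    summable_of_enorm (ne_top_of_le_ne_top (ENNReal.add_ne_top.2 ⟨hfin, ENNReal.coe_ne_top⟩) hle)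
      fun p => enorm_coeff_le _ _ s
  rw [h s, hsum.tsum_prod]
  exact tsum_congr fun i => (hr i).2 s

theorem fourierENorm_zero : fourierENorm (0 : G → ℂ) = 0 := by
  refine le_antisymm ?_ bot_le
  simpa using fourierENorm_le_of_countable (u := (0 : G → ℂ)) (ι := Empty)
    (fun i => i.elim) (fun i => i.elim) (by simp)

theorem fourierENorm_add_le (u v : G → ℂ) :
    fourierENorm (u + v) ≤ fourierENorm u + fourierENorm v := by
  have := fourierENorm_le_tsum (u := u + v) (fun b : Bool => cond b u v) (fun s => by
    simp)
  simpa using this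

theorem fourierENorm_smul_le (c : ℂ) (u : G → ℂ) :
    fourierENorm (c • u) ≤ ‖c‖ₑ * fourierENorm u := by
  by_cases hc : c = 0
  · subst hc; simp [fourierENorm_zero]
  have hc' : ‖c‖ₑ ≠ 0 := by simpa using hc
  rw [← ENNReal.inv_mul_le_iff hc' enorm_ne_top]
  refine le_iInf fun ξ => le_iInf fun η => le_iInf fun h => ?_
  rw [ENNReal.inv_mul_le_iff hc' enorm_ne_top, ← ENNReal.tsum_mul_left]
  have := fourierENorm_le_of_countable (u := c • u) (fun n => c • ξ n) η (fun s => by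
    simp [coeff, h.2 s, inner_smul_right, tsum_mul_left])
  simpa [enorm_smul, mul_assoc] using this

/-- Square-integrable function attached to a compactly supported continuous one. -/
theorem memLp_two {f : G → ℂ} (hf : Continuous f) (hc : HasCompactSupport f) :
    MemLp f 2 (Measure.haar : Measure G) := hf.memLp_of_hasCompactSupport hc

theorem continuous_leftReg (h : L2 G) : Continuous fun s : G => leftReg s h := by
  have : ∀ s : G, leftReg s h = DomMulAct.mk s⁻¹ • h := fun s => rfl
  have h2 : Fact ((2 : ℝ≥0∞) ≠ ∞) := ⟨by simp⟩
  simp_rw [this]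
  exact (DomMulAct.continuous_mk.comp continuous_inv).smul continuous_const

theorem leftReg_mul (s t : G) (h : L2 G) : leftReg (s * t) h = leftReg s (leftReg t h) := by
  have : ∀ (s : G) (h : L2 G), leftReg s h = DomMulAct.mk s⁻¹ • h := fun s h => rfl
  simp_rw [this, smul_smul]
  rw [mul_inv_rev, DomMulAct.mk_mul]

theorem leftReg_one (h : L2 G) : leftReg (1 : G) h = h := by
  have : leftReg (1 : G) h = DomMulAct.mk (1 : G)⁻¹ • h := rfl
  rw [this, inv_one, DomMulAct.mk_one, one_smul]

theorem inner_leftReg (s : G) (h k : L2 G) : inner ℂ (leftReg s h) (leftReg s k) = inner ℂ h k :=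
  LinearIsometry.inner_map_map _ _ _

theorem leftReg_toLp {f : G → ℂ} (hf : MemLp f 2 (Measure.haar : Measure G)) (s : G) :
    leftReg s (hf.toLp f) =
    (hf.comp_measurePreserving (measurePreserving_mul_left Measure.haar s⁻¹)).toLp
      (fun x => f (s⁻¹ * x)) := rfl

theorem inner_toLp {f g : G → ℂ} (hf : MemLp f 2 (Measure.haar : Measure G))
    (hg : MemLp g 2 (Measure.haar : Measure G)) :
    inner ℂ (hg.toLp g) (hf.toLp f) = ∫ x, f x * star (g x) ∂Measure.haar := by
  rw [L2.inner_def]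
  refine integral_congr_ae ?_
  filter_upwards [hf.coeFn_toLp, hg.coeFn_toLp] with x h1 h2
  rw [h1, h2]; rfl

theorem norm_toLp_sq {f : G → ℂ} (hf : MemLp f 2 (Measure.haar : Measure G)) :
    ‖hf.toLp f‖ ^ 2 = ∫ x, ‖f x‖ ^ 2 ∂Measure.haar := by
  have h := inner_toLp hf hf
  rw [inner_self_eq_norm_sq_to_K] at h
  have : ∀ x, f x * star (f x) = ((‖f x‖ ^ 2 : ℝ) : ℂ) := fun x => by
    rw [← Complex.normSq_eq_norm_sq, ← Complex.mul_conj]; rfl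
  simp_rw [this] at h
  rw [integral_complex_ofReal] at h
  have h' : ((‖hf.toLp f‖ ^ 2 : ℝ) : ℂ) = ((∫ x, ‖f x‖ ^ 2 ∂Measure.haar : ℝ) : ℂ) := by
    rw [← h]; simp
  exact Complex.ofReal_injective h'

theorem tsum_mul_le_of_sq {ι : Type*} {a b : ι → ℝ≥0∞} {A B : ℝ≥0∞}
    (ha : ∑' i, a i ^ 2 ≤ A ^ 2) (hb : ∑' i, b i ^ 2 ≤ B ^ 2) : ∑' i, a i * b i ≤ A * B := by
  rw [ENNReal.tsum_eq_iSup_sum]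
  refine iSup_le fun S => ?_
  refine (ENNReal.inner_le_Lp_mul_Lq S a b (p := 2) (q := 2)
    (by exact_mod_cast Real.HolderConjugate.two_two)).trans ?_
  have key : ∀ {c : ι → ℝ≥0∞} {C : ℝ≥0∞}, ∑' i, c i ^ 2 ≤ C ^ 2 →
      (∑ i ∈ S, c i ^ (2 : ℝ)) ^ (1 / (2 : ℝ)) ≤ C := by
    intro c C h
    have : ∑ i ∈ S, c i ^ (2 : ℝ) ≤ C ^ (2 : ℝ) := by
      simpa using (ENNReal.sum_le_tsum S).trans h
    calc _ ≤ (C ^ (2 : ℝ)) ^ (1 / (2 : ℝ)) := by gcongr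
      _ = C := by rw [← ENNReal.rpow_mul]; norm_num
  gcongr
  · exact key ha
  · exact key hb

theorem lintegral_mul_le_toLp {f g : G → ℂ} (hf : MemLp f 2 (Measure.haar : Measure G))
    (hg : MemLp g 2 (Measure.haar : Measure G)) :
    ∫⁻ x, ‖f x * star (g x)‖ₑ ∂Measure.haar ≤ ‖hf.toLp f‖ₑ * ‖hg.toLp g‖ₑ := by
  have := eLpNorm_smul_le_mul_eLpNorm (p := 2) (q := 2) (r := 1) hg.1 hf.1
  rw [eLpNorm_one_eq_lintegral_enorm] at this
  rw [Lp.enorm_toLp, Lp.enorm_toLp]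
  refine le_trans (le_of_eq ?_) this
  refine lintegral_congr fun x => ?_
  simp [enorm_mul]

/-- Products of coefficients, for compactly supported continuous vectors in one factor. -/
theorem fourierENorm_mul_aux {f g : G → ℂ} (hf : Continuous f) (hfc : HasCompactSupport f)
    (hg : Continuous g) (hgc : HasCompactSupport g) (h k : L2 G) :
    fourierENorm (fun s : G => coeff ((memLp_two hf hfc).toLp f) ((memLp_two hg hgc).toLp g)
      (leftReg s) * coeff h k (leftReg s)) ≤
    ‖(memLp_two hf hfc).toLp f‖ₑ * ‖(memLp_two hg hgc).toLp g‖ₑ * (‖h‖ₑ * ‖k‖ₑ) := by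
  obtain ⟨w, b, -⟩ := exists_hilbertBasis ℂ (L2 G)
  -- the coordinate functions of the orbit maps
  let c : L2 G → w → G → ℂ := fun h i x => inner ℂ (b i) (leftReg x⁻¹ h)
  have hcc : ∀ h i, Continuous (c h i) := fun h i =>
    continuous_const.inner ((continuous_leftReg h).comp continuous_inv)
  -- only countably many coordinates matter
  have hI : ∃ I : Set w, I.Countable ∧ ∀ i ∉ I, ∀ x, f x ≠ 0 → c h i x = 0 := by
    have hK : IsCompact ((fun x : G => leftReg x⁻¹ h) '' tsupport f) :=
      hfc.image ((continuous_leftReg h).comp continuous_inv)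
    obtain ⟨D, hD, hKD⟩ := hK.isSeparable
    refine ⟨⋃ y ∈ D, {i | inner ℂ (b i) y ≠ 0}, ?_, ?_⟩
    · refine hD.biUnion fun y _ => ?_
      have hs : Summable fun i => ‖(inner ℂ (b i) y : ℂ)‖ ^ 2 := by
        have := b.summable_inner_mul_inner y y
        refine (this.norm).congr fun i => ?_
        rw [norm_mul, norm_inner_symm y, sq]
      refine hs.countable_support.mono fun i hi => ?_
      simpa using hi
    · intro i hi x hx
      have hcl : IsClosed {y : L2 G | inner ℂ (b i) y = (0 : ℂ)} :=
        isClosed_eq (continuous_const.inner continuous_id) continuous_const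
      have : D ⊆ {y : L2 G | inner ℂ (b i) y = (0 : ℂ)} := by
        intro y hy
        by_contra hne
        exact hi (Set.mem_biUnion hy hne)
      exact (closure_minimal this hcl) (hKD ⟨x, subset_tsupport f hx, rfl⟩)
  obtain ⟨I, hIc, hI⟩ := hI
  have : Countable I := hIc.to_subtype
  -- the vectors of the new coefficient expansion
  have hF : ∀ (f : G → ℂ) (hf : Continuous f) (hfc : HasCompactSupport f) (h : L2 G) (i : w),
      MemLp (fun x => f x * c h i x) 2 (Measure.haar : Measure G) := fun f hf hfc h i =>
    memLp_two (hf.mul (hcc h i)) hfc.mul_right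
  have hbess : ∀ (y : L2 G) (S : Finset I), ∑ i ∈ S, ‖(inner ℂ (b i) y : ℂ)‖ ^ 2 ≤ ‖y‖ ^ 2 := by
    intro y S
    have h1 : Orthonormal ℂ fun i : I => b i := b.orthonormal.comp _ Subtype.val_injective
    exact h1.sum_inner_products_le y
  have hbound : ∀ (f : G → ℂ) (hf : Continuous f) (hfc : HasCompactSupport f) (h : L2 G),
      (∑' i : I, ‖(hF f hf hfc h i).toLp _‖ₑ ^ 2) ≤
        (‖(memLp_two hf hfc).toLp f‖ₑ * ‖h‖ₑ) ^ 2 := by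
    intro f hf hfc h
    rw [ENNReal.tsum_eq_iSup_sum]
    refine iSup_le fun S => ?_
    simp only [← ofReal_norm]
    simp only [← ENNReal.ofReal_pow (norm_nonneg _), ← ENNReal.ofReal_mul (norm_nonneg _)]
    rw [← ENNReal.ofReal_sum_of_nonneg (fun _ _ => by positivity), ← ENNReal.ofReal_pow
      (by positivity)]
    refine ENNReal.ofReal_le_ofReal ?_
    simp only [norm_toLp_sq, mul_pow]
    have hint : ∀ i : I, Integrable (fun x => ‖f x * c h i x‖ ^ 2) (Measure.haar : Measure G) :=
      fun i => (hF f hf hfc h i).integrable_norm_pow two_ne_zero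
    rw [← integral_finsetSum _ fun i _ => hint i, ← integral_mul_const]
    refine integral_mono (integrable_finsetSum _ fun i _ => hint i)
      (((memLp_two hf hfc).integrable_norm_pow two_ne_zero).mul_const _) fun x => ?_
    simp only [norm_mul, mul_pow, ← Finset.mul_sum]
    gcongr
    have := hbess (leftReg x⁻¹ h) S
    rwa [norm_leftReg] at this
  let F : I → L2 G := fun i => (hF f hf hfc h i).toLp _
  let E : I → L2 G := fun i => (hF g hg hgc k i).toLp _
  have hFE : ∑' i, ‖F i‖ₑ * ‖E i‖ₑ ≤
      ‖(memLp_two hf hfc).toLp f‖ₑ * ‖(memLp_two hg hgc).toLp g‖ₑ * (‖h‖ₑ * ‖k‖ₑ) := by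
    have h1 := hbound f hf hfc h
    have h2 := hbound g hg hgc k
    rw [mul_mul_mul_comm]
    exact tsum_mul_le_of_sq h1 h2
  refine (fourierENorm_le_of_countable F E fun s => ?_).trans hFE
  have hfs : MemLp (fun x => f (s⁻¹ * x)) 2 (Measure.haar : Measure G) :=
    (memLp_two hf hfc).comp_measurePreserving (measurePreserving_mul_left Measure.haar s⁻¹)
  have hFs : ∀ i : I, MemLp (fun x => f (s⁻¹ * x) * c h i (s⁻¹ * x)) 2
      (Measure.haar : Measure G) := fun i =>
    (hF f hf hfc h i).comp_measurePreserving (measurePreserving_mul_left Measure.haar s⁻¹)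
  have hFsn : ∀ i : I, ‖(hFs i).toLp _‖ₑ = ‖F i‖ₑ := fun i => by
    have := norm_leftReg s (F i)
    simp only [F, leftReg_toLp] at this
    simp only [← ofReal_norm, F, ← this]
  have hpt : ∀ x, f (s⁻¹ * x) * star (g x) * coeff h k (leftReg s) =
      ∑' i : I, (f (s⁻¹ * x) * c h i (s⁻¹ * x)) * star (g x * c k i x) := by
    intro x
    by_cases hx : f (s⁻¹ * x) = 0
    · simp [hx]
    have h1 : coeff h k (leftReg s) = ∑' i : w, c h i (s⁻¹ * x) * star (c k i x) := by
      rw [coeff, ← inner_leftReg x⁻¹, ← leftReg_mul, ← b.tsum_inner_mul_inner]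
      refine tsum_congr fun i => ?_
      simp only [c, mul_inv_rev, inv_inv]
      rw [mul_comm]
      congr 1
      exact (inner_conj_symm _ _).symm
    have h2 : ∑' i : w, c h i (s⁻¹ * x) * star (c k i x) =
        ∑' i : I, c h i (s⁻¹ * x) * star (c k i x) := by
      refine (tsum_subtype_eq_of_support_subset
        (f := fun i : w => c h i (s⁻¹ * x) * star (c k i x)) fun i hi => ?_).symm
      by_contra hne
      exact hi (by simp [hI i hne _ hx])
    rw [h1, h2, ← tsum_mul_left]
    refine tsum_congr fun i => ?_
    rw [star_mul']; ring
  have hl : coeff ((memLp_two hf hfc).toLp f) ((memLp_two hg hgc).toLp g) (leftReg s) =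
      ∫ x, f (s⁻¹ * x) * star (g x) ∂Measure.haar := by
    rw [coeff, leftReg_toLp, inner_toLp]
  have hr : ∀ i : I, coeff (F i) (E i) (leftReg s) =
      ∫ x, (f (s⁻¹ * x) * c h i (s⁻¹ * x)) * star (g x * c k i x) ∂Measure.haar := fun i => by
    simp only [coeff, F, E]
    rw [leftReg_toLp, inner_toLp]
  rw [hl, ← integral_mul_const]
  simp_rw [hpt, hr]
  refine integral_tsum (fun i => ?_) ?_
  · exact (hFs i).1.mul (hF g hg hgc k i).1.star
  · refine ne_top_of_le_ne_top ?_ ((ENNReal.tsum_le_tsum fun i =>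
      (lintegral_mul_le_toLp (hFs i) (hF g hg hgc k i)).trans_eq
        (by rw [hFsn])).trans hFE)
    exact ENNReal.mul_ne_top (ENNReal.mul_ne_top enorm_ne_top enorm_ne_top)
      (ENNReal.mul_ne_top enorm_ne_top enorm_ne_top)

/-- Density of the compactly supported continuous functions in `L²`. -/
theorem exists_compactSupport_approx {f : G → ℂ} (hf : MemLp f 2 (Measure.haar : Measure G))
    {ε : ℝ≥0∞} (hε : ε ≠ 0) :
    ∃ g : G → ℂ, eLpNorm (f - g) 2 Measure.haar ≤ ε ∧ (Continuous g ∧ HasCompactSupport g) := by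
  refine MemLp.induction_dense (by simp) _ ?_ (fun f g hf hg => ⟨hf.1.add hg.1, hf.2.add hg.2⟩)
    (fun f hf => (memLp_two hf.1 hf.2).1) hf hε
  intro c t ht htμ ε hε
  obtain ⟨η, ηpos, hη⟩ : ∃ η : ℝ≥0, 0 < η ∧ ∀ s : Set G, (Measure.haar : Measure G) s ≤ η →
      eLpNorm (s.indicator fun _ => c) 2 Measure.haar ≤ ε :=
    exists_eLpNorm_indicator_le (by simp) c hε
  have hη2 : ((η / 2 : ℝ≥0) : ℝ≥0∞) ≠ 0 := by
    simpa using (half_pos ηpos).ne'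
  obtain ⟨K, Kt, K_compact, K_closed, hK⟩ :=
    ht.exists_isCompact_isClosed_sdiff_lt htμ.ne hη2
  obtain ⟨V, KV, V_open, hVfin, hV⟩ := K_closed.measurableSet.exists_isOpen_sdiff_lt
    ((measure_mono Kt).trans_lt htμ).ne hη2
  obtain ⟨φ, hφK, hφV, hφc, hφ⟩ := exists_continuous_one_zero_of_isCompact K_compact
    V_open.isClosed_compl (Set.disjoint_compl_right_iff_subset.2 KV)
  refine ⟨fun x => (φ x : ℂ) * c, ?_, (Complex.continuous_ofReal.comp φ.continuous).mul
    continuous_const, ?_⟩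
  · refine (eLpNorm_mono (g := ((V \ K) ∪ (t \ K)).indicator fun _ => c) fun x => ?_).trans
      (hη _ ?_)
    · by_cases hxK : x ∈ K
      · simp [hxK, Kt hxK, hφK hxK]
      · by_cases hxV : x ∈ V
        · have hx : x ∈ (V \ K) ∪ (t \ K) := Or.inl ⟨hxV, hxK⟩
          rw [Set.indicator_of_mem hx]
          by_cases hxt : x ∈ t
          · simp only [Pi.sub_apply, Set.indicator_of_mem hxt]
            have : (φ x : ℂ) * c - c = ((φ x - 1 : ℝ) : ℂ) * c := by push_cast; ring
            rw [this, norm_mul, Complex.norm_real, Real.norm_eq_abs]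
            refine mul_le_of_le_one_left (norm_nonneg _) ?_
            rw [abs_le]; constructor <;> linarith [(hφ x).1, (hφ x).2]
          · simp only [Pi.sub_apply, Set.indicator_of_notMem hxt, sub_zero]
            rw [norm_mul, Complex.norm_real, Real.norm_eq_abs]
            refine mul_le_of_le_one_left (norm_nonneg _) ?_
            rw [abs_le]; constructor <;> linarith [(hφ x).1, (hφ x).2]
        · have h0 : φ x = 0 := hφV hxV
          by_cases hxt : x ∈ t
          · have hx : x ∈ (V \ K) ∪ (t \ K) := Or.inr ⟨hxt, hxK⟩
            simp [Set.indicator_of_mem hx, hxt, h0]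
          · simp [hxt, h0]
    · calc _ ≤ (Measure.haar : Measure G) (V \ K) + Measure.haar (t \ K) := measure_union_le _ _
        _ ≤ ((η / 2 : ℝ≥0) : ℝ≥0∞) + ((η / 2 : ℝ≥0) : ℝ≥0∞) := add_le_add hV.le hK.le
        _ = η := by rw [← ENNReal.coe_add, add_halves]
  · exact HasCompactSupport.mul_right (f' := fun _ => c)
      (hφc.comp_left (g := fun r : ℝ => (r : ℂ)) Complex.ofReal_zero)

/-- Every square-integrable function is a sum of compactly supported continuous ones with
almost the same total norm. -/
theorem exists_compactSupport_sum (f : L2 G) {ε : ℝ≥0} (hε : 0 < ε) :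
    ∃ w : ℕ → L2 G, (∀ n, ∃ (v : G → ℂ) (hv : Continuous v) (hc : HasCompactSupport v),
      (memLp_two hv hc).toLp v = w n) ∧ ∑' n, ‖w n‖ₑ ≤ ‖f‖ₑ + ε ∧ HasSum w f := by
  let S : AddSubgroup (L2 G) :=
    { carrier := {f | ∃ (v : G → ℂ) (hv : Continuous v) (hc : HasCompactSupport v),
        (memLp_two hv hc).toLp v = f}
      zero_mem' := ⟨0, continuous_zero, HasCompactSupport.zero, rfl⟩
      add_mem' := by
        rintro _ _ ⟨v, hv, hc, rfl⟩ ⟨v', hv', hc', rfl⟩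
        exact ⟨v + v', hv.add hv', hc.add hc', rfl⟩
      neg_mem' := by
        rintro _ ⟨v, hv, hc, rfl⟩
        exact ⟨-v, hv.neg, hc.neg, rfl⟩ }
  have hmem : f ∈ closure (S : Set (L2 G)) := by
    rw [EMetric.mem_closure_iff]
    intro δ hδ
    obtain ⟨g, hle, hg, hgc⟩ := exists_compactSupport_approx (Lp.memLp f)
      (ENNReal.half_pos hδ.ne').ne'
    by_cases hδt : δ = ∞
    · exact ⟨0, S.zero_mem, by rw [hδt]; exact edist_lt_top _ _⟩
    refine ⟨_, ⟨g, hg, hgc, rfl⟩, ?_⟩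
    nth_rewrite 1 [← Lp.toLp_coeFn f (Lp.memLp f)]
    rw [Lp.edist_toLp_toLp]
    exact hle.trans_lt (ENNReal.half_lt_self hδ.ne' hδt)
  let b : ℕ → ℝ := fun n => ε / 2 / 2 ^ (n + 1)
  have hb : ∀ n, 0 < b n := fun n => by positivity
  obtain ⟨w, hw, hwS, hw0, hwn⟩ := controlled_sum_of_mem_closure hmem hb
  have hbs : HasSum b (ε / 2) := by
    refine (hasSum_geometric_two' (ε / 2 : ℝ)).congr_fun fun n => ?_
    simp only [b, pow_succ]
    field_simp
  have hle : ∀ n, ‖w n‖ ≤ (if n = 0 then ‖f‖ + b 0 else 0) + b n := by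
    intro n
    by_cases hn : n = 0
    · subst hn
      have : ‖w 0‖ ≤ ‖f‖ + ‖-w 0 + f‖ := by
        have := norm_sub_le f (-w 0 + f)
        simpa using this
      simp only [if_true]
      linarith [hb 0]
    · simpa [hn] using (hwn n (Nat.pos_of_ne_zero hn)).le
  have hs : HasSum (fun n => (if n = 0 then ‖f‖ + b 0 else 0) + b n) (‖f‖ + b 0 + ε / 2) :=
    (hasSum_ite_eq 0 (‖f‖ + b 0)).add hbs
  have hws : Summable fun n => ‖w n‖ := Summable.of_nonneg_of_le (fun _ => norm_nonneg _) hle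
    hs.summable
  refine ⟨w, hwS, ?_, ?_⟩
  · have h1 : ∑' n, ‖w n‖ ≤ ‖f‖ + ε := by
      refine (hws.tsum_le_tsum hle hs.summable).trans ?_
      rw [hs.tsum_eq]
      have : b 0 = ε / 4 := by simp only [b]; ring
      rw [this]
      have : (0 : ℝ) < ε := hε
      linarith
    simp only [← ofReal_norm]
    rw [← ENNReal.ofReal_tsum_of_nonneg (fun _ => norm_nonneg _) hws]
    refine (ENNReal.ofReal_le_ofReal h1).trans_eq ?_
    rw [ENNReal.ofReal_add (norm_nonneg f) (NNReal.coe_nonneg ε), ENNReal.ofReal_coe_nnreal]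
  · have h1 := hws.of_norm.hasSum
    have h2 := (Filter.tendsto_add_atTop_iff_nat 1).2 h1.tendsto_sum_nat
    rwa [tendsto_nhds_unique h2 hw] at h1

theorem inner_eq_tsum_prod {H : Type*} [NormedAddCommGroup H] [InnerProductSpace ℂ H]
    (L : H →L[ℂ] H) {V W : ℕ → H} {f g : H} (hV : HasSum V f) (hW : HasSum W g)
    (hs : Summable fun p : ℕ × ℕ => (inner ℂ (W p.2) (L (V p.1)) : ℂ)) :
    inner ℂ g (L f) = ∑' p : ℕ × ℕ, (inner ℂ (W p.2) (L (V p.1)) : ℂ) := by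
  have h1 : ∀ m, HasSum (fun n => (inner ℂ (W n) (L (V m)) : ℂ)) (inner ℂ g (L (V m))) := by
    intro m
    have h2 : HasSum (fun n => star (inner ℂ (L (V m)) (W n) : ℂ))
      (star (inner ℂ (L (V m)) g)) := ((innerSL ℂ (L (V m))).hasSum hW).star
    have h3 : ∀ y : H, star (inner ℂ (L (V m)) y : ℂ) = inner ℂ y (L (V m)) :=
      fun y => inner_conj_symm _ _
    simpa only [h3] using h2
  rw [hs.tsum_prod]
  simp_rw [fun m => (h1 m).tsum_eq]
  have h4 : HasSum (fun n => (inner ℂ g (L (V n)) : ℂ)) (inner ℂ g (L f)) :=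
    ((innerSL ℂ g).comp L).hasSum hV
  exact h4.tsum_eq.symm

theorem fourierENorm_coeff_mul_le_of_sum {f g h k : L2 G} {V W : ℕ → L2 G} {A B : ℝ≥0∞}
    (hA : A ≠ ∞) (hB : B ≠ ∞)
    (hvle : ∑' n, ‖V n‖ₑ ≤ A) (hwle : ∑' n, ‖W n‖ₑ ≤ B) (hvs : HasSum V f) (hws : HasSum W g)
    (haux : ∀ m n, fourierENorm (fun s : G => coeff (V m) (W n) (leftReg s) *
      coeff h k (leftReg s)) ≤ ‖V m‖ₑ * ‖W n‖ₑ * (‖h‖ₑ * ‖k‖ₑ)) :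
    fourierENorm (fun s : G => coeff f g (leftReg s) * coeff h k (leftReg s)) ≤
      A * B * (‖h‖ₑ * ‖k‖ₑ) := by
  have hsum : ∑' p : ℕ × ℕ, ‖V p.1‖ₑ * ‖W p.2‖ₑ * (‖h‖ₑ * ‖k‖ₑ) =
      (∑' n, ‖V n‖ₑ) * (∑' n, ‖W n‖ₑ) * (‖h‖ₑ * ‖k‖ₑ) := by
    rw [ENNReal.tsum_prod']
    simp only [ENNReal.tsum_mul_right, ENNReal.tsum_mul_left]
  have hle : ∑' p : ℕ × ℕ, ‖V p.1‖ₑ * ‖W p.2‖ₑ * (‖h‖ₑ * ‖k‖ₑ) ≤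
      A * B * (‖h‖ₑ * ‖k‖ₑ) := by
    rw [hsum]; gcongr
  have hfin : ∑' p : ℕ × ℕ, ‖V p.1‖ₑ * ‖W p.2‖ₑ ≠ ∞ := by
    rw [ENNReal.tsum_prod']
    simp only [ENNReal.tsum_mul_right, ENNReal.tsum_mul_left]
    exact ENNReal.mul_ne_top (ne_top_of_le_ne_top hA hvle) (ne_top_of_le_ne_top hB hwle)
  let z : ℕ × ℕ → G → ℂ := fun p s => coeff (V p.1) (W p.2) (leftReg s) * coeff h k (leftReg s)
  have hz : ∀ s, coeff f g (leftReg s) * coeff h k (leftReg s) = ∑' p, z p s := by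
    intro s
    have hsm : Summable fun p : ℕ × ℕ => coeff (V p.1) (W p.2) (leftReg s) :=
      summable_of_enorm hfin fun p => enorm_coeff_le _ _ s
    have e : coeff f g (leftReg s) = ∑' p : ℕ × ℕ, coeff (V p.1) (W p.2) (leftReg s) :=
      inner_eq_tsum_prod (leftReg s) hvs hws hsm
    rw [e, ← tsum_mul_right]
  have h1 := fourierENorm_le_tsum z hz
  have h2 : ∑' p, fourierENorm (z p) ≤ ∑' p : ℕ × ℕ, ‖V p.1‖ₑ * ‖W p.2‖ₑ * (‖h‖ₑ * ‖k‖ₑ) :=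
    ENNReal.tsum_le_tsum fun p => haux p.1 p.2
  exact h1.trans (h2.trans hle)

theorem tendsto_add_mul_add {A B C : ℝ≥0∞} (hA : A ≠ ∞) (hB : B ≠ ∞) (hC : C ≠ ∞) :
    Tendsto (fun ε : ℝ≥0 => (A + ε) * (B + ε) * C)
      (𝓝[>] 0) (nhds (A * B * C)) := by
  have h : ∀ A : ℝ≥0∞, Tendsto (fun ε : ℝ≥0 => A + ε)
      (𝓝[>] 0) (nhds A) := fun A => by
    have : Continuous fun ε : ℝ≥0 => A + ε := by fun_prop
    simpa using (this.tendsto 0).mono_left nhdsWithin_le_nhds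
  refine ENNReal.Tendsto.mul_const (ENNReal.Tendsto.mul (h A) (Or.inr hB) (h B) (Or.inr hA))
    (Or.inr hC)

/-- The Fourier norm is submultiplicative on products of two coefficient functions. -/
theorem fourierENorm_coeff_mul_le (f g h k : L2 G) :
    fourierENorm (fun s : G => coeff f g (leftReg s) * coeff h k (leftReg s)) ≤
      ‖f‖ₑ * ‖g‖ₑ * (‖h‖ₑ * ‖k‖ₑ) := by
  refine ge_of_tendsto (tendsto_add_mul_add enorm_ne_top enorm_ne_top
    (ENNReal.mul_ne_top enorm_ne_top enorm_ne_top)) ?_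
  filter_upwards [self_mem_nhdsWithin] with ε hε
  obtain ⟨V, hV, hvle, hvs⟩ := exists_compactSupport_sum f hε
  obtain ⟨W, hW, hwle, hws⟩ := exists_compactSupport_sum g hε
  refine fourierENorm_coeff_mul_le_of_sum (by simp) (by simp) hvle hwle hvs hws fun m n => ?_
  obtain ⟨v, hv, hvc, e1⟩ := hV m
  obtain ⟨w, hw, hwc, e2⟩ := hW n
  rw [← e1, ← e2]
  exact fourierENorm_mul_aux hv hvc hw hwc h k

/-- The Fourier norm is submultiplicative for pointwise products. -/
theorem fourierENorm_mul_le (u v : G → ℂ) :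
    fourierENorm (u * v) ≤ fourierENorm u * fourierENorm v := by
  have key : ∀ ξ η ξ' η', IsFourierRep u ξ η → IsFourierRep v ξ' η' →
      fourierENorm (u * v) ≤ (∑' n, ‖ξ n‖ₑ * ‖η n‖ₑ) * (∑' n, ‖ξ' n‖ₑ * ‖η' n‖ₑ) := by
    intro ξ η ξ' η' h h'
    have e : (∑' n, ‖ξ n‖ₑ * ‖η n‖ₑ) * (∑' n, ‖ξ' n‖ₑ * ‖η' n‖ₑ) =
        ∑' p : ℕ × ℕ, ‖ξ p.1‖ₑ * ‖η p.1‖ₑ * (‖ξ' p.2‖ₑ * ‖η' p.2‖ₑ) := by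
      rw [ENNReal.tsum_prod']
      simp only [ENNReal.tsum_mul_right, ENNReal.tsum_mul_left]
    rw [e]
    refine (fourierENorm_le_tsum (fun p : ℕ × ℕ => fun s => coeff (ξ p.1) (η p.1) (leftReg s) *
      coeff (ξ' p.2) (η' p.2) (leftReg s)) fun s => ?_).trans
      (ENNReal.tsum_le_tsum fun p => fourierENorm_coeff_mul_le _ _ _ _)
    have hs : Summable fun p : ℕ × ℕ => coeff (ξ p.1) (η p.1) (leftReg s) *
        coeff (ξ' p.2) (η' p.2) (leftReg s) := by
      refine summable_of_enorm (e ▸ ENNReal.mul_ne_top h.1 h'.1) fun p => ?_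
      rw [enorm_mul]
      exact mul_le_mul' (enorm_coeff_le _ _ s) (enorm_coeff_le _ _ s)
    rw [hs.tsum_prod]
    simp only [tsum_mul_left, tsum_mul_right, Pi.mul_apply, h.2 s, h'.2 s]
  by_cases hu : fourierENorm u = ∞
  · by_cases hv : fourierENorm v = 0
    · have hv0 : v = 0 := by
        funext s
        simpa [hv] using enorm_apply_le v s
      simp [hv0, fourierENorm_zero]
    · simp [hu, ENNReal.top_mul hv]
  by_cases hv : fourierENorm v = ∞
  · by_cases hu : fourierENorm u = 0
    · have hu0 : u = 0 := by
        funext s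
        simpa [hu] using enorm_apply_le u s
      simp [hu0, fourierENorm_zero]
    · simp [hv, ENNReal.mul_top hu]
  have hlim := tendsto_add_mul_add hu hv ENNReal.one_ne_top
  simp only [mul_one] at hlim
  refine ge_of_tendsto hlim ?_
  filter_upwards [self_mem_nhdsWithin] with ε hε
  have hε' : (ε : ℝ≥0∞) ≠ 0 := by simpa using (show (0 : ℝ≥0) < ε from hε).ne'
  obtain ⟨ξ, η, h, hl⟩ := exists_rep_lt (ENNReal.lt_add_right hu hε')
  obtain ⟨ξ', η', h', hl'⟩ := exists_rep_lt (ENNReal.lt_add_right hv hε')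
  exact (key _ _ _ _ h h').trans (mul_le_mul' hl.le hl'.le)

theorem sum_inner_eq_zero_of_bicommutant {H ι : Type*} [NormedAddCommGroup H]
    [InnerProductSpace ℂ H] [CompleteSpace H] (S : Set (H →L[ℂ] H)) (h1 : 1 ∈ S)
    (hm : ∀ a ∈ S, ∀ b ∈ S, a * b ∈ S)
    (hs : ∀ a ∈ S, ContinuousLinearMap.adjoint a ∈ S) {T : H →L[ℂ] H}
    (hT : T ∈ Set.centralizer (Set.centralizer S)) (ξ η : lp (fun _ : ι => H) 2)
    (h0 : ∀ a ∈ S, ∑' i, inner ℂ (η i) (a (ξ i)) = 0) :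
    ∑' i, inner ℂ (η i) (T (ξ i)) = 0 := by
  classical
  let amp : (H →L[ℂ] H) → (lp (fun _ : ι => H) 2 →L[ℂ] lp (fun _ : ι => H) 2) := fun a =>
    lp.mapCLM 2 (fun _ => a) (norm_nonneg a) (fun _ => le_rfl)
  have amp_apply : ∀ a x i, amp a x i = a (x i) := fun a x i => rfl
  have amp_single : ∀ a j y, amp a (lp.single 2 j y) = lp.single 2 j (a y) := by
    intro a j y
    ext i
    rw [amp_apply, lp.single_apply, lp.single_apply]
    by_cases h : i = j
    · subst h; simp
    · simp [h]
  have amp_mul : ∀ a b x, amp (a * b) x = amp a (amp b x) := fun a b x => rfl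
  have amp_inner : ∀ a x y, inner ℂ (amp (ContinuousLinearMap.adjoint a) x) y =
      inner ℂ x (amp a y) := by
    intro a x y
    rw [lp.inner_eq_tsum, lp.inner_eq_tsum]
    refine tsum_congr fun i => ?_
    rw [amp_apply, amp_apply, ContinuousLinearMap.adjoint_inner_left]
  let M : Submodule ℂ (lp (fun _ : ι => H) 2) :=
    (Submodule.span ℂ ((fun a => amp a ξ) '' S)).topologicalClosure
  have hMc : IsClosed (M : Set (lp (fun _ : ι => H) 2)) :=
    Submodule.isClosed_topologicalClosure _
  have : CompleteSpace M := hMc.completeSpace_coe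
  have hinv : ∀ a ∈ S, ∀ x ∈ M, amp a x ∈ M := by
    intro a ha
    have : M ≤ M.comap (amp a).toLinearMap := by
      refine Submodule.topologicalClosure_minimal _ ?_ (hMc.preimage (amp a).continuous)
      rw [Submodule.span_le]
      rintro _ ⟨b, hb, rfl⟩
      refine Submodule.le_topologicalClosure _ (Submodule.subset_span ⟨a * b, hm a ha b hb, ?_⟩)
      exact amp_mul a b ξ
    exact this
  have hinv' : ∀ a ∈ S, ∀ x ∈ Mᗮ, amp a x ∈ Mᗮ := by
    intro a ha x hx
    rw [Submodule.mem_orthogonal] at hx ⊢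
    intro u hu
    rw [← amp_inner]
    exact hx _ (hinv _ (hs a ha) u hu)
  have hcomm : ∀ a ∈ S, ∀ x, M.starProjection (amp a x) = amp a (M.starProjection x) := by
    intro a ha x
    refine Submodule.eq_starProjection_of_mem_orthogonal
      (hinv a ha _ (M.starProjection_apply_mem x)) ?_
    rw [← map_sub]
    exact hinv' a ha _ (M.sub_starProjection_mem_orthogonal x)
  have hTP : (amp T).comp M.starProjection = M.starProjection.comp (amp T) := by
    refine lp.ext_continuousLinearMap (by simp) fun j => ?_
    ext y i
    let Pij : H →L[ℂ] H := (lp.evalCLM ℂ (fun _ : ι => H) 2 i).comp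
      (M.starProjection.comp (lp.singleContinuousLinearMap ℂ (fun _ : ι => H) 2 j))
    have hP : Pij ∈ Set.centralizer S := by
      intro a ha
      ext z
      have := congrArg (fun x => x i) (hcomm a ha (lp.single 2 j z))
      simp only [amp_single] at this
      exact this.symm
    have := congrArg (fun f : H →L[ℂ] H => f y) (hT Pij hP)
    have e : M.starProjection (amp T (lp.single 2 j y)) = M.starProjection (lp.single 2 j (T y)) := by
      rw [amp_single]
    have e' := congrArg (fun x => x i) e
    exact (this.symm).trans e'.symm
  have hξ : ξ ∈ M := by
    refine Submodule.le_topologicalClosure _ (Submodule.subset_span ⟨1, h1, ?_⟩)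
    rfl
  have hTξ : amp T ξ ∈ M := by
    have h := congrArg (fun f : lp (fun _ : ι => H) 2 →L[ℂ] lp (fun _ : ι => H) 2 => f ξ) hTP
    simp only [ContinuousLinearMap.comp_apply, Submodule.starProjection_eq_self_iff.2 hξ] at h
    rw [h]
    exact M.starProjection_apply_mem _
  have hη : M ≤ (Submodule.span ℂ {η})ᗮ := by
    refine Submodule.topologicalClosure_minimal _ ?_ (Submodule.isClosed_orthogonal _)
    rw [Submodule.span_le]
    rintro _ ⟨a, ha, rfl⟩
    rw [SetLike.mem_coe, Submodule.mem_orthogonal_singleton_iff_inner_right, lp.inner_eq_tsum]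
    exact h0 a ha
  have := hη hTξ
  rwa [Submodule.mem_orthogonal_singleton_iff_inner_right, lp.inner_eq_tsum] at this

/-- Version for absolutely convergent sums. -/
theorem sum_inner_eq_zero_of_bicommutant' {H ι : Type*} [NormedAddCommGroup H]
    [InnerProductSpace ℂ H] [CompleteSpace H] (S : Set (H →L[ℂ] H)) (h1 : 1 ∈ S)
    (hm : ∀ a ∈ S, ∀ b ∈ S, a * b ∈ S)
    (hs : ∀ a ∈ S, ContinuousLinearMap.adjoint a ∈ S) {T : H →L[ℂ] H}
    (hT : T ∈ Set.centralizer (Set.centralizer S)) (ξ η : ι → H)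
    (hfin : ∑' i, ‖ξ i‖ₑ * ‖η i‖ₑ ≠ ∞)
    (h0 : ∀ a ∈ S, ∑' i, inner ℂ (η i) (a (ξ i)) = 0) :
    ∑' i, inner ℂ (η i) (T (ξ i)) = 0 := by
  classical
  have hsum : Summable fun i => ‖ξ i‖ * ‖η i‖ := by
    have : ∑' i, ((‖ξ i‖₊ * ‖η i‖₊ : ℝ≥0) : ℝ≥0∞) ≠ ∞ := by simpa [enorm] using hfin
    have := NNReal.summable_coe.2 (ENNReal.tsum_coe_ne_top_iff_summable.1 this)
    simpa using this
  let c : ι → ℝ := fun i => √(‖η i‖ / ‖ξ i‖)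
  let ξ' : ι → H := fun i => (c i : ℂ) • ξ i
  let η' : ι → H := fun i => ((c i)⁻¹ : ℂ) • η i
  have hξ' : ∀ i, ‖ξ' i‖ ^ 2 ≤ ‖ξ i‖ * ‖η i‖ := by
    intro i
    simp only [ξ', norm_smul, mul_pow, Complex.norm_real, Real.norm_eq_abs, sq_abs, c]
    rw [Real.sq_sqrt (by positivity)]
    rcases eq_or_ne (‖ξ i‖) 0 with h | h
    · simp [h]
    · exact le_of_eq (by field_simp)
  have hη' : ∀ i, ‖η' i‖ ^ 2 ≤ ‖ξ i‖ * ‖η i‖ := by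
    intro i
    simp only [η', norm_smul, mul_pow, norm_inv, inv_pow, Complex.norm_real, Real.norm_eq_abs,
      sq_abs, c]
    rw [Real.sq_sqrt (by positivity)]
    rcases eq_or_ne (‖η i‖) 0 with h | h
    · simp [h]
    · exact le_of_eq (by field_simp)
  have hinner : ∀ (a : H →L[ℂ] H) i, inner ℂ (η' i) (a (ξ' i)) = inner ℂ (η i) (a (ξ i)) := by
    intro a i
    simp only [ξ', η', map_smul, inner_smul_left, inner_smul_right]
    rcases eq_or_ne (ξ i) 0 with h | h
    · simp [h]
    rcases eq_or_ne (η i) 0 with h' | h'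
    · simp [h']
    have hc : (c i : ℂ) ≠ 0 := by
      have : 0 < c i := Real.sqrt_pos.2 (div_pos (norm_pos_iff.2 h') (norm_pos_iff.2 h))
      exact_mod_cast this.ne'
    rw [map_inv₀, Complex.conj_ofReal, ← mul_assoc, mul_inv_cancel₀ hc, one_mul]
  have mem : ∀ x : ι → H, (∀ i, ‖x i‖ ^ 2 ≤ ‖ξ i‖ * ‖η i‖) → Memℓp x 2 := by
    intro x hx
    refine memℓp_gen ?_
    simp only [ENNReal.toReal_ofNat, Real.rpow_two]
    exact Summable.of_nonneg_of_le (fun _ => by positivity) hx hsum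
  have := sum_inner_eq_zero_of_bicommutant S h1 hm hs hT ⟨ξ', mem ξ' hξ'⟩ ⟨η', mem η' hη'⟩
    (fun a ha => by simpa only [hinner] using h0 a ha)
  simpa only [hinner] using this

/-- Two absolutely convergent sums of vector functionals that agree on `S` agree on `S''`. -/
theorem sum_inner_eq_of_bicommutant {H : Type*} [NormedAddCommGroup H]
    [InnerProductSpace ℂ H] [CompleteSpace H] (S : Set (H →L[ℂ] H)) (h1 : 1 ∈ S)
    (hm : ∀ a ∈ S, ∀ b ∈ S, a * b ∈ S)
    (hs : ∀ a ∈ S, ContinuousLinearMap.adjoint a ∈ S) {T : H →L[ℂ] H}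
    (hT : T ∈ Set.centralizer (Set.centralizer S)) (ξ η ξ' η' : ℕ → H)
    (hfin : ∑' i, ‖ξ i‖ₑ * ‖η i‖ₑ ≠ ∞) (hfin' : ∑' i, ‖ξ' i‖ₑ * ‖η' i‖ₑ ≠ ∞)
    (h0 : ∀ a ∈ S, ∑' i, inner ℂ (η i) (a (ξ i)) = ∑' i, inner ℂ (η' i) (a (ξ' i))) :
    ∑' i, inner ℂ (η i) (T (ξ i)) = ∑' i, inner ℂ (η' i) (T (ξ' i)) := by
  let X : ℕ ⊕ ℕ → H := Sum.elim ξ ξ'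
  let Y : ℕ ⊕ ℕ → H := Sum.elim η (fun n => -η' n)
  have hXY : ∑' i, ‖X i‖ₑ * ‖Y i‖ₑ ≠ ∞ := by
    have h : HasSum (fun i => ‖X i‖ₑ * ‖Y i‖ₑ)
        (∑' i, ‖ξ i‖ₑ * ‖η i‖ₑ + ∑' i, ‖ξ' i‖ₑ * ‖η' i‖ₑ) := by
      refine HasSum.sum ENNReal.summable.hasSum ?_
      have : (fun i => ‖X i‖ₑ * ‖Y i‖ₑ) ∘ Sum.inr = fun i => ‖ξ' i‖ₑ * ‖η' i‖ₑ := by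
        funext i; simp [X, Y]
      rw [this]
      exact ENNReal.summable.hasSum
    rw [h.tsum_eq]
    exact ENNReal.add_ne_top.2 ⟨hfin, hfin'⟩
  have hsm : ∀ {ξ η : ℕ → H}, ∑' i, ‖ξ i‖ₑ * ‖η i‖ₑ ≠ ∞ → ∀ a : H →L[ℂ] H,
      Summable fun i => inner ℂ (η i) (a (ξ i)) := by
    intro ξ η hf a
    refine summable_of_enorm (g := fun n => ‖a‖ₑ * (‖ξ n‖ₑ * ‖η n‖ₑ)) ?_ fun n => ?_
    · rw [ENNReal.tsum_mul_left]
      exact ENNReal.mul_ne_top enorm_ne_top hf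
    · have h : ‖(inner ℂ (η n) (a (ξ n)) : ℂ)‖ ≤ ‖a‖ * (‖ξ n‖ * ‖η n‖) := by
        refine (norm_inner_le_norm (𝕜 := ℂ) (η n) (a (ξ n))).trans ?_
        calc ‖η n‖ * ‖a (ξ n)‖ ≤ ‖η n‖ * (‖a‖ * ‖ξ n‖) := by gcongr; exact a.le_opNorm _
          _ = _ := by ring
      simp only [← ofReal_norm, ← ENNReal.ofReal_mul (norm_nonneg _)]
      exact ENNReal.ofReal_le_ofReal h
  have hsplit : ∀ a : H →L[ℂ] H, ∑' i, inner ℂ (Y i) (a (X i)) =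
      ∑' i, inner ℂ (η i) (a (ξ i)) - ∑' i, inner ℂ (η' i) (a (ξ' i)) := by
    intro a
    have h : HasSum (fun i => inner ℂ (Y i) (a (X i)))
        (∑' i, inner ℂ (η i) (a (ξ i)) + -∑' i, inner ℂ (η' i) (a (ξ' i))) := by
      refine HasSum.sum (hsm hfin a).hasSum ?_
      have : (fun i => inner ℂ (Y i) (a (X i))) ∘ Sum.inr =
          fun i => -inner ℂ (η' i) (a (ξ' i)) := by
        funext i; simp [X, Y]
      rw [this]
      exact (hsm hfin' a).hasSum.neg
    rw [h.tsum_eq, sub_eq_add_neg]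
  have key := sum_inner_eq_zero_of_bicommutant' S h1 hm hs hT X Y hXY
    (fun a ha => by rw [hsplit, h0 a ha, sub_self])
  rw [hsplit] at key
  exact sub_eq_zero.1 key

/-- The group von Neumann algebra `VN(G)`: the von Neumann algebra generated by the left regular
representation, that is, the bicommutant of its (self-adjoint) range. -/
def groupVN (G : Type*) [Group G] [TopologicalSpace G] [IsTopologicalGroup G]
    [LocallyCompactSpace G] [MeasurableSpace G] [BorelSpace G] : Set (L2 G →L[ℂ] L2 G) :=
  Set.centralizer (Set.centralizer (Set.range (leftReg (G := G))))

/-- The predual pairing of `VN(G)` with `A(G)`: `⟨T, u⟩ = ∑ₙ ⟨T ξₙ, ηₙ⟩` if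
`u(s) = ∑ₙ ⟨λ(s) ξₙ, ηₙ⟩`. On `VN(G)` it does not depend on the chosen expansion. -/
def vnPairing (T : L2 G →L[ℂ] L2 G) (u : G → ℂ) : ℂ :=
  open scoped Classical in
  if h : ∃ p : (ℕ → L2 G) × (ℕ → L2 G), IsFourierRep u p.1 p.2 then
    ∑' n, coeff (h.choose.1 n) (h.choose.2 n) T
  else 0

/-- The pairing is well defined. -/
theorem vnPairing_eq {T : L2 G →L[ℂ] L2 G} (hT : T ∈ groupVN G) {u : G → ℂ} {ξ η : ℕ → L2 G}
    (h : IsFourierRep u ξ η) : vnPairing T u = ∑' n, coeff (ξ n) (η n) T := by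
  classical
  have hex : ∃ p : (ℕ → L2 G) × (ℕ → L2 G), IsFourierRep u p.1 p.2 := ⟨(ξ, η), h⟩
  rw [vnPairing, dif_pos hex]
  have h' := hex.choose_spec
  have hadj : ∀ s : G, ContinuousLinearMap.adjoint (leftReg s) = leftReg s⁻¹ := by
    intro s
    refine ((ContinuousLinearMap.eq_adjoint_iff _ _).2 fun x y => ?_).symm
    rw [← inner_leftReg s, ← leftReg_mul, mul_inv_cancel]
    congr 1
    exact leftReg_one x
  refine sum_inner_eq_of_bicommutant (Set.range (leftReg (G := G)))
    ⟨1, ContinuousLinearMap.ext leftReg_one⟩ ?_ ?_ hT _ _ _ _ h'.1 h.1 ?_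
  · rintro _ ⟨s, rfl⟩ _ ⟨t, rfl⟩
    exact ⟨s * t, ContinuousLinearMap.ext fun x => leftReg_mul s t x⟩
  · rintro _ ⟨s, rfl⟩
    exact ⟨s⁻¹, (hadj s).symm⟩
  · rintro _ ⟨s, rfl⟩
    exact (h'.2 s).symm.trans (h.2 s)

variable (G)

/-- The Fourier algebra `A(G)`, with pointwise operations: all functions
`u(s) = ∑ₙ ⟨λ(s) ξₙ, ηₙ⟩` with `ξₙ, ηₙ ∈ L²(G)` and `∑ₙ ‖ξₙ‖ ‖ηₙ‖ < ∞`. -/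
def fourierAlgebra : NonUnitalSubalgebra ℂ (G → ℂ) where
  carrier := {u | fourierENorm u ≠ ∞}
  zero_mem' := by simp [fourierENorm_zero]
  add_mem' hu hv :=
    ne_top_of_le_ne_top (ENNReal.add_ne_top.2 ⟨hu, hv⟩) (fourierENorm_add_le _ _)
  mul_mem' hu hv := ne_top_of_le_ne_top (ENNReal.mul_ne_top hu hv) (fourierENorm_mul_le _ _)
  smul_mem' c _ hu :=
    ne_top_of_le_ne_top (ENNReal.mul_ne_top enorm_ne_top hu) (fourierENorm_smul_le c _)

theorem integrable_mul {u v : G → ℂ} (hu : fourierENorm u ≠ ∞)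
    (hui : Integrable u Measure.haar) (hv : Integrable v Measure.haar) :
    Integrable (u * v) (Measure.haar : Measure G) := by
  refine hv.bdd_mul (c := (fourierENorm u).toReal) hui.1 (Filter.Eventually.of_forall fun s => ?_)
  rw [← toReal_enorm]
  exact ENNReal.toReal_mono hu (enorm_apply_le u s)

/-- The algebra `A(G) ∩ L¹(G)`, with pointwise operations. -/
def lebesgueFourier : NonUnitalSubalgebra ℂ (G → ℂ) where
  carrier := {u | u ∈ fourierAlgebra G ∧ Integrable u (Measure.haar : Measure G)}
  zero_mem' := ⟨zero_mem _, integrable_zero _ _ _⟩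
  add_mem' hu hv := ⟨add_mem hu.1 hv.1, hu.2.add hv.2⟩
  mul_mem' hu hv := ⟨mul_mem hu.1 hv.1, integrable_mul G hu.1 hu.2 hv.2⟩
  smul_mem' c _ hu := ⟨(fourierAlgebra G).smul_mem' c hu.1, hu.2.smul c⟩

/-- The Lebesgue-Fourier algebra `S¹A(G)`: the pointwise algebra `A(G) ∩ L¹(G)`, normed by
`‖u‖_{A(G)} + ‖u‖_{L¹(G)}` below. -/
def S1A : Type _ := lebesgueFourier G

instance : NonUnitalCommRing (S1A G) := inferInstanceAs (NonUnitalCommRing (lebesgueFourier G))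
instance : Module ℂ (S1A G) := inferInstanceAs (Module ℂ (lebesgueFourier G))
instance : IsScalarTower ℂ (S1A G) (S1A G) :=
  inferInstanceAs (IsScalarTower ℂ (lebesgueFourier G) (lebesgueFourier G))
instance : SMulCommClass ℂ (S1A G) (S1A G) :=
  inferInstanceAs (SMulCommClass ℂ (lebesgueFourier G) (lebesgueFourier G))
instance : FunLike (S1A G) G ℂ where
  coe u := u.1
  coe_injective := Subtype.val_injective

variable {G}

theorem S1A.fourierENorm_ne_top (u : S1A G) : fourierENorm (u : G → ℂ) ≠ ∞ := u.2.1
theorem S1A.integrable (u : S1A G) : Integrable u (Measure.haar : Measure G) := u.2.2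

instance : Norm (S1A G) where
  norm u := (fourierENorm (u : G → ℂ)).toReal + ∫ x, ‖u x‖ ∂Measure.haar

theorem S1A.norm_def (u : S1A G) :
    ‖u‖ = (fourierENorm (u : G → ℂ)).toReal + ∫ x, ‖u x‖ ∂Measure.haar := rfl

theorem S1A.norm_smul_le (c : ℂ) (u : S1A G) : ‖c • u‖ ≤ ‖c‖ * ‖u‖ := by
  rw [S1A.norm_def, S1A.norm_def, mul_add]
  refine add_le_add ?_ ?_
  · have := ENNReal.toReal_mono (ENNReal.mul_ne_top enorm_ne_top u.fourierENorm_ne_top)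
      (fourierENorm_smul_le c (u : G → ℂ))
    rwa [ENNReal.toReal_mul, toReal_enorm] at this
  · rw [← integral_const_mul]
    refine le_of_eq (integral_congr_ae (Filter.Eventually.of_forall fun x => ?_))
    exact norm_mul _ _

theorem S1A.norm_mul_le (u v : S1A G) : ‖u * v‖ ≤ ‖u‖ * ‖v‖ := by
  have h1 : (fourierENorm ((u * v : S1A G) : G → ℂ)).toReal ≤
      (fourierENorm (u : G → ℂ)).toReal * (fourierENorm (v : G → ℂ)).toReal := by
    have := ENNReal.toReal_mono (ENNReal.mul_ne_top u.fourierENorm_ne_top v.fourierENorm_ne_top)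
      (fourierENorm_mul_le (u : G → ℂ) v)
    rwa [ENNReal.toReal_mul] at this
  have h2 : ∫ x, ‖(u * v) x‖ ∂(Measure.haar : Measure G) ≤
      (fourierENorm (u : G → ℂ)).toReal * ∫ x, ‖v x‖ ∂Measure.haar := by
    rw [← integral_const_mul]
    refine integral_mono (u * v).integrable.norm (v.integrable.norm.const_mul _) fun x => ?_
    refine (norm_mul (u x) (v x)).trans_le ?_
    gcongr
    rw [← toReal_enorm]
    exact ENNReal.toReal_mono u.fourierENorm_ne_top (enorm_apply_le _ x)
  have h3 : 0 ≤ ∫ x, ‖u x‖ ∂(Measure.haar : Measure G) := integral_nonneg fun _ => norm_nonneg _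
  have h4 : 0 ≤ ∫ x, ‖v x‖ ∂(Measure.haar : Measure G) := integral_nonneg fun _ => norm_nonneg _
  have h5 : 0 ≤ (fourierENorm (v : G → ℂ)).toReal := ENNReal.toReal_nonneg
  simp only [S1A.norm_def]
  nlinarith [mul_nonneg h3 h4, mul_nonneg h3 h5]

theorem S1A.norm_add_le (u v : S1A G) : ‖u + v‖ ≤ ‖u‖ + ‖v‖ := by
  have h1 : (fourierENorm ((u + v : S1A G) : G → ℂ)).toReal ≤
      (fourierENorm (u : G → ℂ)).toReal + (fourierENorm (v : G → ℂ)).toReal := by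
    have := ENNReal.toReal_mono (ENNReal.add_ne_top.2
      ⟨u.fourierENorm_ne_top, v.fourierENorm_ne_top⟩) (fourierENorm_add_le (u : G → ℂ) v)
    rwa [ENNReal.toReal_add u.fourierENorm_ne_top v.fourierENorm_ne_top] at this
  have h2 : ∫ x, ‖(u + v) x‖ ∂(Measure.haar : Measure G) ≤
      ∫ x, ‖u x‖ ∂Measure.haar + ∫ x, ‖v x‖ ∂Measure.haar := by
    rw [← integral_add u.integrable.norm v.integrable.norm]
    exact integral_mono (u + v).integrable.norm (u.integrable.norm.add v.integrable.norm)
      fun x => _root_.norm_add_le (u x) (v x)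
  simp only [S1A.norm_def]
  linarith

theorem S1A.eq_zero_of_norm (u : S1A G) (h : ‖u‖ = 0) : u = 0 := by
  have h3 : 0 ≤ ∫ x, ‖u x‖ ∂(Measure.haar : Measure G) := integral_nonneg fun _ => norm_nonneg _
  have h4 : 0 ≤ (fourierENorm (u : G → ℂ)).toReal := ENNReal.toReal_nonneg
  rw [S1A.norm_def] at h
  have h0 : fourierENorm (u : G → ℂ) = 0 := by
    have : (fourierENorm (u : G → ℂ)).toReal = 0 := by linarith
    exact ((ENNReal.toReal_eq_zero_iff _).1 this).resolve_right u.fourierENorm_ne_top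
  refine DFunLike.ext _ _ fun s => ?_
  have := enorm_apply_le (u : G → ℂ) s
  rw [h0] at this
  exact enorm_eq_zero.1 (le_antisymm this bot_le)

/-- `‖·‖` as a group norm. -/
def S1A.groupNorm : AddGroupNorm (S1A G) where
  toFun := norm
  map_zero' := by
    have := S1A.norm_smul_le 0 (0 : S1A G)
    have h3 : 0 ≤ ‖(0 : S1A G)‖ := add_nonneg ENNReal.toReal_nonneg
      (integral_nonneg fun _ => norm_nonneg _)
    simp at this
    linarith
  add_le' := S1A.norm_add_le
  neg' u := by
    have h : ∀ u : S1A G, ‖-u‖ ≤ ‖u‖ := fun u => by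
      have := S1A.norm_smul_le (-1) u
      simpa using this
    exact le_antisymm (h u) (by simpa using h (-u))
  eq_zero_of_map_eq_zero' := S1A.eq_zero_of_norm

instance : NormedAddCommGroup (S1A G) := S1A.groupNorm.toNormedAddCommGroup
instance : NonUnitalNormedCommRing (S1A G) where
  toNonUnitalCommRing := inferInstance
  toNorm := inferInstance
  toMetricSpace := inferInstance
  dist_eq := NormedAddCommGroup.dist_eq
  norm_mul_le := S1A.norm_mul_le
instance : NormedSpace ℂ (S1A G) where
  norm_smul_le := S1A.norm_smul_le

end Fourier

section Bimodules

universe u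

variable (A : Type u) [NonUnitalNormedRing A] [NormedSpace ℂ A] [IsScalarTower ℂ A A]
  [SMulCommClass ℂ A A]

/-- `A` has a (two-sided, possibly unbounded) approximate identity. -/
def HasApproxIdentity : Prop :=
  ∃ (Λ : Type u) (_ : Preorder Λ) (_ : IsDirectedOrder Λ) (_ : Nonempty Λ) (e : Λ → A),
    ∀ a, Tendsto (fun i => e i * a) atTop (𝓝 a) ∧ Tendsto (fun i => a * e i) atTop (𝓝 a)

variable {A}

/-- The left action on `A*`: `⟨b, a · φ⟩ = ⟨b a, φ⟩`. -/
def dualLeft (a : A) (φ : StrongDual ℂ A) : StrongDual ℂ A :=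
  φ.comp ((ContinuousLinearMap.mul ℂ A).flip a)

/-- The right action on `A*`: `⟨b, φ · a⟩ = ⟨a b, φ⟩`. -/
def dualRight (φ : StrongDual ℂ A) (a : A) : StrongDual ℂ A :=
  φ.comp (ContinuousLinearMap.mul ℂ A a)

/-- The left action on functionals on `A ⊗ A`: `⟨b ⊗ c, a · ψ⟩ = ⟨b ⊗ c a, ψ⟩`. -/
def tensorLeft (a : A) (ψ : Module.Dual ℂ (A ⊗[ℂ] A)) : Module.Dual ℂ (A ⊗[ℂ] A) :=
  ψ ∘ₗ (LinearMap.mulRight ℂ a).lTensor A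

/-- The right action on functionals on `A ⊗ A`: `⟨b ⊗ c, ψ · a⟩ = ⟨a b ⊗ c, ψ⟩`. -/
def tensorRight (ψ : Module.Dual ℂ (A ⊗[ℂ] A)) (a : A) : Module.Dual ℂ (A ⊗[ℂ] A) :=
  ψ ∘ₗ (LinearMap.mulLeft ℂ a).rTensor A

/-- `π* φ`, where `π (b ⊗ c) = b c`. -/
def mulPullback (φ : StrongDual ℂ A) : Module.Dual ℂ (A ⊗[ℂ] A) :=
  (φ : A →ₗ[ℂ] ℂ) ∘ₗ LinearMap.mul' ℂ A

/-- `D`, a space of functionals on `A ⊗ A`, is a dual `A`-bimodule containing the range of `π*`,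
and there is a net of `A`-bimodule maps `θ_δ : D → A*`, all satisfying `P`, such that
`θ_δ ∘ π* → id` in the weak* operator topology. -/
def HasBiflatNet (D : Submodule ℂ (Module.Dual ℂ (A ⊗[ℂ] A)))
    (P : (D →ₗ[ℂ] StrongDual ℂ A) → Prop) : Prop :=
  ∃ (hl : ∀ (a : A), ∀ ψ ∈ D, tensorLeft a ψ ∈ D) (hr : ∀ (a : A), ∀ ψ ∈ D, tensorRight ψ a ∈ D)
    (hπ : ∀ φ : StrongDual ℂ A, mulPullback φ ∈ D),
  ∃ (Δ : Type u) (_ : Preorder Δ) (_ : IsDirectedOrder Δ) (_ : Nonempty Δ)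
    (θ : Δ → D →ₗ[ℂ] StrongDual ℂ A),
    (∀ δ, P (θ δ)) ∧
    (∀ δ (a : A) (ψ : D), θ δ ⟨tensorLeft a ψ, hl a ψ ψ.2⟩ = dualLeft a (θ δ ψ)) ∧
    (∀ δ (a : A) (ψ : D), θ δ ⟨tensorRight ψ a, hr a ψ ψ.2⟩ = dualRight (θ δ ψ) a) ∧
    ∀ (φ : StrongDual ℂ A) (b : A),
      Tendsto (fun δ => θ δ ⟨mulPullback φ, hπ φ⟩ b) atTop (𝓝 (φ b))

/-- The dual space of `(E, p)`: linear functionals that are bounded with respect to `p`. -/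
def boundedDual {E : Type*} [AddCommGroup E] [Module ℂ E] (p : E → ℝ≥0∞) :
    Submodule ℂ (Module.Dual ℂ E) where
  carrier := {ψ | ∃ C : ℝ≥0, ∀ t, ‖ψ t‖ₑ ≤ C * p t}
  zero_mem' := ⟨0, by simp⟩
  add_mem' := by
    rintro ψ₁ ψ₂ ⟨C₁, h₁⟩ ⟨C₂, h₂⟩
    refine ⟨C₁ + C₂, fun t => ?_⟩
    rw [ENNReal.coe_add, add_mul]
    exact (enorm_add_le _ _).trans (add_le_add (h₁ t) (h₂ t))
  smul_mem' := by
    rintro c ψ ⟨C, h⟩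
    refine ⟨‖c‖₊ * C, fun t => ?_⟩
    rw [LinearMap.smul_apply, enorm_smul, ENNReal.coe_mul, mul_assoc]
    exact mul_le_mul' le_rfl (h t)

/-- The dual norm of a functional on `(E, p)`. -/
def dualENorm {E : Type*} [AddCommGroup E] [Module ℂ E] (p : E → ℝ≥0∞)
    (ψ : Module.Dual ℂ E) : ℝ≥0∞ :=
  ⨆ (t : E) (_ : p t ≤ 1), ‖ψ t‖ₑ

/-- The projective tensor norm on the algebraic tensor product. -/
def projENorm (t : A ⊗[ℂ] A) : ℝ≥0∞ :=
  ⨅ (n : ℕ) (a : Fin n → A) (b : Fin n → A) (_ : t = ∑ i, a i ⊗ₜ[ℂ] b i),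
    ∑ i, ‖a i‖ₑ * ‖b i‖ₑ

variable (A) in
/-- `(A ⊗̂ A)*`: the functionals on the algebraic tensor product that are bounded for the
projective norm (they extend uniquely to the completion). -/
abbrev ProjDual : Submodule ℂ (Module.Dual ℂ (A ⊗[ℂ] A)) := boundedDual (projENorm (A := A))

variable (A) in
/-- Approximate biflatness of a Banach algebra: there is a net of bounded `A`-bimodule maps
`θ_δ : (A ⊗̂ A)* → A*` with `θ_δ ∘ π* → id` in the weak* operator topology. -/
def IsApproxBiflat : Prop :=
  HasBiflatNet (ProjDual A) fun θ =>
    ∃ C : ℝ≥0, ∀ ψ, ‖θ ψ‖ₑ ≤ C * dualENorm projENorm (ψ : Module.Dual ℂ (A ⊗[ℂ] A))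

end Bimodules

section OperatorSpaces

/-- A family of matrix norms on `V`, one on each `M_n(V)`. -/
abbrev MatrixNorm (V : Type*) : Type _ := (n : ℕ) → Matrix (Fin n) (Fin n) V → ℝ≥0∞

open scoped Matrix.Norms.L2Operator in
/-- The operator norm of a complex matrix acting between Euclidean spaces. -/
def matENorm {ι κ : Type*} [Fintype ι] [Fintype κ] [DecidableEq κ] (M : Matrix ι κ ℂ) : ℝ≥0∞ :=
  ‖M‖ₑ

/-- The dual matrix norms, `M_n(V*) = CB(V, M_n)`:
`‖[F_ij]‖ = sup {‖[F_ij(v_kl)]‖ : [v_kl] ∈ M_m(V), ‖[v_kl]‖ ≤ 1, m ∈ ℕ}`. -/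
def dualMatrixNorm {V : Type*} [AddCommGroup V] [Module ℂ V] (N : MatrixNorm V) :
    MatrixNorm (Module.Dual ℂ V) := fun n F =>
  ⨆ (m : ℕ) (v : Matrix (Fin m) (Fin m) V) (_ : N m v ≤ 1),
    matENorm (Matrix.of fun r s : Fin n × Fin m => F r.1 s.1 (v r.2 s.2))

/-- The operator projective tensor norms on the algebraic tensor product:
`‖t‖ = inf {‖α‖ ‖v‖ ‖w‖ ‖β‖ : t = α (v ⊗ w) β}` with `v ∈ M_p(V)`, `w ∈ M_q(V)` and scalar
matrices `α ∈ M_{n,pq}`, `β ∈ M_{pq,n}`. -/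
def opProjNorm {V : Type*} [AddCommGroup V] [Module ℂ V] (N : MatrixNorm V) :
    MatrixNorm (V ⊗[ℂ] V) := fun n t =>
  ⨅ (p : ℕ) (q : ℕ) (α : Matrix (Fin n) (Fin p × Fin q) ℂ) (v : Matrix (Fin p) (Fin p) V)
    (w : Matrix (Fin q) (Fin q) V) (β : Matrix (Fin p × Fin q) (Fin n) ℂ)
    (_ : ∀ i j, t i j = ∑ r, ∑ s, (α i r * β s j) • (v r.1 s.1 ⊗ₜ[ℂ] w r.2 s.2)),
    matENorm α * N p v * N q w * matENorm β

/-- `(V ⊗̂_op V)*`: the functionals on the algebraic tensor product that are bounded for the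
operator projective norm (they extend uniquely to the completion). -/
abbrev OpProjDual {V : Type*} [AddCommGroup V] [Module ℂ V] (N : MatrixNorm V) :
    Submodule ℂ (Module.Dual ℂ (V ⊗[ℂ] V)) :=
  boundedDual fun t => opProjNorm N 1 (Matrix.of fun _ _ => t)

/-- Operator approximate biflatness of `A` with matrix norms `N`: there is a net of completely
bounded `A`-bimodule maps `θ_δ : (A ⊗̂_op A)* → A*` with `θ_δ ∘ π* → id` in the weak* operator
topology. The duals carry their dual matrix norms. -/
def IsOpApproxBiflat {A : Type*} [NonUnitalNormedRing A] [NormedSpace ℂ A]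
    [IsScalarTower ℂ A A] [SMulCommClass ℂ A A] (N : MatrixNorm A) : Prop :=
  HasBiflatNet (OpProjDual N) fun θ =>
    ∃ C : ℝ≥0, ∀ (n : ℕ) (F : Matrix (Fin n) (Fin n) (OpProjDual N)),
      dualMatrixNorm N n (F.map fun ψ => (θ ψ : A →ₗ[ℂ] ℂ)) ≤
        C * dualMatrixNorm (opProjNorm N) n (F.map fun ψ => (ψ : Module.Dual ℂ (A ⊗[ℂ] A)))

/-- A matrix of operators is a contraction on the Hilbert space direct sum `H^m`. -/
def IsContractionMatrix {H : Type*} [NormedAddCommGroup H] [InnerProductSpace ℂ H] {m : ℕ}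
    (T : Matrix (Fin m) (Fin m) (H →L[ℂ] H)) : Prop :=
  ∀ x : Fin m → H, ∑ k, ‖∑ l, T k l (x l)‖ ^ 2 ≤ ∑ k, ‖x k‖ ^ 2

/-- The matrix norms of `S¹A(G)`, inherited from the embedding `u ↦ (u, u)` into the operator
space direct sum `A(G) ⊕₁ L¹(G)`. The latter is the predual of `VN(G) ⊕_∞ L^∞(G)`, so `‖[u_ij]‖` is
the supremum of `‖[⟨T_kl, u_ij⟩ + ∫ φ_kl u_ij]‖` over the pairs `([T_kl], [φ_kl])` in the unit balls
of `M_m(VN(G))` and `M_m(L^∞(G))`. -/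
def S1A.matrixNorm (G : Type*) [Group G] [TopologicalSpace G] [IsTopologicalGroup G]
    [LocallyCompactSpace G] [MeasurableSpace G] [BorelSpace G] : MatrixNorm (S1A G) := fun n u =>
  ⨆ (m : ℕ) (T : Matrix (Fin m) (Fin m) (L2 G →L[ℂ] L2 G)) (_ : ∀ k l, T k l ∈ groupVN G)
    (_ : IsContractionMatrix T) (φ : G → Matrix (Fin m) (Fin m) ℂ)
    (_ : ∀ k l, Measurable fun x => φ x k l) (_ : ∀ x, matENorm (φ x) ≤ 1),
    matENorm (Matrix.of fun r s : Fin n × Fin m =>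
      vnPairing (T r.2 s.2) (u r.1 s.1) + ∫ x, φ x r.2 s.2 * u r.1 s.1 x ∂Measure.haar)

end OperatorSpaces

instance {G : Type*} [Group G] [TopologicalSpace G] [LocallyCompactSpace G]
    (H : OpenSubgroup G) : LocallyCompactSpace H.toSubgroup :=
  H.isOpen.locallyCompactSpace

end FourierSegal
end

/-!
# Approximate biflatness of Lebesgue-Fourier algebras and open subgroups

Let `K` be an open subgroup of `G`. For each left coset `x K` there are a restriction map
`r_x : S¹A(G) → S¹A(K)`, `r_x a (h) = a (x h)`, and an embedding `j_x : S¹A(K) → S¹A(G)`, where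
`j_x b` is the translate of `b` to `x K`, extended by zero. Both are homomorphisms, and
`j_x (b · r_x a) = j_x b · a`. If `θ` is a bimodule map from functionals on `S¹A(K) ⊗ S¹A(K)` to
functionals on `S¹A(K)`, then for every `w` in `S¹A(G)` the map
`ψ ↦ θ (ψ ∘ (j_x ⊗ j_x)) ∘ r_x ∘ (w ·)` is a bimodule map for `S¹A(G)`. If `θ` runs through a net
with `θ ∘ π* → id`, the composites with `π*` converge to `φ ↦ φ ∘ j_x ∘ r_x ∘ (w ·)`. Let `w` be
supported in finitely many cosets. Then the sum over these cosets has the limit `φ ↦ φ (w ·)`, because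
`∑ j_x r_x (w a) = w a`. If `w` in addition acts nearly as the identity on a prescribed finite set,
this limit is close to `φ` there. This is `HasBiflatNet.transfer`.

Such elements `w` come from the approximate identity
(`S1A.exists_supported_approxIdentity`). Coefficients of continuous vectors of compact support are
compactly supported, hence supported in finitely many cosets, and their sums `v` are dense in `A(G)`.
`S¹A(G)` is an ideal of `A(G)` with `‖e v‖ ≤ ‖e‖ ‖v‖_{A(G)}`, so the products `e v`, with `e` in the
approximate identity, are dense in `S¹A(G)`.

It remains to show that `r_x`, `j_x` and multiplication by `w` are bounded and completely bounded.
The norms of matrices over `S¹A(G)` are controlled by pairing separately with matrices over `VN(G)`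
(`VNBound`) and over `L^∞(G)` (`LBound`).

* Translations, extension by zero and restriction are weighted compositions `u ↦ s · (u ∘ p)`. On
  `L¹` they are the transposes of such maps of `L^∞` (`TransposesTo`), by the comparison of the Haar
  measures of `K` and of its right cosets in `G` (`integral_coset`). On `A(G)` they send coefficients
  of finite families of compactly supported vectors to sums of coefficients with no larger square sums
  (`ExpandsCoeff`). For the restriction, `L²(G)` as a representation of `K` is a sum of copies of
  `L²(K)`, one for each right coset, and only finitely many cosets meet a compact set. Hence the
  adjoints map contractive matrices over one von Neumann algebra to contractive matrices over the
  other (`VNBound.wcomp`).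
* Multiplication is jointly completely contractive on `A(G)` (`VNBound.mul`). This is Fell absorption
  `λ ⊗ λ ≅ λ ⊗ 1` in the form `norm_sum_vnPairing_mul_le`. It also shows that `π*` takes values in the
  functionals bounded for the operator projective norm, so that the dual of the operator projective
  tensor product is a bimodule of the required kind.
-/

noncomputable section
namespace FourierSegal

/-! ### Matrices of operators and of scalars -/

section Matrices

/-- The Hilbert space direct sum norm of a finite family. -/
def l2 {κ E : Type*} [Fintype κ] [Norm E] (x : κ → E) : ℝ := √(∑ k, ‖x k‖ ^ 2)

theorem l2_nonneg {κ E : Type*} [Fintype κ] [Norm E] (x : κ → E) : 0 ≤ l2 x := Real.sqrt_nonneg _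

theorem l2_sq {κ E : Type*} [Fintype κ] [Norm E] (x : κ → E) : l2 x ^ 2 = ∑ k, ‖x k‖ ^ 2 :=
  Real.sq_sqrt (Finset.sum_nonneg fun _ _ => sq_nonneg _)

theorem sum_norm_mul_le_l2 {κ E F : Type*} [Fintype κ] [Norm E] [Norm F] (x : κ → E) (y : κ → F) :
    ∑ k, ‖x k‖ * ‖y k‖ ≤ l2 x * l2 y :=
  Real.sum_mul_le_sqrt_mul_sqrt _ _ _

theorem l2_const_smul {κ E : Type*} [Fintype κ] [SeminormedAddCommGroup E] [NormedSpace ℂ E]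
    (x : κ → ℂ) (ξ : E) : l2 (fun k => x k • ξ) = l2 x * ‖ξ‖ := by
  rw [← abs_of_nonneg (norm_nonneg ξ), ← Real.sqrt_sq_eq_abs, l2, l2,
    ← Real.sqrt_mul (Finset.sum_nonneg fun _ _ => sq_nonneg _), Finset.sum_mul]
  simp only [norm_smul, mul_pow]

theorem l2_smul {κ E : Type*} [Fintype κ] [SeminormedAddCommGroup E] [NormedSpace ℂ E]
    (a : ℂ) (x : κ → E) : l2 (fun k => a • x k) = ‖a‖ * l2 x := by
  rw [← abs_of_nonneg (norm_nonneg a), ← Real.sqrt_sq_eq_abs, l2, l2,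
    ← Real.sqrt_mul (sq_nonneg _), Finset.mul_sum]
  simp only [norm_smul, mul_pow]

theorem l2_star {κ : Type*} [Fintype κ] (x : κ → ℂ) : l2 (fun k => star (x k)) = l2 x := by
  simp [l2]

theorem l2_comp_equiv {κ κ' E : Type*} [Fintype κ] [Fintype κ'] [Norm E] (e : κ ≃ κ')
    (x : κ' → E) : l2 (fun k => x (e k)) = l2 x := by
  rw [l2, l2, e.sum_comp fun k => ‖x k‖ ^ 2]

theorem l2_le_mul {κ E F : Type*} [Fintype κ] [SeminormedAddCommGroup E]
    [SeminormedAddCommGroup F] {x : κ → E} {y : κ → F} {d : ℝ} (hd : 0 ≤ d)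
    (h : ∀ k, ‖x k‖ ≤ d * ‖y k‖) : l2 x ≤ d * l2 y := by
  rw [← Real.sqrt_sq hd, l2, l2, ← Real.sqrt_mul (sq_nonneg _), Finset.mul_sum]
  refine Real.sqrt_le_sqrt (Finset.sum_le_sum fun k _ => ?_)
  rw [← mul_pow]
  exact pow_le_pow_left₀ (norm_nonneg _) (h k) 2

theorem l2_single {κ : Type*} [Fintype κ] [DecidableEq κ] (k : κ) :
    l2 (Pi.single k (1 : ℂ)) = 1 := by
  rw [l2, Finset.sum_eq_single k (fun b _ hb => by simp [hb]) (by simp)]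
  simp

/-- A fibred family has the same `ℓ²`-norm as the family of the norms of its fibres. -/
theorem l2_prod {κ κ' E : Type*} [Fintype κ] [Fintype κ'] [Norm E] (x : κ × κ' → E) :
    l2 x = l2 (fun k => l2 fun k' => x (k, k')) := by
  have : ∀ k, ‖l2 fun k' => x (k, k')‖ ^ 2 = ∑ k', ‖x (k, k')‖ ^ 2 := fun k => by
    rw [Real.norm_eq_abs, sq_abs, l2_sq]
  conv_rhs => rw [l2]
  simp only [this]
  rw [l2, Fintype.sum_prod_type]

theorem norm_le_l2 {κ E : Type*} [Fintype κ] [SeminormedAddCommGroup E] (x : κ → E) (k : κ) :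
    ‖x k‖ ≤ l2 x :=
  Real.le_sqrt_of_sq_le (Finset.single_le_sum (f := fun k => ‖x k‖ ^ 2)
    (fun _ _ => sq_nonneg _) (Finset.mem_univ k))

theorem norm_sum_le_of_l2_fibres {κ κ' : Type*} [Fintype κ] [Fintype κ'] {E F : Type*}
    [SeminormedAddCommGroup E] [SeminormedAddCommGroup F]
    (x : κ × κ' → E) (y : κ × κ' → F) :
    ∑ k, (l2 fun k' => x (k, k')) * (l2 fun k' => y (k, k')) ≤ l2 x * l2 y := by
  have := sum_norm_mul_le_l2 (fun k => l2 fun k' => x (k, k')) (fun k => l2 fun k' => y (k, k'))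
  rw [← l2_prod, ← l2_prod] at this
  refine le_trans (le_of_eq (Finset.sum_congr rfl fun k _ => ?_)) this
  rw [Real.norm_of_nonneg (l2_nonneg _), Real.norm_of_nonneg (l2_nonneg _)]

variable {H : Type*} [NormedAddCommGroup H] [InnerProductSpace ℂ H]

theorem norm_sum_inner_le_l2 {κ : Type*} [Fintype κ] (x y : κ → H) :
    ‖∑ k, (inner ℂ (y k) (x k) : ℂ)‖ ≤ l2 x * l2 y := by
  refine (norm_sum_le _ _).trans ((Finset.sum_le_sum fun k _ => ?_).trans (sum_norm_mul_le_l2 x y))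
  rw [mul_comm]; exact norm_inner_le_norm _ _

/-- The operator matrix `T` on the finite Hilbert space direct sum has norm at most `c`. -/
def OpBound {κ : Type*} [Fintype κ] (T : κ → κ → H →L[ℂ] H) (c : ℝ) : Prop :=
  ∀ x : κ → H, l2 (fun k => ∑ l, T k l (x l)) ≤ c * l2 x

theorem OpBound.form_le {κ : Type*} [Fintype κ] {T : κ → κ → H →L[ℂ] H} {c : ℝ}
    (h : OpBound T c) (x y : κ → H) :
    ‖∑ k, ∑ l, (inner ℂ (y k) (T k l (x l)) : ℂ)‖ ≤ c * l2 x * l2 y := by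
  simp only [← inner_sum]
  exact (norm_sum_inner_le_l2 _ _).trans (mul_le_mul_of_nonneg_right (h x) (l2_nonneg _))

/-- The converse of `OpBound.form_le`: take `y = T x`. -/
theorem OpBound.of_form_le {κ : Type*} [Fintype κ] {T : κ → κ → H →L[ℂ] H} {c : ℝ}
    (h : ∀ x y : κ → H, ‖∑ k, ∑ l, (inner ℂ (y k) (T k l (x l)) : ℂ)‖ ≤ c * l2 x * l2 y) :
    OpBound T c := by
  intro x
  have h1 := h x (fun k => ∑ l, T k l (x l))
  simp only [← inner_sum, inner_self_eq_norm_sq_to_K] at h1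
  have h2 : (∑ k, ((‖∑ l, T k l (x l)‖ : ℂ)) ^ 2) =
      ((l2 fun k => ∑ l, T k l (x l)) ^ 2 : ℝ) := by rw [l2_sq]; push_cast; rfl
  have h3 : ‖((l2 fun k => ∑ l, T k l (x l)) ^ 2 : ℝ)‖ ≤
      c * l2 x * (l2 fun k => ∑ l, T k l (x l)) := by
    rw [← Complex.norm_real, ← h2]; exact h1
  rw [Real.norm_of_nonneg (sq_nonneg _), sq] at h3
  rcases (l2_nonneg fun k => ∑ l, T k l (x l)).eq_or_lt' with h0 | h0
  · by_contra hne
    rw [h0, not_le] at hne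
    -- `c` is not assumed nonnegative; testing the form at `(x, x)` excludes `c < 0`
    have h5 := (norm_nonneg _).trans (h x x)
    have h6 : 0 ≤ l2 x := l2_nonneg x
    rcases h6.eq_or_lt' with h7 | h7
    · rw [h7] at hne; simp at hne
    · nlinarith
  · exact le_of_mul_le_mul_right h3 h0

theorem isContractionMatrix_iff {m : ℕ} (T : Matrix (Fin m) (Fin m) (H →L[ℂ] H)) :
    IsContractionMatrix T ↔ OpBound (fun k l => T k l) 1 := by
  refine forall_congr' fun x => ?_
  rw [one_mul, l2, l2, Real.sqrt_le_sqrt_iff (Finset.sum_nonneg fun _ _ => sq_nonneg _)]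

theorem OpBound.comp_equiv {κ κ' : Type*} [Fintype κ] [Fintype κ'] {T : κ → κ → H →L[ℂ] H} {c : ℝ}
    (h : OpBound T c) (e : κ' ≃ κ) : OpBound (fun k l => T (e k) (e l)) c := by
  intro x
  have h1 := h fun k => x (e.symm k)
  rw [l2_comp_equiv e.symm, ← l2_comp_equiv e] at h1
  refine le_trans (le_of_eq ?_) h1
  congr 1
  funext k
  rw [← e.sum_comp]
  simp

theorem OpBound.smul {κ : Type*} [Fintype κ] {T : κ → κ → H →L[ℂ] H} {c : ℝ}
    (h : OpBound T c) (a : ℂ) : OpBound (fun k l => a • T k l) (‖a‖ * c) := by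
  intro x
  have : l2 (fun k => ∑ l, (a • T k l) (x l)) = ‖a‖ * l2 (fun k => ∑ l, T k l (x l)) := by
    simp only [smul_apply, ← Finset.smul_sum]
    exact l2_smul a _
  rw [this, mul_assoc]
  exact mul_le_mul_of_nonneg_left (h x) (norm_nonneg a)

theorem OpBound.eq_zero {κ : Type*} [Fintype κ] {T : κ → κ → H →L[ℂ] H} (h : OpBound T 0)
    (k l : κ) : T k l = 0 := by
  classical
  ext z
  have h1 := h (Pi.single l z)
  rw [zero_mul] at h1
  have h2 := (norm_le_l2 _ k).trans h1
  rw [Finset.sum_eq_single l (fun b _ hb => by simp [hb]) (by simp), Pi.single_eq_same] at h2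
  simpa using h2

theorem opBound_of_norm_le {T : H →L[ℂ] H} {c : ℝ} (h : ‖T‖ ≤ c) :
    OpBound (fun _ _ : Unit => T) c := by
  intro x
  simp only [l2, Finset.univ_unique, Finset.sum_singleton, Real.sqrt_sq (norm_nonneg _)]
  exact T.le_of_opNorm_le h _

theorem OpBound.norm_le {T : H →L[ℂ] H} {c : ℝ} (hc : 0 ≤ c)
    (h : OpBound (fun _ _ : Unit => T) c) : ‖T‖ ≤ c := by
  refine T.opNorm_le_bound hc fun z => ?_
  have := h fun _ => z
  simpa only [l2, Finset.univ_unique, Finset.sum_singleton, Real.sqrt_sq (norm_nonneg _)] using this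

section Scalar

variable {ι κ : Type*} [Fintype ι] [Fintype κ]

/-- The scalar matrix `M` has operator norm at most `c`, expressed by its bilinear form. -/
def MatBound (M : ι → κ → ℂ) (c : ℝ) : Prop :=
  ∀ (x : κ → ℂ) (y : ι → ℂ), ‖∑ r, ∑ s, y r * M r s * x s‖ ≤ c * l2 x * l2 y

theorem norm_toLp_eq_l2 (x : κ → ℂ) : ‖WithLp.toLp 2 x‖ = l2 x := by
  rw [EuclideanSpace.norm_eq, l2]

section
open scoped Matrix.Norms.L2Operator

theorem matENorm_smul [DecidableEq κ] (c : ℂ) (M : Matrix ι κ ℂ) :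
    matENorm (c • M) = ‖c‖ₑ * matENorm M := enorm_smul c M

theorem matENorm_zero [DecidableEq κ] : matENorm (0 : Matrix ι κ ℂ) = 0 := enorm_zero

theorem matENorm_add_le [DecidableEq κ] (M N : Matrix ι κ ℂ) :
    matENorm (M + N) ≤ matENorm M + matENorm N := enorm_add_le M N

theorem matENorm_ne_top [DecidableEq κ] (M : Matrix ι κ ℂ) : matENorm M ≠ ∞ := enorm_ne_top

end

open scoped Matrix.Norms.L2Operator in
theorem MatBound.of_matENorm_le [DecidableEq κ] {M : Matrix ι κ ℂ} {c : ℝ} (hc : 0 ≤ c)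
    (h : matENorm M ≤ ENNReal.ofReal c) : MatBound (fun r s => M r s) c := by
  intro x y
  have h' : ‖M‖ ≤ c := by
    rw [matENorm, ← ofReal_norm, ENNReal.ofReal_le_ofReal_iff hc] at h
    exact h
  have h1 : ∑ r, ∑ s, y r * M r s * x s = ∑ r, inner ℂ (star (y r)) ((M.mulVec x) r) := by
    refine Finset.sum_congr rfl fun r _ => ?_
    simp only [Matrix.mulVec, dotProduct, RCLike.inner_apply, Finset.sum_mul, starRingEnd_apply,
      star_star]
    exact Finset.sum_congr rfl fun s _ => by ring
  rw [h1]
  refine (norm_sum_inner_le_l2 _ _).trans ?_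
  rw [l2_star]
  refine mul_le_mul_of_nonneg_right ?_ (l2_nonneg _)
  have h2 := M.l2_opNorm_mulVec (WithLp.toLp 2 x)
  refine le_trans (le_of_eq ?_) ((h2.trans (mul_le_mul_of_nonneg_right h' (norm_nonneg _))).trans
    (le_of_eq (by rw [norm_toLp_eq_l2])))
  exact (norm_toLp_eq_l2 (M.mulVec x)).symm

/-- The bilinear form is tested at the conjugate of `M x`. -/
theorem MatBound.l2_le {M : ι → κ → ℂ} {c : ℝ} (hc : 0 ≤ c) (h : MatBound M c) (x : κ → ℂ) :
    l2 (fun r => ∑ s, M r s * x s) ≤ c * l2 x := by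
  have h1 := h x (fun r => star (∑ s, M r s * x s))
  have h2 : ∑ r, ∑ s, star (∑ s, M r s * x s) * M r s * x s =
      ((l2 fun r => ∑ s, M r s * x s) ^ 2 : ℝ) := by
    rw [l2_sq]
    push_cast
    refine Finset.sum_congr rfl fun r _ => ?_
    rw [← Complex.conj_mul']
    simp only [mul_assoc, ← Finset.mul_sum]
    rfl
  rw [h2, Complex.norm_real, Real.norm_of_nonneg (sq_nonneg _), l2_star, sq] at h1
  rcases (l2_nonneg fun r => ∑ s, M r s * x s).eq_or_lt' with h0 | h0
  · rw [h0]; exact mul_nonneg hc (l2_nonneg _)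
  · exact le_of_mul_le_mul_right h1 h0

open scoped Matrix.Norms.L2Operator in
theorem MatBound.matENorm_le [DecidableEq κ] {M : Matrix ι κ ℂ} {c : ℝ} (hc : 0 ≤ c)
    (h : MatBound (fun r s => M r s) c) : matENorm M ≤ ENNReal.ofReal c := by
  rw [matENorm, ← ofReal_norm]
  refine ENNReal.ofReal_le_ofReal ?_
  rw [Matrix.l2_opNorm_def]
  refine ContinuousLinearMap.opNorm_le_bound _ hc fun x => ?_
  have h3 : l2 (M.mulVec fun s => x s) ≤ c * l2 fun s => x s := h.l2_le hc _
  have h4 : ‖x‖ = l2 fun s => x s := norm_toLp_eq_l2 _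
  rw [h4]
  exact le_trans (le_of_eq (norm_toLp_eq_l2 _)) h3

theorem MatBound.add {M N : ι → κ → ℂ} {c d : ℝ} (hM : MatBound M c) (hN : MatBound N d) :
    MatBound (fun r s => M r s + N r s) (c + d) := by
  intro x y
  simp only [mul_add, add_mul, Finset.sum_add_distrib]
  exact (norm_add_le _ _).trans (by linarith [hM x y, hN x y])

end Scalar

end Matrices

/-! ### The Fourier algebra as a normed algebra, and its duality with `VN(G)` -/

section FourierAlgebra

variable (G : Type*) [Group G] [TopologicalSpace G] [IsTopologicalGroup G]
  [LocallyCompactSpace G] [MeasurableSpace G] [BorelSpace G]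

/-- The Fourier algebra `A(G)`, as a type of its own that carries the norm of `A(G)` and not the
topology of pointwise convergence. -/
def FourierAlg : Type _ := fourierAlgebra G

instance : NonUnitalCommRing (FourierAlg G) :=
  inferInstanceAs (NonUnitalCommRing (fourierAlgebra G))
instance : Module ℂ (FourierAlg G) := inferInstanceAs (Module ℂ (fourierAlgebra G))
instance : IsScalarTower ℂ (FourierAlg G) (FourierAlg G) :=
  inferInstanceAs (IsScalarTower ℂ (fourierAlgebra G) (fourierAlgebra G))
instance : SMulCommClass ℂ (FourierAlg G) (FourierAlg G) :=
  inferInstanceAs (SMulCommClass ℂ (fourierAlgebra G) (fourierAlgebra G))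
instance : FunLike (FourierAlg G) G ℂ where
  coe u := u.1
  coe_injective := Subtype.val_injective

variable {G}

namespace FourierAlg

@[ext] theorem ext {u v : FourierAlg G} (h : ∀ s, u s = v s) : u = v := DFunLike.ext _ _ h

theorem fourierENorm_ne_top (u : FourierAlg G) : fourierENorm (u : G → ℂ) ≠ ∞ := u.2

@[simp] theorem add_apply (u v : FourierAlg G) (s : G) : (u + v) s = u s + v s := rfl
@[simp] theorem sub_apply (u v : FourierAlg G) (s : G) : (u - v) s = u s - v s := rfl
@[simp] theorem mul_apply (u v : FourierAlg G) (s : G) : (u * v) s = u s * v s := rfl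
@[simp] theorem smul_apply (c : ℂ) (u : FourierAlg G) (s : G) : (c • u) s = c * u s := rfl
@[simp] theorem zero_apply (s : G) : (0 : FourierAlg G) s = 0 := rfl

theorem sum_apply {ι : Type*} (S : Finset ι) (v : ι → FourierAlg G) (s : G) :
    (∑ i ∈ S, v i) s = ∑ i ∈ S, v i s :=
  map_sum (⟨⟨fun u => u s, zero_apply s⟩, fun u v => add_apply u v s⟩ : FourierAlg G →+ ℂ) v S

instance : Norm (FourierAlg G) where
  norm u := (fourierENorm (u : G → ℂ)).toReal

theorem norm_def (u : FourierAlg G) : ‖u‖ = (fourierENorm (u : G → ℂ)).toReal := rfl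

theorem norm_smul_le (c : ℂ) (u : FourierAlg G) : ‖c • u‖ ≤ ‖c‖ * ‖u‖ := by
  have := ENNReal.toReal_mono (ENNReal.mul_ne_top enorm_ne_top u.fourierENorm_ne_top)
    (fourierENorm_smul_le c (u : G → ℂ))
  rwa [ENNReal.toReal_mul, toReal_enorm] at this

/-- `‖·‖_{A(G)}` as a group norm. -/
def groupNorm : AddGroupNorm (FourierAlg G) where
  toFun := norm
  map_zero' := by
    have : fourierENorm ((0 : FourierAlg G) : G → ℂ) = 0 := fourierENorm_zero
    rw [norm_def, this, ENNReal.toReal_zero]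
  add_le' u v := by
    have := ENNReal.toReal_mono (ENNReal.add_ne_top.2
      ⟨u.fourierENorm_ne_top, v.fourierENorm_ne_top⟩) (fourierENorm_add_le (u : G → ℂ) v)
    rwa [ENNReal.toReal_add u.fourierENorm_ne_top v.fourierENorm_ne_top] at this
  neg' u := by
    have h : ∀ u : FourierAlg G, ‖-u‖ ≤ ‖u‖ := fun u => by simpa using norm_smul_le (-1) u
    exact le_antisymm (h u) (by simpa using h (-u))
  eq_zero_of_map_eq_zero' u h := by
    have h0 := ((ENNReal.toReal_eq_zero_iff _).1 h).resolve_right u.fourierENorm_ne_top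
    ext s
    have := enorm_apply_le (u : G → ℂ) s
    rw [h0] at this
    exact enorm_eq_zero.1 (le_antisymm this bot_le)

instance : NormedAddCommGroup (FourierAlg G) := groupNorm.toNormedAddCommGroup
instance : NonUnitalNormedCommRing (FourierAlg G) where
  toNonUnitalCommRing := inferInstance
  toNorm := inferInstance
  toMetricSpace := inferInstance
  dist_eq := NormedAddCommGroup.dist_eq
  norm_mul_le u v := by
    have := ENNReal.toReal_mono (ENNReal.mul_ne_top u.fourierENorm_ne_top v.fourierENorm_ne_top)
      (fourierENorm_mul_le (u : G → ℂ) v)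
    rwa [ENNReal.toReal_mul] at this
instance : NormedSpace ℂ (FourierAlg G) where
  norm_smul_le := norm_smul_le

theorem enorm_def (u : FourierAlg G) : ‖u‖ₑ = fourierENorm (u : G → ℂ) := by
  rw [← ofReal_norm, norm_def, ENNReal.ofReal_toReal u.fourierENorm_ne_top]

/-- The coefficient function `s ↦ ⟨λ(s) ξ, η⟩` as an element of `A(G)`. -/
def ofCoeff (ξ η : L2 G) : FourierAlg G :=
  ⟨fun s => coeff ξ η (leftReg s), ne_top_of_le_ne_top (by simp [ENNReal.mul_eq_top])
    (fourierENorm_le_of_countable (ι := Unit) (fun _ => ξ) (fun _ => η) (by simp))⟩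

@[simp] theorem ofCoeff_apply (ξ η : L2 G) (s : G) :
    ofCoeff ξ η s = coeff ξ η (leftReg s) := rfl

theorem enorm_ofCoeff_le (ξ η : L2 G) : ‖ofCoeff ξ η‖ₑ ≤ ‖ξ‖ₑ * ‖η‖ₑ := by
  rw [enorm_def]
  simpa using fourierENorm_le_of_countable (u := ofCoeff ξ η) (ι := Unit) (fun _ => ξ) (fun _ => η)
    (by simp)

theorem norm_ofCoeff_le (ξ η : L2 G) : ‖ofCoeff ξ η‖ ≤ ‖ξ‖ * ‖η‖ := by
  have := ENNReal.toReal_mono (by simp [ENNReal.mul_eq_top]) (enorm_ofCoeff_le ξ η)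
  simpa using this

theorem ofCoeff_add_left (ξ ξ' η : L2 G) : ofCoeff (ξ + ξ') η = ofCoeff ξ η + ofCoeff ξ' η := by
  ext s; simp [coeff, inner_add_right]

theorem ofCoeff_add_right (ξ η η' : L2 G) : ofCoeff ξ (η + η') = ofCoeff ξ η + ofCoeff ξ η' := by
  ext s; simp [coeff, inner_add_left]

theorem ofCoeff_smul_left (c : ℂ) (ξ η : L2 G) : ofCoeff (c • ξ) η = c • ofCoeff ξ η := by
  ext s; simp [coeff, inner_smul_right]

theorem ofCoeff_smul_right (c : ℂ) (ξ η : L2 G) :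
    ofCoeff ξ (c • η) = (starRingEnd ℂ) c • ofCoeff ξ η := by
  ext s; simp [coeff, inner_smul_left]

variable (G) in
/-- `(ξ, η) ↦ (s ↦ ⟨λ(s) ξ, η⟩)` as a bounded sesquilinear map, with the conjugate linear variable
`η` first. -/
def ofCoeffL : L2 G →L⋆[ℂ] L2 G →L[ℂ] FourierAlg G :=
  LinearMap.mkContinuous₂ (LinearMap.mk₂'ₛₗ (starRingEnd ℂ) (RingHom.id ℂ)
    (fun η ξ => ofCoeff ξ η) (fun η η' ξ => ofCoeff_add_right ξ η η')
    (fun c η ξ => ofCoeff_smul_right c ξ η) (fun η ξ ξ' => ofCoeff_add_left ξ ξ' η)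
    (fun c η ξ => ofCoeff_smul_left c ξ η)) 1 (fun η ξ => by
      rw [one_mul, mul_comm]; exact norm_ofCoeff_le ξ η)

@[simp] theorem ofCoeffL_apply (ξ η : L2 G) : ofCoeffL G η ξ = ofCoeff ξ η := rfl

/-- A countable coefficient expansion of a function converges in the norm of `A(G)`. -/
theorem hasSum_ofCoeff {ι : Type*} [Countable ι] {u : FourierAlg G} {ξ η : ι → L2 G}
    (hfin : ∑' i, ‖ξ i‖ₑ * ‖η i‖ₑ ≠ ∞) (h : ∀ s, u s = ∑' i, coeff (ξ i) (η i) (leftReg s)) :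
    HasSum (fun i => ofCoeff (ξ i) (η i)) u := by
  rw [HasSum, tendsto_iff_edist_tendsto_0]
  refine tendsto_of_tendsto_of_tendsto_of_le_of_le tendsto_const_nhds
    (ENNReal.tendsto_tsum_compl_atTop_zero hfin) (fun _ => bot_le) fun S => ?_
  simp only
  rw [edist_comm, edist_eq_enorm_sub, enorm_def]
  refine fourierENorm_le_of_countable (fun i : {i // i ∉ S} => ξ i) (fun i => η i) fun s => ?_
  have hs : Summable fun i => coeff (ξ i) (η i) (leftReg s) :=
    summable_of_enorm hfin fun i => enorm_coeff_le _ _ s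
  have h1 := hs.sum_add_tsum_compl (s := S)
  rw [sub_apply, sum_apply, h s, ← h1]
  simp only [ofCoeff_apply, add_sub_cancel_left]
  rfl

end FourierAlg

theorem enorm_coeff_apply_le (ξ η : L2 G) (T : L2 G →L[ℂ] L2 G) :
    ‖coeff ξ η T‖ₑ ≤ ‖T‖ₑ * (‖ξ‖ₑ * ‖η‖ₑ) := by
  have h : ‖coeff ξ η T‖ ≤ ‖T‖ * (‖ξ‖ * ‖η‖) := by
    refine (norm_inner_le_norm (𝕜 := ℂ) η (T ξ)).trans ?_
    calc ‖η‖ * ‖T ξ‖ ≤ ‖η‖ * (‖T‖ * ‖ξ‖) := by gcongr; exact T.le_opNorm _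
      _ = _ := by ring
  simp only [← ofReal_norm, ← ENNReal.ofReal_mul (norm_nonneg _)]
  exact ENNReal.ofReal_le_ofReal h

/-- The pairing may be computed from an expansion over any countable index set. -/
theorem vnPairing_eq_tsum {ι : Type*} [Countable ι] {T : L2 G →L[ℂ] L2 G} (hT : T ∈ groupVN G)
    {u : G → ℂ} {ξ η : ι → L2 G} (hfin : ∑' i, ‖ξ i‖ₑ * ‖η i‖ₑ ≠ ∞)
    (h : ∀ s, u s = ∑' i, coeff (ξ i) (η i) (leftReg s)) :
    vnPairing T u = ∑' i, coeff (ξ i) (η i) T := by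
  obtain ⟨f, hf⟩ := exists_injective_nat ι
  have key : ∀ n ∉ Set.range f, Function.extend f ξ 0 n = 0 := by
    intro n hn
    rw [Function.extend_apply' _ _ _ (by simpa using hn)]; rfl
  have e1 : ∑' n, ‖Function.extend f ξ 0 n‖ₑ * ‖Function.extend f η 0 n‖ₑ
      = ∑' i, ‖ξ i‖ₑ * ‖η i‖ₑ := by
    rw [← hf.tsum_eq]
    · simp [hf.extend_apply]
    · intro n hn
      by_contra h'
      exact hn (by simp [key n h'])
  have e2 : ∀ S : L2 G →L[ℂ] L2 G,
      ∑' n, coeff (Function.extend f ξ 0 n) (Function.extend f η 0 n) S =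
        ∑' i, coeff (ξ i) (η i) S := by
    intro S
    rw [← hf.tsum_eq (f := fun n => coeff (Function.extend f ξ 0 n) (Function.extend f η 0 n) S)]
    · simp [hf.extend_apply]
    · intro n hn
      by_contra h'
      exact hn (by simp [key n h', coeff])
  rw [vnPairing_eq hT (ξ := Function.extend f ξ 0) (η := Function.extend f η 0)
    ⟨by rwa [e1], fun s => by rw [h s, e2]⟩, e2]

theorem FourierAlg.exists_rep (u : FourierAlg G) : ∃ ξ η : ℕ → L2 G, IsFourierRep u ξ η := by
  obtain ⟨ξ, η, h, -⟩ := exists_rep_lt u.fourierENorm_ne_top.lt_top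
  exact ⟨ξ, η, h⟩

theorem summable_coeff {ι : Type*} {ξ η : ι → L2 G} (hfin : ∑' i, ‖ξ i‖ₑ * ‖η i‖ₑ ≠ ∞)
    (T : L2 G →L[ℂ] L2 G) : Summable fun i => coeff (ξ i) (η i) T := by
  refine summable_of_enorm (g := fun i => ‖T‖ₑ * (‖ξ i‖ₑ * ‖η i‖ₑ)) ?_ fun i =>
    enorm_coeff_apply_le _ _ _
  rw [ENNReal.tsum_mul_left]
  exact ENNReal.mul_ne_top enorm_ne_top hfin

/-- Two expansions are joined to one over the index set `ℕ ⊕ ℕ`. -/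
theorem vnPairing_add {T : L2 G →L[ℂ] L2 G} (hT : T ∈ groupVN G) (u v : FourierAlg G) :
    vnPairing T (u + v : FourierAlg G) = vnPairing T u + vnPairing T v := by
  obtain ⟨ξ, η, h⟩ := u.exists_rep
  obtain ⟨ξ', η', h'⟩ := v.exists_rep
  have hsum : ∀ S, HasSum (fun i : ℕ ⊕ ℕ => coeff (Sum.elim ξ ξ' i) (Sum.elim η η' i) S)
      (∑' n, coeff (ξ n) (η n) S + ∑' n, coeff (ξ' n) (η' n) S) := fun S =>
    HasSum.sum (summable_coeff h.1 S).hasSum (summable_coeff h'.1 S).hasSum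
  rw [vnPairing_eq hT h, vnPairing_eq hT h', ← (hsum T).tsum_eq]
  refine vnPairing_eq_tsum hT ?_ fun s => ?_
  · have : HasSum (fun i : ℕ ⊕ ℕ => ‖Sum.elim ξ ξ' i‖ₑ * ‖Sum.elim η η' i‖ₑ)
        (∑' n, ‖ξ n‖ₑ * ‖η n‖ₑ + ∑' n, ‖ξ' n‖ₑ * ‖η' n‖ₑ) :=
      HasSum.sum ENNReal.summable.hasSum ENNReal.summable.hasSum
    rw [this.tsum_eq]
    exact ENNReal.add_ne_top.2 ⟨h.1, h'.1⟩
  · rw [(hsum _).tsum_eq, ← h.2, ← h'.2]; rfl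

theorem vnPairing_smul {T : L2 G →L[ℂ] L2 G} (hT : T ∈ groupVN G) (c : ℂ) (u : FourierAlg G) :
    vnPairing T (c • u : FourierAlg G) = c * vnPairing T u := by
  obtain ⟨ξ, η, h⟩ := u.exists_rep
  have hs : ∀ S, ∑' n, coeff (c • ξ n) (η n) S = c * ∑' n, coeff (ξ n) (η n) S := fun S => by
    simp [coeff, inner_smul_right, tsum_mul_left]
  rw [vnPairing_eq hT h, ← hs]
  refine vnPairing_eq_tsum hT ?_ fun s => ?_
  · simp only [enorm_smul, mul_assoc]
    rw [ENNReal.tsum_mul_left]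
    exact ENNReal.mul_ne_top enorm_ne_top h.1
  · rw [hs, ← h.2]; rfl

theorem enorm_vnPairing_le {T : L2 G →L[ℂ] L2 G} (hT : T ∈ groupVN G) (u : FourierAlg G) :
    ‖vnPairing T u‖ₑ ≤ ‖T‖ₑ * ‖u‖ₑ := by
  rw [FourierAlg.enorm_def, mul_comm]
  by_cases h0 : ‖T‖ₑ = 0
  · obtain ⟨ξ, η, h⟩ := u.exists_rep
    have hT0 : T = 0 := norm_eq_zero.1 (by rw [← toReal_enorm, h0]; rfl)
    rw [vnPairing_eq hT h, hT0]
    simp [coeff]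
  rw [← ENNReal.div_le_iff_le_mul (Or.inl h0) (Or.inl enorm_ne_top)]
  refine le_iInf fun ξ => le_iInf fun η => le_iInf fun h => ?_
  rw [ENNReal.div_le_iff_le_mul (Or.inl h0) (Or.inl enorm_ne_top), vnPairing_eq hT h, mul_comm,
    ← ENNReal.tsum_mul_left]
  exact (enorm_tsum_le _).trans (ENNReal.tsum_le_tsum fun n => enorm_coeff_apply_le _ _ _)

/-- An element of `VN(G)` as a bounded functional on `A(G)`. -/
def vnFunctional (T : L2 G →L[ℂ] L2 G) (hT : T ∈ groupVN G) : FourierAlg G →L[ℂ] ℂ :=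
  LinearMap.mkContinuous
    { toFun := fun u => vnPairing T u
      map_add' := vnPairing_add hT
      map_smul' := vnPairing_smul hT } ‖T‖ fun u => by
    have := ENNReal.toReal_mono (ENNReal.mul_ne_top enorm_ne_top enorm_ne_top)
      (enorm_vnPairing_le hT u)
    rwa [ENNReal.toReal_mul, toReal_enorm, toReal_enorm, toReal_enorm] at this

@[simp] theorem vnFunctional_apply {T : L2 G →L[ℂ] L2 G} (hT : T ∈ groupVN G) (u : FourierAlg G) :
    vnFunctional T hT u = vnPairing T u := rfl

theorem vnPairing_ofCoeff {T : L2 G →L[ℂ] L2 G} (hT : T ∈ groupVN G) (ξ η : L2 G) :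
    vnPairing T (FourierAlg.ofCoeff ξ η) = coeff ξ η T := by
  simpa using vnPairing_eq_tsum (ι := Unit) hT (u := FourierAlg.ofCoeff ξ η) (ξ := fun _ => ξ)
    (η := fun _ => η) (by simp [ENNReal.mul_eq_top]) (by simp)

/-- Operators whose matrix coefficients depend only on the coefficient functions of the left regular
representation lie in `VN(G)`. -/
theorem mem_groupVN_of_coeff {T : L2 G →L[ℂ] L2 G} (f : FourierAlg G → ℂ)
    (h : ∀ ξ η, coeff ξ η T = f (FourierAlg.ofCoeff ξ η)) : T ∈ groupVN G := by
  intro S hS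
  ext1 ξ
  refine ext_inner_left ℂ fun η => ?_
  have h1 : FourierAlg.ofCoeff (S ξ) η = FourierAlg.ofCoeff ξ (ContinuousLinearMap.adjoint S η) := by
    ext s
    simp only [FourierAlg.ofCoeff_apply, coeff, ContinuousLinearMap.adjoint_inner_left]
    have := congrArg (fun R : L2 G →L[ℂ] L2 G => R ξ) (hS _ ⟨s, rfl⟩)
    exact congrArg _ this
  have h2 := h (S ξ) η
  rw [h1, ← h, coeff, coeff, ContinuousLinearMap.adjoint_inner_left] at h2
  exact h2.symm

/-- The operators `λ(s)` lie in `VN(G)`. -/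
theorem leftReg_mem_groupVN (s : G) : leftReg s ∈ groupVN G :=
  mem_groupVN_of_coeff (fun u => u s) fun _ _ => rfl

theorem vnPairing_leftReg (s : G) (u : FourierAlg G) : vnPairing (leftReg s) u = u s := by
  obtain ⟨ξ, η, h⟩ := u.exists_rep
  rw [vnPairing_eq (leftReg_mem_groupVN s) h, h.2]

/-- A bounded functional on `A(G)` is given by an operator in `VN(G)`. -/
theorem exists_vn_of_functional (f : FourierAlg G →L[ℂ] ℂ) :
    ∃ T ∈ groupVN G, ∀ u : FourierAlg G, vnPairing T u = f u := by
  -- the sesquilinear form `(η, ξ) ↦ f(⟨λ(·) ξ, η⟩)` is that of an operator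
  let B : L2 G →L⋆[ℂ] L2 G →L[ℂ] ℂ :=
    (ContinuousLinearMap.compL ℂ (L2 G) (FourierAlg G) ℂ f).comp (FourierAlg.ofCoeffL G)
  let T := ContinuousLinearMap.adjoint (InnerProductSpace.continuousLinearMapOfBilin B)
  have h : ∀ ξ η, coeff ξ η T = f (FourierAlg.ofCoeff ξ η) := fun ξ η => by
    rw [coeff, ContinuousLinearMap.adjoint_inner_right,
      InnerProductSpace.continuousLinearMapOfBilin_apply]
    rfl
  have hT : T ∈ groupVN G := mem_groupVN_of_coeff f h
  refine ⟨T, hT, fun u => ?_⟩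
  obtain ⟨ξ, η, hr⟩ := u.exists_rep
  rw [vnPairing_eq hT hr]
  simp only [h]
  exact (f.hasSum (FourierAlg.hasSum_ofCoeff hr.1 hr.2)).tsum_eq

end FourierAlgebra

/-! ### Matrices over `VN(G)` and expansions by continuous vectors of compact support -/

section VNMatrices

variable {G : Type*} [Group G] [TopologicalSpace G] [IsTopologicalGroup G]
  [LocallyCompactSpace G] [MeasurableSpace G] [BorelSpace G]

/-- The class `ξ ∈ L²(G)` has a continuous representative of compact support. -/
def IsCc (ξ : L2 G) : Prop :=
  ∃ (v : G → ℂ) (hv : Continuous v) (hc : HasCompactSupport v), (memLp_two hv hc).toLp v = ξ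

theorem dense_isCc : Dense {ξ : L2 G | IsCc ξ} := by
  intro f
  rw [EMetric.mem_closure_iff]
  intro δ hδ
  obtain ⟨g, hle, hg, hgc⟩ := exists_compactSupport_approx (Lp.memLp f)
    (ENNReal.half_pos hδ.ne').ne'
  refine ⟨_, ⟨g, hg, hgc, rfl⟩, ?_⟩
  by_cases hδt : δ = ∞
  · rw [hδt]; exact edist_lt_top _ _
  nth_rewrite 1 [← Lp.toLp_coeFn f (Lp.memLp f)]
  rw [Lp.edist_toLp_toLp]
  exact hle.trans_lt (ENNReal.half_lt_self hδ.ne' hδt)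

theorem continuous_l2 {κ E : Type*} [Fintype κ] [SeminormedAddCommGroup E] :
    Continuous fun x : κ → E => l2 x := by
  unfold l2; fun_prop

theorem OpBound.of_dense {H κ : Type*} [NormedAddCommGroup H] [InnerProductSpace ℂ H] [Fintype κ]
    {T : κ → κ → H →L[ℂ] H} {c : ℝ} {D : Set H} (hD : Dense D)
    (h : ∀ x y : κ → H, (∀ k, x k ∈ D) → (∀ k, y k ∈ D) →
      ‖∑ k, ∑ l, (inner ℂ (y k) (T k l (x l)) : ℂ)‖ ≤ c * l2 x * l2 y) : OpBound T c := by
  have hd : Dense (Set.univ.pi fun _ : κ => D) := dense_pi _ fun _ _ => hD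
  have hcl : IsClosed {p : (κ → H) × (κ → H) |
      ‖∑ k, ∑ l, (inner ℂ (p.2 k) (T k l (p.1 l)) : ℂ)‖ ≤ c * l2 p.1 * l2 p.2} := by
    refine isClosed_le ?_ ?_
    · refine continuous_norm.comp (continuous_finsetSum _ fun k _ => continuous_finsetSum _
        fun l _ => Continuous.inner ?_ ?_)
      · exact (continuous_apply k).comp continuous_snd
      · exact (T k l).continuous.comp ((continuous_apply l).comp continuous_fst)
    · exact (continuous_const.mul (continuous_l2.comp continuous_fst)).mul
        (continuous_l2.comp continuous_snd)
  refine OpBound.of_form_le fun x y => ?_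
  refine (closure_minimal ?_ hcl) ((hd.prod hd) (x, y))
  rintro ⟨x, y⟩ ⟨hx, hy⟩
  exact h x y (fun k => hx k trivial) (fun k => hy k trivial)

/-- A matrix of functionals on `A(G)` that satisfies a Hilbert space bound on the coefficients of
continuous vectors of compact support is a matrix over `VN(G)` with the same bound. -/
theorem exists_vn_matrix {κ : Type*} [Fintype κ] (L : κ → κ → FourierAlg G →L[ℂ] ℂ) {c : ℝ}
    (h : ∀ x y : κ → L2 G, (∀ k, IsCc (x k)) → (∀ k, IsCc (y k)) →
      ‖∑ k, ∑ l, L k l (FourierAlg.ofCoeff (x l) (y k))‖ ≤ c * l2 x * l2 y) :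
    ∃ T : κ → κ → L2 G →L[ℂ] L2 G, (∀ k l, T k l ∈ groupVN G) ∧ OpBound T c ∧
      ∀ k l (u : FourierAlg G), vnPairing (T k l) u = L k l u := by
  choose T hT hTL using fun k l => exists_vn_of_functional (L k l)
  refine ⟨T, hT, OpBound.of_dense dense_isCc fun x y hx hy => ?_, hTL⟩
  have := h x y hx hy
  simp only [← hTL, vnPairing_ofCoeff (hT _ _)] at this
  exact this

/-- Square-summable families of vectors give absolutely convergent coefficient expansions. -/
theorem tsum_enorm_mul_ne_top {ι : Type*} {ξ η : ι → L2 G} {A B : ℝ}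
    (hξ : ∀ S : Finset ι, ∑ i ∈ S, ‖ξ i‖ ^ 2 ≤ A ^ 2)
    (hη : ∀ S : Finset ι, ∑ i ∈ S, ‖η i‖ ^ 2 ≤ B ^ 2) : ∑' i, ‖ξ i‖ₑ * ‖η i‖ₑ ≠ ∞ := by
  have key : ∀ {ξ : ι → L2 G} {A : ℝ}, (∀ S : Finset ι, ∑ i ∈ S, ‖ξ i‖ ^ 2 ≤ A ^ 2) →
      ∑' i, ‖ξ i‖ₑ ^ 2 ≤ (ENNReal.ofReal |A|) ^ 2 := by
    intro ξ A h
    rw [ENNReal.tsum_eq_iSup_sum]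
    refine iSup_le fun S => ?_
    simp only [← ofReal_norm, ← ENNReal.ofReal_pow (norm_nonneg _)]
    rw [← ENNReal.ofReal_sum_of_nonneg fun _ _ => sq_nonneg _, ← ENNReal.ofReal_pow (abs_nonneg _),
      sq_abs]
    exact ENNReal.ofReal_le_ofReal (h S)
  exact ne_top_of_le_ne_top (ENNReal.mul_ne_top ENNReal.ofReal_ne_top ENNReal.ofReal_ne_top)
    (tsum_mul_le_of_sq (key hξ) (key hη))

/-- The pairing of a matrix over `VN(G)` with a matrix of functions that are expanded into
coefficients over a common countable index set: only the square sums of the vectors enter. -/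
theorem norm_sum_vnPairing_le {κ ι : Type*} [Fintype κ] [Countable ι]
    {T : κ → κ → L2 G →L[ℂ] L2 G} (hT : ∀ k l, T k l ∈ groupVN G) {c : ℝ} (hc : 0 ≤ c)
    (hb : OpBound T c) {u : κ → κ → FourierAlg G} {ξ η : ι → κ → L2 G} {A B : κ → ℝ}
    (hξ : ∀ k (S : Finset ι), ∑ i ∈ S, ‖ξ i k‖ ^ 2 ≤ A k ^ 2)
    (hη : ∀ k (S : Finset ι), ∑ i ∈ S, ‖η i k‖ ^ 2 ≤ B k ^ 2)
    (hu : ∀ k l s, u k l s = ∑' i, coeff (ξ i l) (η i k) (leftReg s)) :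
    ‖∑ k, ∑ l, vnPairing (T k l) (u k l)‖ ≤ c * l2 A * l2 B := by
  have hfin : ∀ k l, ∑' i, ‖ξ i l‖ₑ * ‖η i k‖ₑ ≠ ∞ := fun k l =>
    tsum_enorm_mul_ne_top (hξ l) (hη k)
  have hs : HasSum (fun i => ∑ k, ∑ l, coeff (ξ i l) (η i k) (T k l))
      (∑ k, ∑ l, vnPairing (T k l) (u k l)) := by
    refine hasSum_sum fun k _ => hasSum_sum fun l _ => ?_
    rw [vnPairing_eq_tsum (hT k l) (hfin k l) (hu k l)]
    exact (summable_coeff (hfin k l) _).hasSum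
  refine le_of_tendsto hs.norm (Eventually.of_forall fun S => ?_)
  have hsq : ∀ {ξ : ι → κ → L2 G} {A : κ → ℝ},
      (∀ k (S : Finset ι), ∑ i ∈ S, ‖ξ i k‖ ^ 2 ≤ A k ^ 2) →
      √(∑ i ∈ S, l2 (ξ i) ^ 2) ≤ l2 A := by
    intro ξ A h
    refine Real.sqrt_le_sqrt ?_
    simp only [l2_sq]
    rw [Finset.sum_comm]
    refine Finset.sum_le_sum fun k _ => ?_
    rw [Real.norm_eq_abs, sq_abs]
    exact h k S
  calc ‖∑ i ∈ S, ∑ k, ∑ l, coeff (ξ i l) (η i k) (T k l)‖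
      ≤ ∑ i ∈ S, c * l2 (ξ i) * l2 (η i) :=
        (norm_sum_le _ _).trans (Finset.sum_le_sum fun i _ => hb.form_le _ _)
    _ = c * ∑ i ∈ S, l2 (ξ i) * l2 (η i) := by
        rw [Finset.mul_sum]; exact Finset.sum_congr rfl fun i _ => mul_assoc _ _ _
    _ ≤ c * (√(∑ i ∈ S, l2 (ξ i) ^ 2) * √(∑ i ∈ S, l2 (η i) ^ 2)) := by
        gcongr; exact Real.sum_mul_le_sqrt_mul_sqrt _ _ _
    _ ≤ c * (l2 A * l2 B) := by
        exact mul_le_mul_of_nonneg_left (mul_le_mul (hsq hξ) (hsq hη) (Real.sqrt_nonneg _)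
          (l2_nonneg _)) hc
    _ = _ := (mul_assoc _ _ _).symm

/-- The unit ball of `VN(G)` norms `A(G)`. -/
theorem norm_le_of_vnPairing {u : FourierAlg G} {c : ℝ}
    (h : ∀ T ∈ groupVN G, ‖T‖ ≤ 1 → ‖vnPairing T u‖ ≤ c) : ‖u‖ ≤ c := by
  obtain ⟨f, hf, hfu⟩ := exists_dual_vector'' ℂ u
  obtain ⟨T, hT, hb, hTf⟩ := exists_vn_matrix (κ := Unit) (fun _ _ => f) (c := 1) fun x y _ _ => by
    simp only [Finset.univ_unique, Finset.sum_singleton, l2, Real.sqrt_sq (norm_nonneg _), one_mul]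
    exact (f.le_of_opNorm_le hf _).trans (by
      rw [one_mul]; exact FourierAlg.norm_ofCoeff_le _ _)
  have h1 := h (T () ()) (hT _ _) (OpBound.norm_le zero_le_one hb)
  rw [hTf, hfu] at h1
  simpa using h1

/-- Functions in `A(G)` have nearly optimal expansions by continuous vectors of compact support. -/
theorem FourierAlg.exists_isCc_rep (u : FourierAlg G) {ε : ℝ≥0} (hε : 0 < ε) :
    ∃ ξ η : ℕ × ℕ × ℕ → L2 G, (∀ i, IsCc (ξ i)) ∧ (∀ i, IsCc (η i)) ∧
      (∀ s, u s = ∑' i, coeff (ξ i) (η i) (leftReg s)) ∧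
      ∑' i, ‖ξ i‖ₑ * ‖η i‖ₑ ≤ ‖u‖ₑ + ε := by
  have hε2 : ((ε / 2 : ℝ≥0) : ℝ≥0∞) ≠ 0 := by simpa using hε.ne'
  obtain ⟨ξ, η, h, hlt⟩ := exists_rep_lt (ENNReal.lt_add_right u.fourierENorm_ne_top hε2)
  obtain ⟨δ, hδ, hδε⟩ := ENNReal.exists_pos_sum_of_countable (ι := ℕ) hε2
  -- the slack `γ` allowed in the norms of the `n`-th pair of vectors
  have hγ : ∀ n, ∃ γ : ℝ≥0, 0 < γ ∧
      (‖ξ n‖ₑ + γ) * (‖η n‖ₑ + γ) ≤ ‖ξ n‖ₑ * ‖η n‖ₑ + δ n := by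
    intro n
    have h1 := tendsto_add_mul_add (A := ‖ξ n‖ₑ) (B := ‖η n‖ₑ) (C := 1) enorm_ne_top enorm_ne_top
      ENNReal.one_ne_top
    simp only [mul_one] at h1
    have h2 : ‖ξ n‖ₑ * ‖η n‖ₑ < ‖ξ n‖ₑ * ‖η n‖ₑ + δ n :=
      ENNReal.lt_add_right (ENNReal.mul_ne_top enorm_ne_top enorm_ne_top)
        (ENNReal.coe_ne_zero.2 (hδ n).ne')
    obtain ⟨γ, h3, h4⟩ := ((h1.eventually (gt_mem_nhds h2)).and self_mem_nhdsWithin).exists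
    exact ⟨γ, h4, h3.le⟩
  choose γ hγ0 hγ using hγ
  -- each vector is an absolutely convergent series of continuous vectors of compact support
  choose V hVc hV hVs using fun n => exists_compactSupport_sum (ξ n) (hγ0 n)
  choose W hWc hW hWs using fun n => exists_compactSupport_sum (η n) (hγ0 n)
  have hle : ∑' i : ℕ × ℕ × ℕ, ‖V i.1 i.2.1‖ₑ * ‖W i.1 i.2.2‖ₑ ≤ ‖u‖ₑ + ε := by
    rw [ENNReal.tsum_prod']
    calc ∑' n, ∑' p : ℕ × ℕ, ‖V n p.1‖ₑ * ‖W n p.2‖ₑ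
        ≤ ∑' n, (‖ξ n‖ₑ * ‖η n‖ₑ + δ n) := by
          refine ENNReal.tsum_le_tsum fun n => ?_
          rw [ENNReal.tsum_prod']
          simp only [ENNReal.tsum_mul_left, ENNReal.tsum_mul_right]
          exact (mul_le_mul' (hV n) (hW n)).trans (hγ n)
      _ = ∑' n, ‖ξ n‖ₑ * ‖η n‖ₑ + ∑' n, (δ n : ℝ≥0∞) := ENNReal.tsum_add
      _ ≤ (‖u‖ₑ + (ε / 2 : ℝ≥0)) + (ε / 2 : ℝ≥0) := by
          rw [FourierAlg.enorm_def]; exact add_le_add hlt.le hδε.le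
      _ = ‖u‖ₑ + ε := by rw [add_assoc, ← ENNReal.coe_add, add_halves]
  have hfin : ∑' i : ℕ × ℕ × ℕ, ‖V i.1 i.2.1‖ₑ * ‖W i.1 i.2.2‖ₑ ≠ ∞ :=
    ne_top_of_le_ne_top (by simp) hle
  refine ⟨fun i => V i.1 i.2.1, fun i => W i.1 i.2.2, fun i => hVc _ _, fun i => hWc _ _,
    fun s => ?_, hle⟩
  have hs := summable_coeff hfin (leftReg s)
  rw [h.2 s, hs.tsum_prod]
  exact tsum_congr fun n => inner_eq_tsum_prod (leftReg s) (hVs n) (hWs n) (hs.prod_factor n)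

end VNMatrices

/-! ### Fell absorption and the multiplication of `A(G)` -/

section Fell

variable {G : Type*} [Group G] [TopologicalSpace G] [IsTopologicalGroup G]
  [LocallyCompactSpace G] [MeasurableSpace G] [BorelSpace G]

/-- Coefficient functions of the left translation on `L²(G; K)` are sums of coefficients of the left
regular representation: expand the vectors in an orthonormal basis of `K`. -/
theorem exists_expansion_of_vector_valued {K κ : Type*} [NormedAddCommGroup K]
    [InnerProductSpace ℂ K] [CompleteSpace K] [Fintype κ] {h k : κ → G → K}
    (hh : ∀ a, Continuous (h a)) (hhc : ∀ a, HasCompactSupport (h a))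
    (hk : ∀ a, Continuous (k a)) (hkc : ∀ a, HasCompactSupport (k a)) :
    ∃ (w : Set K) (I : Set w) (_ : I.Countable) (ξ η : I → κ → L2 G),
      (∀ a (S : Finset I), ∑ i ∈ S, ‖ξ i a‖ ^ 2 ≤ ∫ x, ‖h a x‖ ^ 2 ∂(Measure.haar : Measure G)) ∧
      (∀ a (S : Finset I), ∑ i ∈ S, ‖η i a‖ ^ 2 ≤ ∫ x, ‖k a x‖ ^ 2 ∂(Measure.haar : Measure G)) ∧
      ∀ a b s, ∫ x, inner ℂ (k a x) (h b (s⁻¹ * x)) ∂(Measure.haar : Measure G) =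
        ∑' i, coeff (ξ i b) (η i a) (leftReg s) := by
  obtain ⟨w, b, -⟩ := exists_hilbertBasis ℂ K
  -- the range of `h a` is separable, so only countably many coordinates of it are nonzero
  have hI : ∀ a, ∃ I : Set w, I.Countable ∧ ∀ i ∉ I, ∀ x, (inner ℂ (b i) (h a x) : ℂ) = 0 := by
    intro a
    obtain ⟨D, hD, hKD⟩ := ((hhc a).isCompact.image (hh a)).isSeparable
    refine ⟨⋃ y ∈ D, {i | inner ℂ (b i) y ≠ (0 : ℂ)}, ?_, ?_⟩
    · refine hD.biUnion fun y _ => ?_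
      have hs : Summable fun i => ‖(inner ℂ (b i) y : ℂ)‖ ^ 2 := by
        refine ((b.summable_inner_mul_inner y y).norm).congr fun i => ?_
        rw [norm_mul, norm_inner_symm y, sq]
      refine hs.countable_support.mono fun i hi => ?_
      simpa using hi
    · intro i hi x
      by_cases hx : h a x = 0
      · simp [hx]
      have hcl : IsClosed {y : K | inner ℂ (b i) y = (0 : ℂ)} :=
        isClosed_eq (continuous_const.inner continuous_id) continuous_const
      have : D ⊆ {y : K | inner ℂ (b i) y = (0 : ℂ)} := by
        intro y hy
        by_contra hne
        exact hi (Set.mem_biUnion hy hne)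
      exact (closure_minimal this hcl) (hKD ⟨x, subset_tsupport (h a) hx, rfl⟩)
  choose J hJc hJ using hI
  let I : Set w := ⋃ a, J a
  have hIc : I.Countable := Set.countable_iUnion hJc
  have : Countable I := hIc.to_subtype
  have hI0 : ∀ i ∉ I, ∀ a x, (inner ℂ (b i) (h a x) : ℂ) = 0 := fun i hi a x =>
    hJ a i (fun hia => hi (Set.mem_iUnion.2 ⟨a, hia⟩)) x
  have hcont : ∀ {f : G → K}, Continuous f → ∀ i : I,
      Continuous fun x => (inner ℂ (b i) (f x) : ℂ) :=
    fun hf i => continuous_const.inner hf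
  have hsupp : ∀ {f : G → K}, HasCompactSupport f → ∀ i : I,
      HasCompactSupport fun x => (inner ℂ (b i) (f x) : ℂ) :=
    fun hf i => hf.comp_left (g := fun y => (inner ℂ (b i) y : ℂ)) (inner_zero_right _)
  have hsq : ∀ {f : G → K} (hf : Continuous f) (hc : HasCompactSupport f) (S : Finset I),
      ∑ i ∈ S, ‖(memLp_two (hcont hf i) (hsupp hc i)).toLp _‖ ^ 2 ≤
        ∫ x, ‖f x‖ ^ 2 ∂(Measure.haar : Measure G) := by
    intro f hf hc S
    simp only [norm_toLp_sq]
    have hint : ∀ i : I, Integrable (fun x => ‖(inner ℂ (b i) (f x) : ℂ)‖ ^ 2)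
        (Measure.haar : Measure G) := fun i =>
      (memLp_two (hcont hf i) (hsupp hc i)).integrable_norm_pow two_ne_zero
    rw [← integral_finsetSum _ fun i _ => hint i]
    refine integral_mono (integrable_finsetSum _ fun i _ => hint i) ?_ fun x => ?_
    · exact Continuous.integrable_of_hasCompactSupport (by fun_prop)
        (hc.comp_left (g := fun y : K => ‖y‖ ^ 2) (by simp))
    · have h1 : Orthonormal ℂ fun i : I => b i := b.orthonormal.comp _ Subtype.val_injective
      exact h1.sum_inner_products_le (f x)
  refine ⟨w, I, hIc, fun i a => (memLp_two (hcont (hh a) i) (hsupp (hhc a) i)).toLp _,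
    fun i a => (memLp_two (hcont (hk a) i) (hsupp (hkc a) i)).toLp _,
    fun a S => hsq (hh a) (hhc a) S, fun a S => hsq (hk a) (hkc a) S, fun a c s => ?_⟩
  have hFs : ∀ i : I, MemLp (fun x => (inner ℂ (b i) (h c (s⁻¹ * x)) : ℂ)) 2
      (Measure.haar : Measure G) := fun i =>
    (memLp_two (hcont (hh c) i) (hsupp (hhc c) i)).comp_measurePreserving
      (measurePreserving_mul_left Measure.haar s⁻¹)
  have hFsn : ∀ i : I, ‖(hFs i).toLp _‖ₑ =
      ‖(memLp_two (hcont (hh c) i) (hsupp (hhc c) i)).toLp _‖ₑ := fun i => by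
    have := norm_leftReg s ((memLp_two (hcont (hh c) i) (hsupp (hhc c) i)).toLp _)
    simp only [leftReg_toLp] at this
    simp only [← ofReal_norm, ← this]
  have hpt : ∀ x, (inner ℂ (k a x) (h c (s⁻¹ * x)) : ℂ) =
      ∑' i : I, (inner ℂ (b i) (h c (s⁻¹ * x)) : ℂ) * star (inner ℂ (b i) (k a x) : ℂ) := by
    intro x
    rw [← b.tsum_inner_mul_inner, ← tsum_subtype_eq_of_support_subset (s := I)]
    · refine tsum_congr fun i => ?_
      rw [mul_comm, ← inner_conj_symm (k a x) (b i)]; rfl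
    · intro i hi
      by_contra hne
      exact hi (by simp [hI0 i hne])
  simp only [coeff, leftReg_toLp, inner_toLp]
  simp_rw [hpt]
  refine integral_tsum (fun i => ?_) ?_
  · exact (hFs i).1.mul (memLp_two (hcont (hk a) i) (hsupp (hkc a) i)).1.star
  · refine ne_top_of_le_ne_top (tsum_enorm_mul_ne_top
      (fun S => (hsq (hh c) (hhc c) S).trans_eq (Real.sq_sqrt (integral_nonneg fun _ =>
        sq_nonneg _)).symm)
      (fun S => (hsq (hk a) (hkc a) S).trans_eq (Real.sq_sqrt (integral_nonneg fun _ =>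
        sq_nonneg _)).symm))
      (ENNReal.tsum_le_tsum fun i => (lintegral_mul_le_toLp (hFs i)
        (memLp_two (hcont (hk a) i) (hsupp (hkc a) i))).trans_eq ?_)
    rw [hFsn]

/-- For an orthonormal family `e`, multiplication by the coefficients of `e` maps bounded matrices
over `VN(G)` to bounded matrices over `VN(G)`: the unitary `f ⊗ e ↦ (x ↦ f(x) λ(x⁻¹) e)` turns
`λ ⊗ λ` into `λ ⊗ 1`. -/
theorem norm_sum_vnPairing_mul_le {κ d : Type*} [Fintype κ] [Fintype d]
    {T : κ → κ → L2 G →L[ℂ] L2 G} (hT : ∀ k l, T k l ∈ groupVN G) {c : ℝ} (hc : 0 ≤ c)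
    (hb : OpBound T c) {e : d → L2 G} (he : Orthonormal ℂ e) {x y : κ × d → L2 G}
    (hx : ∀ k, IsCc (x k)) (hy : ∀ k, IsCc (y k)) :
    ‖∑ p : κ × d, ∑ q : κ × d, vnPairing (T p.1 q.1)
      (FourierAlg.ofCoeff (e q.2) (e p.2) * FourierAlg.ofCoeff (x q) (y p) : FourierAlg G)‖ ≤
      c * l2 x * l2 y := by
  choose f hf hfc hfx using hx
  choose g hg hgc hgy using hy
  -- the vector valued functions `x ↦ ∑ f(x) λ(x⁻¹) e`
  let V : (κ × d → G → ℂ) → κ → G → L2 G := fun f a x => ∑ l, f (a, l) x • leftReg x⁻¹ (e l)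
  have hVc : ∀ {f : κ × d → G → ℂ}, (∀ p, Continuous (f p)) → ∀ a, Continuous (V f a) :=
    fun hf a => continuous_finsetSum _ fun l _ =>
      (hf _).smul ((continuous_leftReg _).comp continuous_inv)
  have hVs : ∀ {f : κ × d → G → ℂ}, (∀ p, HasCompactSupport (f p)) → ∀ a,
      HasCompactSupport (V f a) := by
    intro f hf a
    refine HasCompactSupport.intro (K := ⋃ l, tsupport (f (a, l)))
      (isCompact_iUnion fun l => hf (a, l)) fun x hx => Finset.sum_eq_zero fun l _ => ?_
    rw [image_eq_zero_of_notMem_tsupport fun h => hx (Set.mem_iUnion.2 ⟨l, h⟩), zero_smul]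
  have horth : ∀ x : G, Orthonormal ℂ fun l => leftReg x⁻¹ (e l) := fun x =>
    he.comp_linearIsometry (Lp.compMeasurePreservingₗᵢ ℂ (fun y : G => x⁻¹⁻¹ * y)
      (measurePreserving_mul_left Measure.haar x⁻¹⁻¹))
  have hVn : ∀ (f : κ × d → G → ℂ) a x, ‖V f a x‖ ^ 2 = ∑ l, ‖f (a, l) x‖ ^ 2 := by
    intro f a x
    have := (horth x).inner_sum (fun l => f (a, l) x) (fun l => f (a, l) x) Finset.univ
    rw [inner_self_eq_norm_sq_to_K] at this
    have h2 : ((‖V f a x‖ ^ 2 : ℝ) : ℂ) = ((∑ l, ‖f (a, l) x‖ ^ 2 : ℝ) : ℂ) := by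
      push_cast
      refine this.trans (Finset.sum_congr rfl fun l _ => ?_)
      rw [Complex.conj_mul']
    exact Complex.ofReal_injective h2
  obtain ⟨w, I, hI, ξ, η, hξ, hη, hξη⟩ := exists_expansion_of_vector_valued (hVc hf) (hVs hfc)
    (hVc hg) (hVs hgc)
  have : Countable I := hI.to_subtype
  have hsq : ∀ {f : κ × d → G → ℂ} {x : κ × d → L2 G} (hf : ∀ p, Continuous (f p))
      (hfc : ∀ p, HasCompactSupport (f p)), (∀ p, (memLp_two (hf p) (hfc p)).toLp _ = x p) →
      ∀ a, ∫ t, ‖V f a t‖ ^ 2 ∂(Measure.haar : Measure G) = (l2 fun l => x (a, l)) ^ 2 := by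
    intro f x hf hfc hfx a
    simp only [hVn, l2_sq]
    rw [integral_finsetSum _ fun l _ => (memLp_two (hf (a, l)) (hfc _)).integrable_norm_pow
      two_ne_zero]
    exact Finset.sum_congr rfl fun l _ => by rw [← hfx, norm_toLp_sq]
  have key := norm_sum_vnPairing_le hT hc hb (ξ := ξ) (η := η)
    (u := fun a b => ∑ k, ∑ l, FourierAlg.ofCoeff (e l) (e k) *
      FourierAlg.ofCoeff (x (b, l)) (y (a, k)))
    (fun a S => (hξ a S).trans_eq (hsq hf hfc hfx a))
    (fun a S => (hη a S).trans_eq (hsq hg hgc hgy a)) fun a b s => ?_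
  · rw [← l2_prod, ← l2_prod] at key
    refine le_trans (le_of_eq ?_) key
    congr 1
    simp only [Fintype.sum_prod_type]
    refine Finset.sum_congr rfl fun a _ => ?_
    rw [Finset.sum_comm]
    refine Finset.sum_congr rfl fun b _ => ?_
    simp only [← vnFunctional_apply (hT a b), map_sum]
  · rw [← hξη]
    simp only [FourierAlg.sum_apply, FourierAlg.mul_apply, FourierAlg.ofCoeff_apply]
    have hint : ∀ k l, Integrable (fun t => f (b, l) (s⁻¹ * t) * star (g (a, k) t))
        (Measure.haar : Measure G) := fun k l =>
      ((((hf (b, l)).comp (continuous_const_mul s⁻¹)).mul (hg (a, k)).star)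
        ).integrable_of_hasCompactSupport
        (HasCompactSupport.mul_left ((hgc (a, k)).comp_left (g := star) (star_zero ℂ)))
    have h1 : ∀ k l, coeff (x (b, l)) (y (a, k)) (leftReg s) =
        ∫ t, f (b, l) (s⁻¹ * t) * star (g (a, k) t) ∂(Measure.haar : Measure G) := fun k l => by
      rw [← hfx, ← hgy, coeff, leftReg_toLp, inner_toLp]
    simp only [h1, ← integral_const_mul]
    simp_rw [← integral_finsetSum _ fun l _ => (hint _ l).const_mul _]
    rw [← integral_finsetSum _ fun k _ => integrable_finsetSum _ fun l _ => (hint k l).const_mul _]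
    refine integral_congr_ae (Eventually.of_forall fun t => ?_)
    simp only [V, sum_inner, inner_sum, inner_smul_left, inner_smul_right, Finset.mul_sum]
    rw [Finset.sum_comm]
    refine Finset.sum_congr rfl fun l _ => Finset.sum_congr rfl fun k _ => ?_
    have h2 : (inner ℂ (leftReg t⁻¹ (e k)) (leftReg (s⁻¹ * t)⁻¹ (e l)) : ℂ) =
        coeff (e l) (e k) (leftReg s) := by
      rw [mul_inv_rev, inv_inv, leftReg_mul, inner_leftReg]; rfl
    rw [h2]
    simp only [starRingEnd_apply]
    ring

end Fell

section JointMultiplication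

variable {G : Type*} [Group G] [TopologicalSpace G] [IsTopologicalGroup G]
  [LocallyCompactSpace G] [MeasurableSpace G] [BorelSpace G]

/-- The matrix `u` over `A(G)` has norm at most `c` in the operator space structure of the predual
of `VN(G)`. -/
def VNBound {p : Type*} [Fintype p] (u : p → p → FourierAlg G) (c : ℝ) : Prop :=
  ∀ (κ : Type) [Fintype κ] (T : κ → κ → L2 G →L[ℂ] L2 G), (∀ k l, T k l ∈ groupVN G) →
    OpBound T 1 → MatBound (fun r s : p × κ => vnPairing (T r.2 s.2) (u r.1 s.1)) c

theorem vnPairing_smul_left {T : L2 G →L[ℂ] L2 G} (hT : T ∈ groupVN G) (a : ℂ)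
    (u : FourierAlg G) : a • T ∈ groupVN G ∧ vnPairing (a • T) u = a * vnPairing T u := by
  have h : a • T ∈ groupVN G := mem_groupVN_of_coeff (fun u => a * vnPairing T u) fun ξ η => by
    rw [vnPairing_ofCoeff hT]; simp [coeff, inner_smul_right]
  refine ⟨h, ?_⟩
  obtain ⟨ξ, η, hr⟩ := u.exists_rep
  rw [vnPairing_eq h hr, vnPairing_eq hT hr, ← tsum_mul_left]
  simp [coeff, inner_smul_right]

theorem MatBound.smul {ι κ : Type*} [Fintype ι] [Fintype κ] {M : ι → κ → ℂ} {c : ℝ}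
    (h : MatBound M c) (a : ℂ) : MatBound (fun r s => a * M r s) (‖a‖ * c) := by
  intro x y
  have : ∑ r, ∑ s, y r * (a * M r s) * x s = a * ∑ r, ∑ s, y r * M r s * x s := by
    simp only [Finset.mul_sum]
    exact Finset.sum_congr rfl fun r _ => Finset.sum_congr rfl fun s _ => by ring
  rw [this, norm_mul, mul_assoc, mul_assoc]
  refine mul_le_mul_of_nonneg_left ?_ (norm_nonneg a)
  rw [← mul_assoc]; exact h x y

theorem MatBound.mono {ι κ : Type*} [Fintype ι] [Fintype κ] {M : ι → κ → ℂ} {c d : ℝ}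
    (h : MatBound M c) (hcd : c ≤ d) : MatBound M d := fun x y =>
  (h x y).trans (by have := l2_nonneg x; have := l2_nonneg y; gcongr)

theorem MatBound.comp_equiv {ι κ ι' κ' : Type*} [Fintype ι] [Fintype κ] [Fintype ι'] [Fintype κ']
    {M : ι → κ → ℂ} {c : ℝ} (h : MatBound M c) (e : ι' ≃ ι) (f : κ' ≃ κ) :
    MatBound (fun r s => M (e r) (f s)) c := by
  intro x y
  have := h (fun k => x (f.symm k)) fun k => y (e.symm k)
  rw [l2_comp_equiv e.symm, l2_comp_equiv f.symm] at this
  refine le_trans (le_of_eq ?_) this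
  rw [← e.sum_comp]
  congr 1
  refine Finset.sum_congr rfl fun r _ => ?_
  rw [← f.sum_comp]
  simp

/-- The defining estimate for matrices over `VN(G)` of norm at most `d`, with a finite index type in any
universe. -/
theorem VNBound.apply {p κ : Type*} [Fintype p] [Fintype κ] {u : p → p → FourierAlg G} {c d : ℝ}
    (h : VNBound u c) (hd : 0 ≤ d) {T : κ → κ → L2 G →L[ℂ] L2 G}
    (hT : ∀ k l, T k l ∈ groupVN G) (hb : OpBound T d) :
    MatBound (fun r s : p × κ => vnPairing (T r.2 s.2) (u r.1 s.1)) (c * d) := by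
  rcases hd.eq_or_lt' with rfl | hd
  · intro x y
    have h0 : ∀ k l (v : FourierAlg G), vnPairing (T k l) v = 0 := fun k l v => by
      obtain ⟨ξ, η, hr⟩ := v.exists_rep
      rw [vnPairing_eq (hT k l) hr, hb.eq_zero]
      simp [coeff]
    simp [h0]
  · let e := Fintype.equivFin κ
    have hb' : OpBound (fun k l => ((d⁻¹ : ℝ) : ℂ) • T (e.symm k) (e.symm l)) 1 := by
      have := (hb.comp_equiv e.symm).smul ((d⁻¹ : ℝ) : ℂ)
      rwa [Complex.norm_real, Real.norm_of_nonneg (by positivity), inv_mul_cancel₀ hd.ne'] at this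
    have h1 := h (Fin (Fintype.card κ)) _ (fun k l => (vnPairing_smul_left (hT _ _) _ 0).1) hb'
    have h2 := (h1.comp_equiv ((Equiv.refl p).prodCongr e) ((Equiv.refl p).prodCongr e)).smul
      (d : ℂ)
    rw [Complex.norm_real, Real.norm_of_nonneg hd.le, mul_comm] at h2
    convert! h2 using 3 with r s
    simp only [Equiv.prodCongr_apply, Prod.map_snd, Prod.map_fst, Equiv.refl_apply,
      Equiv.symm_apply_apply]
    rw [(vnPairing_smul_left (hT _ _) _ _).2, ← mul_assoc, ← Complex.ofReal_mul,
      mul_inv_cancel₀ hd.ne', Complex.ofReal_one, one_mul]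

theorem exists_orthonormal_expansion {H ι : Type*} [NormedAddCommGroup H] [InnerProductSpace ℂ H]
    [Finite ι] (x : ι → H) : ∃ (n : ℕ) (e : Fin n → H) (X : ι → Fin n → ℂ), Orthonormal ℂ e ∧
      ∀ i, x i = ∑ l, X i l • e l ∧ l2 (X i) = ‖x i‖ := by
  let W := Submodule.span ℂ (Set.range x)
  have : FiniteDimensional ℂ W := FiniteDimensional.span_of_finite ℂ (Set.finite_range x)
  let b := stdOrthonormalBasis ℂ W
  let x' : ι → W := fun i => ⟨x i, Submodule.subset_span ⟨i, rfl⟩⟩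
  refine ⟨_, fun l => (b l : H), fun i l => b.repr (x' i) l,
    b.orthonormal.comp_linearIsometry W.subtypeₗᵢ, fun i => ⟨?_, ?_⟩⟩
  · have := congrArg (fun z : W => (z : H)) (b.sum_repr (x' i))
    simpa [x'] using this.symm
  · rw [l2, ← EuclideanSpace.norm_eq, b.repr.norm_map]; rfl

theorem ofCoeff_sum_sum {n : ℕ} (e : Fin n → L2 G) (X Y : Fin n → ℂ) :
    FourierAlg.ofCoeff (∑ l, X l • e l) (∑ k, Y k • e k) =
      ∑ k, ∑ l, (star (Y k) * X l) • FourierAlg.ofCoeff (e l) (e k) := by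
  simp only [← FourierAlg.ofCoeffL_apply, map_sum, ContinuousLinearMap.map_smulₛₗ,
    _root_.sum_apply, _root_.smul_apply, smul_smul]
  rw [Finset.sum_comm]
  refine Finset.sum_congr rfl fun k _ => Finset.sum_congr rfl fun l _ => ?_
  rfl

/-- The action of `A(G)` on its dual, in matrix form: the functionals `u ↦ ⟨T_ab, v_ij u⟩` form a
matrix over `VN(G)` of norm at most that of `v`, for a contractive matrix `T`. Expanding the vectors
that test the norm in a common orthonormal family `e` reduces this to Fell absorption for the
functionals `u ↦ ⟨T_ab, ⟨λ(·) e_l, e_k⟩ u⟩`, which are then paired with `v`. -/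
theorem VNBound.exists_module_action {p κ : Type*} [Fintype p] [Fintype κ]
    {v : p → p → FourierAlg G} {c : ℝ} (hv : VNBound v c) {T : κ → κ → L2 G →L[ℂ] L2 G}
    (hT : ∀ k l, T k l ∈ groupVN G) (hb : OpBound T 1) :
    ∃ S : p × κ → p × κ → L2 G →L[ℂ] L2 G, (∀ r s, S r s ∈ groupVN G) ∧ OpBound S c ∧
      ∀ r s (u : FourierAlg G),
        vnPairing (S r s) u = vnPairing (T r.2 s.2) (v r.1 s.1 * u : FourierAlg G) := by
  refine exists_vn_matrix (κ := p × κ) (fun r s => (vnFunctional (T r.2 s.2) (hT _ _)).comp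
    (ContinuousLinearMap.mul ℂ (FourierAlg G) (v r.1 s.1))) fun x y _ _ => ?_
  obtain ⟨n, e, Z, he, hZ⟩ := exists_orthonormal_expansion (Sum.elim x y)
  let X : p × κ → Fin n → ℂ := fun i => Z (Sum.inl i)
  let Y : p × κ → Fin n → ℂ := fun i => Z (Sum.inr i)
  have hX : ∀ i, x i = ∑ l, X i l • e l ∧ l2 (X i) = ‖x i‖ := fun i => hZ (Sum.inl i)
  have hY : ∀ i, y i = ∑ l, Y i l • e l ∧ l2 (Y i) = ‖y i‖ := fun i => hZ (Sum.inr i)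
  obtain ⟨S, hS, hSb, hSv⟩ := exists_vn_matrix (κ := κ × Fin n) (c := 1)
    (fun q r => (vnFunctional (T q.1 r.1) (hT _ _)).comp
      (ContinuousLinearMap.mul ℂ (FourierAlg G) (FourierAlg.ofCoeff (e r.2) (e q.2))))
    fun x y hx hy => norm_sum_vnPairing_mul_le hT zero_le_one hb he hx hy
  have key := hv.apply zero_le_one hS hSb (fun s => X (s.1, s.2.1) s.2.2)
    (fun r => star (Y (r.1, r.2.1) r.2.2))
  have hl : ∀ {x : p × κ → L2 G} {X : p × κ → Fin n → ℂ}, (∀ i, l2 (X i) = ‖x i‖) →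
      l2 (fun s : p × κ × Fin n => X (s.1, s.2.1) s.2.2) = l2 x := by
    intro x X h
    rw [l2, l2]
    congr 1
    simp only [Fintype.sum_prod_type, ← h, l2_sq]
  rw [l2_star, hl fun i => (hX i).2, hl fun i => (hY i).2, mul_one] at key
  refine le_trans (le_of_eq (congrArg _ ?_)) key
  simp only [Fintype.sum_prod_type, ContinuousLinearMap.comp_apply, vnFunctional_apply,
    ContinuousLinearMap.mul_apply']
  refine Finset.sum_congr rfl fun i _ => Finset.sum_congr rfl fun a _ => ?_
  rw [Finset.sum_comm (s := (Finset.univ : Finset (Fin n)))]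
  refine Finset.sum_congr rfl fun j _ => ?_
  rw [Finset.sum_comm (s := (Finset.univ : Finset (Fin n)))]
  refine Finset.sum_congr rfl fun b _ => ?_
  rw [(hX (j, b)).1, (hY (i, a)).1, ofCoeff_sum_sum, ← vnFunctional_apply (hT a b)]
  simp only [Finset.mul_sum, map_sum, mul_smul_comm, map_smul, hSv, vnFunctional_apply,
    ContinuousLinearMap.comp_apply, ContinuousLinearMap.mul_apply', smul_eq_mul]
  refine Finset.sum_congr rfl fun k _ => Finset.sum_congr rfl fun l _ => ?_
  rw [mul_comm (v i j)]
  ring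

/-- Multiplication is jointly completely contractive on the Fourier algebra. -/
theorem VNBound.mul {p q : Type*} [Fintype p] [Fintype q] {v : p → p → FourierAlg G}
    {w : q → q → FourierAlg G} {c d : ℝ} (hc : 0 ≤ c) (hv : VNBound v c) (hw : VNBound w d) :
    VNBound (fun r s : p × q => v r.1 s.1 * w r.2 s.2) (c * d) := by
  intro κ _ T hT hb
  obtain ⟨S, hS, hSb, hSv⟩ := hv.exists_module_action hT hb
  have h := hw.apply hc hS hSb
  simp only [hSv] at h
  rw [mul_comm]
  let e : (p × q) × κ ≃ q × p × κ :=
    ((Equiv.prodComm p q).prodCongr (Equiv.refl κ)).trans (Equiv.prodAssoc q p κ)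
  exact h.comp_equiv e e

/-- A bounded functional on `A(G)` is controlled by its values on coefficients. -/
theorem norm_functional_le {L : FourierAlg G →L[ℂ] ℂ} {c : ℝ} (hc : 0 ≤ c)
    (h : ∀ ξ η, IsCc ξ → IsCc η → ‖L (FourierAlg.ofCoeff ξ η)‖ ≤ c * (‖ξ‖ * ‖η‖))
    (u : FourierAlg G) : ‖L u‖ ≤ c * ‖u‖ := by
  have key : ∀ ε : ℝ≥0, 0 < ε → ‖L u‖ₑ ≤ ENNReal.ofReal c * (‖u‖ₑ + ε) := by
    intro ε hε
    obtain ⟨ξ, η, hξ, hη, hu, hle⟩ := u.exists_isCc_rep hε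
    have hs := L.hasSum (FourierAlg.hasSum_ofCoeff (ne_top_of_le_ne_top (by simp) hle) hu)
    rw [← hs.tsum_eq]
    refine (enorm_tsum_le _).trans (le_trans ?_ (mul_le_mul' le_rfl hle))
    rw [← ENNReal.tsum_mul_left]
    refine ENNReal.tsum_le_tsum fun i => ?_
    simp only [← ofReal_norm, ← ENNReal.ofReal_mul (norm_nonneg _), ← ENNReal.ofReal_mul hc]
    exact ENNReal.ofReal_le_ofReal (h _ _ (hξ i) (hη i))
  have h2 : ∀ ε : ℝ≥0, 0 < ε → ‖L u‖ ≤ c * (‖u‖ + ε) := by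
    intro ε hε
    have := ENNReal.toReal_mono (by simp [ENNReal.mul_eq_top]) (key ε hε)
    rwa [ENNReal.toReal_mul, ENNReal.toReal_ofReal hc, ENNReal.toReal_add (by simp) (by simp),
      toReal_enorm, toReal_enorm] at this
  have h3 : Tendsto (fun ε : ℝ≥0 => c * (‖u‖ + ε)) (𝓝[>] 0) (𝓝 (c * ‖u‖)) := by
    have : Continuous fun ε : ℝ≥0 => c * (‖u‖ + ε) := by fun_prop
    simpa using (this.tendsto 0).mono_left nhdsWithin_le_nhds
  refine ge_of_tendsto h3 ?_
  filter_upwards [self_mem_nhdsWithin] with ε hε using h2 ε hε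

/-- Every matrix over `A(G)` has a finite matrix norm. For contractive `T`, the functional
`∑ y_k x_l ⟨T_kl, ·⟩` on `A(G)` has norm at most `‖x‖ ‖y‖`; on the coefficient of `ξ`, `η` this is
the bound for `T` at the vectors `(x_l ξ)` and `(ȳ_k η)`. -/
theorem vnBound_of_norm {p : Type*} [Fintype p] (u : p → p → FourierAlg G) :
    VNBound u (∑ i, ∑ j, ‖u i j‖) := by
  intro κ _ T hT hb x y
  -- the estimate for one entry of `u`
  have h1 : ∀ i j, ‖∑ k, ∑ l, y (i, k) * vnPairing (T k l) (u i j) * x (j, l)‖ ≤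
      l2 x * l2 y * ‖u i j‖ := by
    intro i j
    let L : FourierAlg G →L[ℂ] ℂ :=
      ∑ k, ∑ l, (y (i, k) * x (j, l)) • vnFunctional (T k l) (hT k l)
    have hL : ∀ u, L u = ∑ k, ∑ l, y (i, k) * vnPairing (T k l) u * x (j, l) := by
      intro u
      simp only [L, _root_.sum_apply, _root_.smul_apply, vnFunctional_apply, smul_eq_mul]
      exact Finset.sum_congr rfl fun k _ => Finset.sum_congr rfl fun l _ => by ring
    rw [← hL]
    refine norm_functional_le (mul_nonneg (l2_nonneg _) (l2_nonneg _)) (fun ξ η _ _ => ?_) _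
    rw [hL]
    simp only [vnPairing_ofCoeff (hT _ _)]
    have h2 := hb.form_le (fun l => x (j, l) • ξ) (fun k => star (y (i, k)) • η)
    rw [l2_const_smul, l2_const_smul, l2_star, one_mul] at h2
    have h3 : l2 (fun l => x (j, l)) ≤ l2 x := by
      rw [l2_prod x]
      simpa [abs_of_nonneg (l2_nonneg _)] using norm_le_l2 (fun j => l2 fun l => x (j, l)) j
    have h4 : l2 (fun l => y (i, l)) ≤ l2 y := by
      rw [l2_prod y]
      simpa [abs_of_nonneg (l2_nonneg _)] using norm_le_l2 (fun j => l2 fun l => y (j, l)) i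
    refine (le_of_eq (congrArg _ ?_)).trans (h2.trans ?_)
    · refine Finset.sum_congr rfl fun k _ => Finset.sum_congr rfl fun l _ => ?_
      simp only [coeff, map_smul, inner_smul_left, inner_smul_right, starRingEnd_apply, star_star]
      ring
    · calc _ = (l2 fun l => x (j, l)) * (l2 fun l => y (i, l)) * (‖ξ‖ * ‖η‖) := by ring
        _ ≤ _ := by gcongr <;> exact l2_nonneg _
  have h2 : ∑ r : p × κ, ∑ s : p × κ, y r * vnPairing (T r.2 s.2) (u r.1 s.1) * x s =
      ∑ i, ∑ j, ∑ k, ∑ l, y (i, k) * vnPairing (T k l) (u i j) * x (j, l) := by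
    simp only [Fintype.sum_prod_type]
    exact Finset.sum_congr rfl fun i _ => Finset.sum_comm
  rw [h2, Finset.sum_mul, Finset.sum_mul]
  refine (norm_sum_le _ _).trans (Finset.sum_le_sum fun i _ => ?_)
  rw [Finset.sum_mul, Finset.sum_mul]
  refine (norm_sum_le _ _).trans (Finset.sum_le_sum fun j _ => (h1 i j).trans (le_of_eq ?_))
  ring

end JointMultiplication

/-! ### The matrix norms of `S¹A(G)` -/

section MatrixNorms

variable {G : Type*} [Group G] [TopologicalSpace G] [IsTopologicalGroup G]
  [LocallyCompactSpace G] [MeasurableSpace G] [BorelSpace G]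

theorem FourierAlg.continuous (u : FourierAlg G) : Continuous u := by
  obtain ⟨ξ, η, h, hu⟩ := u.exists_rep
  have hs : Summable fun n => ‖ξ n‖ * ‖η n‖ := by
    have : ∑' n, ((‖ξ n‖₊ * ‖η n‖₊ : ℝ≥0) : ℝ≥0∞) ≠ ∞ := by simpa [enorm] using h
    simpa using NNReal.summable_coe.2 (ENNReal.tsum_coe_ne_top_iff_summable.1 this)
  have : (u : G → ℂ) = fun s => ∑' n, coeff (ξ n) (η n) (leftReg s) := funext hu
  rw [this]
  refine continuous_tsum (fun n => continuous_const.inner (continuous_leftReg _)) hs fun n s => ?_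
  refine (norm_inner_le_norm (𝕜 := ℂ) _ _).trans ?_
  rw [norm_leftReg, mul_comm]

theorem FourierAlg.norm_apply_le (u : FourierAlg G) (s : G) : ‖u s‖ ≤ ‖u‖ := by
  have := ENNReal.toReal_mono u.fourierENorm_ne_top (enorm_apply_le (u : G → ℂ) s)
  rwa [toReal_enorm] at this

namespace S1A

@[ext] theorem ext {u v : S1A G} (h : ∀ s, u s = v s) : u = v := DFunLike.ext _ _ h

@[simp] theorem add_apply (u v : S1A G) (s : G) : (u + v) s = u s + v s := rfl
@[simp] theorem sub_apply (u v : S1A G) (s : G) : (u - v) s = u s - v s := rfl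
@[simp] theorem mul_apply (u v : S1A G) (s : G) : (u * v) s = u s * v s := rfl
@[simp] theorem smul_apply (c : ℂ) (u : S1A G) (s : G) : (c • u) s = c * u s := rfl
@[simp] theorem zero_apply (s : G) : (0 : S1A G) s = 0 := rfl

theorem sum_apply {ι : Type*} (S : Finset ι) (v : ι → S1A G) (s : G) :
    (∑ i ∈ S, v i) s = ∑ i ∈ S, v i s :=
  map_sum (⟨⟨fun u => u s, zero_apply s⟩, fun u v => add_apply u v s⟩ : S1A G →+ ℂ) v S

/-- The inclusion of `S¹A(G)` into `A(G)`. -/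
def toFourier : S1A G →ₗ[ℂ] FourierAlg G where
  toFun u := ⟨u, u.2.1⟩
  map_add' _ _ := rfl
  map_smul' _ _ := rfl

@[simp] theorem toFourier_apply (u : S1A G) (s : G) : toFourier u s = u s := rfl

theorem coe_toFourier (u : S1A G) : (toFourier u : G → ℂ) = u := rfl

theorem toFourier_mul (u v : S1A G) : toFourier (u * v) = toFourier u * toFourier v := rfl

theorem norm_eq (u : S1A G) : ‖u‖ = ‖toFourier u‖ + ∫ x, ‖u x‖ ∂Measure.haar := rfl

theorem continuous (u : S1A G) : Continuous u := (toFourier u).continuous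

end S1A

/-- The matrix `u` over `S¹A(G)` has norm at most `c` in the operator space structure of the predual
of `L^∞(G)`. -/
def LBound {p : Type*} [Fintype p] (u : p → p → S1A G) (c : ℝ) : Prop :=
  ∀ (κ : Type) [Fintype κ] (φ : G → κ → κ → ℂ), (∀ k l, Measurable fun x => φ x k l) →
    (∀ x, MatBound (φ x) 1) →
    MatBound (fun r s : p × κ => ∫ x, φ x r.2 s.2 * u r.1 s.1 x ∂(Measure.haar : Measure G)) c

theorem MatBound.norm_le {ι κ : Type*} [Fintype ι] [Fintype κ] {M : ι → κ → ℂ} {c : ℝ}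
    (h : MatBound M c) (r : ι) (s : κ) : ‖M r s‖ ≤ c := by
  classical
  have h2 := h (Pi.single s 1) (Pi.single r 1)
  rw [Finset.sum_eq_single r (fun b _ hb => by simp [hb]) (by simp),
    Finset.sum_eq_single s (fun b _ hb => by simp [hb]) (by simp)] at h2
  simpa [l2_single] using h2

/-- The defining estimate for matrix valued functions of norm at most `d`, with a finite index type in
any universe. -/
theorem LBound.apply {p κ : Type*} [Fintype p] [Fintype κ] {u : p → p → S1A G} {c d : ℝ}
    (h : LBound u c) (hd : 0 ≤ d) {φ : G → κ → κ → ℂ} (hφ : ∀ k l, Measurable fun x => φ x k l)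
    (hb : ∀ x, MatBound (φ x) d) :
    MatBound (fun r s : p × κ => ∫ x, φ x r.2 s.2 * u r.1 s.1 x ∂(Measure.haar : Measure G))
      (c * d) := by
  rcases hd.eq_or_lt' with rfl | hd
  · intro x y
    have h0 : ∀ t k l, φ t k l = 0 := fun t k l => norm_le_zero_iff.1 ((hb t).norm_le k l)
    simp [h0]
  · let e := Fintype.equivFin κ
    have h1 := h (Fin (Fintype.card κ))
      (fun x k l => ((d⁻¹ : ℝ) : ℂ) * φ x (e.symm k) (e.symm l))
      (fun k l => (hφ _ _).const_mul _) fun x => by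
        have := ((hb x).comp_equiv e.symm e.symm).smul ((d⁻¹ : ℝ) : ℂ)
        rwa [Complex.norm_real, Real.norm_of_nonneg (by positivity), inv_mul_cancel₀ hd.ne'] at this
    have h2 := (h1.comp_equiv ((Equiv.refl p).prodCongr e) ((Equiv.refl p).prodCongr e)).smul
      (d : ℂ)
    rw [Complex.norm_real, Real.norm_of_nonneg hd.le, mul_comm] at h2
    convert! h2 using 3 with r s
    simp only [Equiv.prodCongr_apply, Prod.map_snd, Prod.map_fst, Equiv.refl_apply,
      Equiv.symm_apply_apply]
    rw [← integral_const_mul]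
    refine integral_congr_ae (Eventually.of_forall fun x => ?_)
    simp only
    rw [← mul_assoc, ← mul_assoc, ← Complex.ofReal_mul,
      mul_inv_cancel₀ hd.ne', Complex.ofReal_one, one_mul]

/-- The norm of a Kronecker product of scalar matrices: apply `N` along one index, then `M`. -/
theorem MatBound.kronecker {p κ : Type*} [Fintype p] [Fintype κ] {M : p → p → ℂ} {N : κ → κ → ℂ}
    {c d : ℝ} (hc : 0 ≤ c) (hd : 0 ≤ d) (hM : MatBound M c) (hN : MatBound N d) :
    MatBound (fun r s : p × κ => M r.1 s.1 * N r.2 s.2) (c * d) := by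
  intro x y
  let z : κ × p → ℂ := fun q => ∑ b, N q.1 b * x (q.2, b)
  have hz : l2 z ≤ d * l2 x := by
    rw [← l2_comp_equiv (Equiv.prodComm p κ), l2_prod, l2_prod x]
    refine l2_le_mul hd fun j => ?_
    rw [Real.norm_of_nonneg (l2_nonneg _), Real.norm_of_nonneg (l2_nonneg _)]
    exact hN.l2_le hd fun b => x (j, b)
  have e : ∑ r : p × κ, ∑ s : p × κ, y r * (M r.1 s.1 * N r.2 s.2) * x s =
      ∑ a, ∑ i, ∑ j, y (i, a) * M i j * z (a, j) := by
    simp only [Fintype.sum_prod_type, z, Finset.mul_sum]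
    rw [Finset.sum_comm]
    refine Finset.sum_congr rfl fun a _ => Finset.sum_congr rfl fun i _ =>
      Finset.sum_congr rfl fun j _ => Finset.sum_congr rfl fun b _ => by ring
  rw [e]
  have h1 : ∀ a, ‖∑ i, ∑ j, y (i, a) * M i j * z (a, j)‖ ≤
      c * (l2 (fun j => z (a, j)) * l2 (fun i => y (i, a))) := fun a => by
    rw [← mul_assoc]; exact hM _ _
  refine (norm_sum_le _ _).trans ((Finset.sum_le_sum fun a _ => h1 a).trans ?_)
  rw [← Finset.mul_sum]
  have h2 := norm_sum_le_of_l2_fibres z fun q : κ × p => y (q.2, q.1)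
  have h3 : l2 (fun q : κ × p => y (q.2, q.1)) = l2 y := l2_comp_equiv (Equiv.prodComm κ p) y
  rw [h3] at h2
  calc _ ≤ c * (l2 z * l2 y) := mul_le_mul_of_nonneg_left h2 hc
    _ ≤ c * ((d * l2 x) * l2 y) := mul_le_mul_of_nonneg_left
        (mul_le_mul_of_nonneg_right hz (l2_nonneg _)) hc
    _ = _ := by ring

/-- The pointwise matrix norms are dominated by the matrix norm of `A(G)`. -/
theorem VNBound.matBound_apply {p : Type*} [Fintype p] {u : p → p → FourierAlg G} {c : ℝ}
    (h : VNBound u c) (x : G) : MatBound (fun i j => u i j x) c := by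
  have h1 := h Unit (fun _ _ => leftReg x) (fun _ _ => leftReg_mem_groupVN x)
    (opBound_of_norm_le ((leftReg x).opNorm_le_bound zero_le_one fun z => by
      rw [norm_leftReg, one_mul]))
  simp only [vnPairing_leftReg] at h1
  exact h1.comp_equiv (Equiv.prodPUnit p).symm (Equiv.prodPUnit p).symm

/-- Multiplication `A(G) × S¹A(G) → S¹A(G)` for the matrix norms of `L¹(G)`. -/
theorem LBound.mul {p q : Type*} [Fintype p] [Fintype q] {v : p → p → S1A G}
    {w : q → q → S1A G} {c d : ℝ} (hc : 0 ≤ c) (hv : VNBound (fun i j => S1A.toFourier (v i j)) c)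
    (hw : LBound w d) : LBound (fun r s : p × q => v r.1 s.1 * w r.2 s.2) (c * d) := by
  intro κ _ φ hφ hb
  have h := hw.apply hc (κ := p × κ) (φ := fun x r s => v r.1 s.1 x * φ x r.2 s.2)
    (fun k l => (v _ _).continuous.measurable.mul (hφ _ _)) fun x => by
      simpa using MatBound.kronecker hc zero_le_one (hv.matBound_apply x) (hb x)
  rw [mul_comm]
  let e : (p × q) × κ ≃ q × p × κ :=
    ((Equiv.prodComm p q).prodCongr (Equiv.refl κ)).trans (Equiv.prodAssoc q p κ)
  convert! h.comp_equiv e e using 3 with r s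
  refine integral_congr_ae (Eventually.of_forall fun x => ?_)
  change φ x r.2 s.2 * (v r.1.1 s.1.1 x * w r.1.2 s.1.2 x) =
    v r.1.1 s.1.1 x * φ x r.2 s.2 * w r.1.2 s.1.2 x
  ring

theorem integrable_mul_of_bound {u : S1A G} {φ : G → ℂ} (hφ : Measurable φ) {c : ℝ}
    (hc : ∀ x, ‖φ x‖ ≤ c) : Integrable (fun x => φ x * u x) (Measure.haar : Measure G) :=
  u.integrable.bdd_mul hφ.aestronglyMeasurable (Eventually.of_forall hc)

/-- Every matrix over `L¹(G)` has a finite matrix norm. -/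
theorem lBound_of_norm {p : Type*} [Fintype p] (u : p → p → S1A G) :
    LBound u (∑ i, ∑ j, ∫ x, ‖u i j x‖ ∂(Measure.haar : Measure G)) := by
  intro κ _ φ hφ hb x y
  have h1 : ∀ i j, ‖∑ k, ∑ l, y (i, k) *
      (∫ t, φ t k l * u i j t ∂(Measure.haar : Measure G)) * x (j, l)‖ ≤
      l2 x * l2 y * ∫ t, ‖u i j t‖ ∂(Measure.haar : Measure G) := by
    intro i j
    have e : ∑ k, ∑ l, y (i, k) *
        (∫ t, φ t k l * u i j t ∂(Measure.haar : Measure G)) * x (j, l) =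
        ∫ t, (∑ k, ∑ l, y (i, k) * φ t k l * x (j, l)) * u i j t ∂(Measure.haar : Measure G) := by
      simp only [Finset.sum_mul]
      have hint : ∀ k l, Integrable (fun t => y (i, k) * φ t k l * x (j, l) * u i j t)
          (Measure.haar : Measure G) := fun k l => by
        refine ((integrable_mul_of_bound (u := u i j) (hφ k l) fun t =>
          (hb t).norm_le k l).const_mul (y (i, k) * x (j, l))).congr
          (Eventually.of_forall fun t => ?_)
        simp only; ring
      rw [integral_finsetSum _ fun k _ => integrable_finsetSum _ fun l _ => hint k l]
      refine Finset.sum_congr rfl fun k _ => ?_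
      rw [integral_finsetSum _ fun l _ => hint k l]
      refine Finset.sum_congr rfl fun l _ => ?_
      rw [mul_right_comm, ← integral_const_mul]
      refine integral_congr_ae (Eventually.of_forall fun t => ?_)
      simp only; ring
    have h3 : l2 (fun l => x (j, l)) ≤ l2 x := by
      rw [l2_prod x]
      simpa [abs_of_nonneg (l2_nonneg _)] using norm_le_l2 (fun j => l2 fun l => x (j, l)) j
    have h4 : l2 (fun l => y (i, l)) ≤ l2 y := by
      rw [l2_prod y]
      simpa [abs_of_nonneg (l2_nonneg _)] using norm_le_l2 (fun j => l2 fun l => y (j, l)) i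
    rw [e, ← integral_const_mul]
    refine norm_integral_le_of_norm_le ((u i j).integrable.norm.const_mul _)
      (Eventually.of_forall fun t => ?_)
    rw [norm_mul]
    refine mul_le_mul_of_nonneg_right ((hb t _ _).trans ?_) (norm_nonneg _)
    rw [one_mul]
    exact mul_le_mul h3 h4 (l2_nonneg _) (l2_nonneg _)
  have h2 : ∑ r : p × κ, ∑ s : p × κ, y r *
      (∫ t, φ t r.2 s.2 * u r.1 s.1 t ∂(Measure.haar : Measure G)) * x s =
      ∑ i, ∑ j, ∑ k, ∑ l, y (i, k) *
        (∫ t, φ t k l * u i j t ∂(Measure.haar : Measure G)) * x (j, l) := by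
    simp only [Fintype.sum_prod_type]
    exact Finset.sum_congr rfl fun i _ => Finset.sum_comm
  rw [h2, Finset.sum_mul, Finset.sum_mul]
  refine (norm_sum_le _ _).trans (Finset.sum_le_sum fun i _ => ?_)
  rw [Finset.sum_mul, Finset.sum_mul]
  refine (norm_sum_le _ _).trans (Finset.sum_le_sum fun j _ => (h1 i j).trans (le_of_eq ?_))
  ring

end MatrixNorms

section MatrixNormBounds

variable {G : Type*} [Group G] [TopologicalSpace G] [IsTopologicalGroup G]
  [LocallyCompactSpace G] [MeasurableSpace G] [BorelSpace G]

theorem vnPairing_zero_left (u : FourierAlg G) :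
    (0 : L2 G →L[ℂ] L2 G) ∈ groupVN G ∧ vnPairing (0 : L2 G →L[ℂ] L2 G) u = 0 := by
  have h := vnPairing_smul_left (leftReg_mem_groupVN (1 : G)) 0 u
  rwa [zero_smul, zero_mul] at h

namespace S1A

theorem matrixNorm_le {n : ℕ} {u : Matrix (Fin n) (Fin n) (S1A G)} {c d : ℝ} (hc : 0 ≤ c)
    (hd : 0 ≤ d) (h : VNBound (fun i j => toFourier (u i j)) c)
    (h' : LBound (fun i j => u i j) d) : S1A.matrixNorm G n u ≤ ENNReal.ofReal (c + d) := by
  refine iSup_le fun m => iSup_le fun T => iSup_le fun hT => iSup_le fun hb => iSup_le fun φ =>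
    iSup_le fun hφ => iSup_le fun hφb => MatBound.matENorm_le (add_nonneg hc hd) ?_
  exact (h (Fin m) (fun k l => T k l) hT ((isContractionMatrix_iff T).1 hb)).add
    (h' (Fin m) (fun x k l => φ x k l) hφ fun x => MatBound.of_matENorm_le zero_le_one
      (by simpa using hφb x))

theorem matrixNorm_ne_top {n : ℕ} (u : Matrix (Fin n) (Fin n) (S1A G)) :
    S1A.matrixNorm G n u ≠ ∞ :=
  ne_top_of_le_ne_top ENNReal.ofReal_ne_top (matrixNorm_le
    (Finset.sum_nonneg fun _ _ => Finset.sum_nonneg fun _ _ => norm_nonneg _)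
    (Finset.sum_nonneg fun _ _ => Finset.sum_nonneg fun _ _ => integral_nonneg fun _ =>
      norm_nonneg _) (vnBound_of_norm _) (lBound_of_norm _))

/-- The matrix norm of `S¹A(G)` dominates that of `A(G)`: test with `φ = 0`. -/
theorem vnBound_matrixNorm {n : ℕ} (u : Matrix (Fin n) (Fin n) (S1A G)) :
    VNBound (fun i j => toFourier (u i j)) (S1A.matrixNorm G n u).toReal := by
  intro κ _ T hT hb
  let e := Fintype.equivFin κ
  have h : matENorm (Matrix.of fun r s : Fin n × Fin (Fintype.card κ) =>
      vnPairing (T (e.symm r.2) (e.symm s.2)) (u r.1 s.1)) ≤ S1A.matrixNorm G n u := by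
    refine le_trans (le_of_eq ?_) (le_iSup_of_le (Fintype.card κ)
      (le_iSup_of_le (Matrix.of fun k l => T (e.symm k) (e.symm l))
      (le_iSup_of_le (fun k l => hT _ _) (le_iSup_of_le ((isContractionMatrix_iff _).2
      (hb.comp_equiv e.symm)) (le_iSup_of_le (fun _ => 0) (le_iSup_of_le (fun _ _ =>
      measurable_const) (le_iSup_of_le (fun _ => matENorm_zero.trans_le zero_le_one) le_rfl)))))))
    congr 1
    ext r s
    simp
  rw [← ENNReal.ofReal_toReal (matrixNorm_ne_top u)] at h
  have h2 := (MatBound.of_matENorm_le ENNReal.toReal_nonneg h).comp_equiv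
    ((Equiv.refl (Fin n)).prodCongr e) ((Equiv.refl (Fin n)).prodCongr e)
  convert! h2 using 3 with r s
  simp [coe_toFourier]

/-- The matrix norm of `S¹A(G)` dominates that of `L¹(G)`: test with `T = 0`. -/
theorem lBound_matrixNorm {n : ℕ} (u : Matrix (Fin n) (Fin n) (S1A G)) :
    LBound (fun i j => u i j) (S1A.matrixNorm G n u).toReal := by
  intro κ _ φ hφ hb
  let e := Fintype.equivFin κ
  have h : matENorm (Matrix.of fun r s : Fin n × Fin (Fintype.card κ) =>
      ∫ x, φ x (e.symm r.2) (e.symm s.2) * u r.1 s.1 x ∂(Measure.haar : Measure G)) ≤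
      S1A.matrixNorm G n u := by
    refine le_trans (le_of_eq ?_) (le_iSup_of_le (Fintype.card κ)
      (le_iSup_of_le 0
      (le_iSup_of_le (fun k l => (vnPairing_zero_left 0).1) (le_iSup_of_le (fun x => by
        simp only [Matrix.zero_apply, _root_.zero_apply, Finset.sum_const_zero, norm_zero,
          ne_eq, OfNat.ofNat_ne_zero, not_false_eq_true, zero_pow]
        exact Finset.sum_nonneg fun _ _ => sq_nonneg _)
      (le_iSup_of_le (fun x => Matrix.of fun k l => φ x (e.symm k) (e.symm l))
      (le_iSup_of_le (fun _ _ => hφ _ _) (le_iSup_of_le (fun x => by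
        have := MatBound.matENorm_le (M := Matrix.of fun k l => φ x (e.symm k) (e.symm l))
          zero_le_one ((hb x).comp_equiv e.symm e.symm)
        simpa using this) le_rfl)))))))
    congr 1
    ext r s
    have : vnPairing (0 : L2 G →L[ℂ] L2 G) (u r.1 s.1) = 0 :=
      (vnPairing_zero_left (toFourier (u r.1 s.1))).2
    simp [this]
  rw [← ENNReal.ofReal_toReal (matrixNorm_ne_top u)] at h
  have h2 := (MatBound.of_matENorm_le ENNReal.toReal_nonneg h).comp_equiv
    ((Equiv.refl (Fin n)).prodCongr e) ((Equiv.refl (Fin n)).prodCongr e)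
  convert! h2 using 3 with r s
  simp

theorem matrixNorm_smul_le {n : ℕ} (c : ℂ) (u : Matrix (Fin n) (Fin n) (S1A G)) :
    S1A.matrixNorm G n (c • u) ≤ ‖c‖ₑ * S1A.matrixNorm G n u := by
  refine iSup_le fun m => iSup_le fun T => iSup_le fun hT => iSup_le fun hb => iSup_le fun φ =>
    iSup_le fun hφ => iSup_le fun hφb => ?_
  refine le_trans (le_of_eq ?_) (mul_le_mul' le_rfl (le_iSup_of_le m (le_iSup_of_le T
    (le_iSup_of_le hT (le_iSup_of_le hb (le_iSup_of_le φ (le_iSup_of_le hφ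
    (le_iSup_of_le hφb le_rfl))))))))
  rw [← matENorm_smul]
  congr 1
  ext r s
  have h1 : vnPairing (T r.2 s.2) (c • u r.1 s.1 : S1A G) = c * vnPairing (T r.2 s.2) (u r.1 s.1) :=
    vnPairing_smul (hT _ _) c (toFourier (u r.1 s.1))
  simp only [Matrix.of_apply, Matrix.smul_apply, h1, smul_eq_mul, mul_add, ← integral_const_mul,
    smul_apply]
  congr 1
  refine integral_congr_ae (Eventually.of_forall fun x => ?_)
  simp only
  ring

end S1A

/-- `Φ` is completely bounded, with bound `K`, for the given matrix norms. -/
def CBBound {V W : Type*} [AddCommGroup V] [Module ℂ V] [AddCommGroup W] [Module ℂ W]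
    (N : MatrixNorm V) (N' : MatrixNorm W) (Φ : V →ₗ[ℂ] W) (K : ℝ≥0) : Prop :=
  ∀ (n : ℕ) (v : Matrix (Fin n) (Fin n) V), N' n (v.map Φ) ≤ K * N n v

/-- Complete boundedness on `S¹A` follows from complete boundedness for the matrix norms of the
Fourier algebra and of `L¹`. -/
theorem S1A.cbBound {G' : Type*} [Group G'] [TopologicalSpace G'] [IsTopologicalGroup G']
    [LocallyCompactSpace G'] [MeasurableSpace G'] [BorelSpace G'] {Φ : S1A G →ₗ[ℂ] S1A G'}
    {a b : ℝ} (ha : 0 ≤ a) (hb : 0 ≤ b)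
    (h : ∀ (n : ℕ) (u : Fin n → Fin n → S1A G) (c : ℝ), 0 ≤ c →
      VNBound (fun i j => toFourier (u i j)) c → VNBound (fun i j => toFourier (Φ (u i j))) (a * c))
    (h' : ∀ (n : ℕ) (u : Fin n → Fin n → S1A G) (c : ℝ), 0 ≤ c →
      LBound u c → LBound (fun i j => Φ (u i j)) (b * c)) :
    CBBound (S1A.matrixNorm G) (S1A.matrixNorm G') Φ (a + b).toNNReal := by
  intro n u
  have h1 := matrixNorm_le (u := u.map Φ) (mul_nonneg ha ENNReal.toReal_nonneg)
    (mul_nonneg hb ENNReal.toReal_nonneg) (h n u _ ENNReal.toReal_nonneg (vnBound_matrixNorm u))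
    (h' n u _ ENNReal.toReal_nonneg (lBound_matrixNorm u))
  rwa [← add_mul, ENNReal.ofReal_mul (add_nonneg ha hb), ENNReal.ofReal_toReal
    (matrixNorm_ne_top u)] at h1

/-- Multiplication by a fixed element of `S¹A(G)` is completely bounded. -/
theorem S1A.cbBound_mulLeft (w : S1A G) :
    CBBound (S1A.matrixNorm G) (S1A.matrixNorm G) (LinearMap.mulLeft ℂ w)
      (‖toFourier w‖ + ‖toFourier w‖).toNNReal := by
  have hw : VNBound (fun _ _ : Unit => toFourier w) ‖toFourier w‖ := by
    simpa using vnBound_of_norm fun _ _ : Unit => toFourier w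
  refine S1A.cbBound (norm_nonneg _) (norm_nonneg _) (fun n u c hc h => ?_) fun n u c hc h => ?_
  · intro κ _ T hT hb
    have h1 := (VNBound.mul (norm_nonneg _) hw h) κ T hT hb
    let e : Fin n × κ ≃ (Unit × Fin n) × κ :=
      ((Equiv.punitProd (Fin n)).symm).prodCongr (Equiv.refl κ)
    exact h1.comp_equiv e e
  · intro κ _ φ hφ hb
    have h1 := (LBound.mul (v := fun _ _ : Unit => w) (norm_nonneg _) hw h) κ φ hφ hb
    let e : Fin n × κ ≃ (Unit × Fin n) × κ :=
      ((Equiv.punitProd (Fin n)).symm).prodCongr (Equiv.refl κ)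
    exact h1.comp_equiv e e

/-- The `A(G)`-norm of a linear combination with decomposing coefficients. -/
theorem VNBound.norm_sum_le {p : Type*} [Fintype p] {z : p → p → FourierAlg G} {c : ℝ}
    (h : VNBound z c) (α β : p → ℂ) :
    ‖∑ r, ∑ s, (α r * β s) • z r s‖ ≤ c * l2 β * l2 α := by
  refine norm_le_of_vnPairing fun T hT hb => ?_
  have h1 := (h Unit (fun _ _ => T) (fun _ _ => hT) (opBound_of_norm_le hb)).comp_equiv
    (Equiv.prodPUnit p).symm (Equiv.prodPUnit p).symm
  refine le_trans (le_of_eq (congrArg _ ?_)) (h1 β α)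
  rw [← vnFunctional_apply hT]
  simp only [map_sum, map_smul, vnFunctional_apply, smul_eq_mul, Equiv.prodPUnit_symm_apply]
  exact Finset.sum_congr rfl fun r _ => Finset.sum_congr rfl fun s _ => by ring

/-- The `L¹(G)`-norm of a linear combination with decomposing coefficients. -/
theorem LBound.integral_norm_sum_le {p : Type*} [Fintype p] {z : p → p → S1A G} {c : ℝ}
    (h : LBound z c) (α β : p → ℂ) :
    ∫ x, ‖(∑ r, ∑ s, (α r * β s) • z r s : S1A G) x‖ ∂(Measure.haar : Measure G) ≤
      c * l2 β * l2 α := by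
  set u : S1A G := ∑ r, ∑ s, (α r * β s) • z r s
  -- test against the conjugate of the sign of the sum; the sign of `0` is `0 / 0 = 0`
  let φ : G → ℂ := fun x => star (u x) / ‖u x‖
  have hφ : Measurable φ :=
    u.continuous.star.measurable.div (Complex.continuous_ofReal.comp
      u.continuous.norm).measurable
  have hφ1 : ∀ x, ‖φ x‖ ≤ 1 := fun x => by
    simp only [φ, norm_div, norm_star, Complex.norm_real, norm_norm]
    exact div_self_le_one _
  have hφu : ∀ x, φ x * u x = (‖u x‖ : ℂ) := fun x => by
    by_cases h0 : u x = 0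
    · simp [h0]
    have : (‖u x‖ : ℂ) ≠ 0 := by simpa using h0
    have h2 : star (u x) * u x = (‖u x‖ : ℂ) ^ 2 := Complex.conj_mul' _
    simp only [φ]
    rw [div_mul_eq_mul_div, h2, sq, mul_div_cancel_right₀ _ this]
  have h1 := (h Unit (fun x _ _ => φ x) (fun _ _ => hφ) fun x y z => by
    simp only [Finset.univ_unique, Finset.sum_singleton, l2, Real.sqrt_sq (norm_nonneg _), one_mul,
      norm_mul]
    nlinarith [mul_nonneg (norm_nonneg (y default)) (norm_nonneg (z default)), hφ1 x,
      mul_le_mul_of_nonneg_right (hφ1 x)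
        (mul_nonneg (norm_nonneg (y default)) (norm_nonneg (z default)))]).comp_equiv
    (Equiv.prodPUnit p).symm (Equiv.prodPUnit p).symm
  refine le_trans (le_of_eq ?_) (h1 β α)
  have h2 : ∑ r, ∑ s, α r * (∫ x, φ x * z r s x ∂(Measure.haar : Measure G)) * β s =
      ∫ x, φ x * u x ∂(Measure.haar : Measure G) := by
    have hint : ∀ r s, Integrable (fun x => α r * β s * (φ x * z r s x))
        (Measure.haar : Measure G) := fun r s =>
      (integrable_mul_of_bound hφ hφ1).const_mul _
    have : ∀ x, φ x * u x = ∑ r, ∑ s, α r * β s * (φ x * z r s x) := fun x => by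
      simp only [u, S1A.sum_apply, S1A.smul_apply, Finset.mul_sum]
      exact Finset.sum_congr rfl fun r _ => Finset.sum_congr rfl fun s _ => by ring
    simp_rw [this]
    rw [integral_finsetSum _ fun k _ => integrable_finsetSum _ fun l _ => hint k l]
    refine Finset.sum_congr rfl fun k _ => ?_
    rw [integral_finsetSum _ fun l _ => hint k l]
    refine Finset.sum_congr rfl fun l _ => ?_
    rw [integral_const_mul]; ring
  simp only [Equiv.prodPUnit_symm_apply]
  rw [h2]
  simp_rw [hφu]
  rw [integral_complex_ofReal, Complex.norm_real, Real.norm_of_nonneg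
    (integral_nonneg fun _ => norm_nonneg _)]

end MatrixNormBounds

/-! ### Functoriality of the tensor norms and of their duals -/

section TensorNorms

theorem boundedDual_comp {E E' : Type*} [AddCommGroup E] [Module ℂ E] [AddCommGroup E']
    [Module ℂ E'] {p : E → ℝ≥0∞} {p' : E' → ℝ≥0∞} {f : E →ₗ[ℂ] E'} {K : ℝ≥0}
    (h : ∀ t, p' (f t) ≤ K * p t) {ψ : Module.Dual ℂ E'} (hψ : ψ ∈ boundedDual p') :
    ψ ∘ₗ f ∈ boundedDual p := by
  obtain ⟨C, hC⟩ := hψ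
  refine ⟨C * K, fun t => (hC (f t)).trans ?_⟩
  rw [ENNReal.coe_mul, mul_assoc]
  exact mul_le_mul' le_rfl (h t)

theorem enorm_coe_inv_mul {K : ℝ≥0} (hK : 0 < K) : ‖((K⁻¹ : ℝ≥0) : ℂ)‖ₑ * (K : ℝ≥0∞) = 1 := by
  have : ‖((K⁻¹ : ℝ≥0) : ℂ)‖ₑ = ((K⁻¹ : ℝ≥0) : ℝ≥0∞) := by
    rw [← ofReal_norm, ← ENNReal.ofReal_coe_nnreal]
    congr 1
    exact (Complex.norm_real _).trans (Real.norm_of_nonneg (NNReal.coe_nonneg _))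
  rw [this, ← ENNReal.coe_mul, inv_mul_cancel₀ hK.ne', ENNReal.coe_one]

theorem enorm_coe_nnreal (K : ℝ≥0) : ‖((K : ℝ≥0) : ℂ)‖ₑ = K := by
  rw [← ofReal_norm, ← ENNReal.ofReal_coe_nnreal]
  congr 1
  exact (Complex.norm_real _).trans (Real.norm_of_nonneg (NNReal.coe_nonneg _))

/-- Scaling by `K⁻¹` brings the image of the unit ball of `p` into the unit ball of `p'`. -/
theorem dualENorm_comp_le {E E' : Type*} [AddCommGroup E] [Module ℂ E] [AddCommGroup E']
    [Module ℂ E'] {p : E → ℝ≥0∞} {p' : E' → ℝ≥0∞} {f : E →ₗ[ℂ] E'} {K : ℝ≥0} (hK : 0 < K)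
    (hp' : ∀ (c : ℂ) t, p' (c • t) ≤ ‖c‖ₑ * p' t) (h : ∀ t, p' (f t) ≤ K * p t)
    (ψ : Module.Dual ℂ E') : dualENorm p (ψ ∘ₗ f) ≤ K * dualENorm p' ψ := by
  refine iSup_le fun t => iSup_le fun ht => ?_
  have h1 : p' (((K⁻¹ : ℝ≥0) : ℂ) • f t) ≤ 1 := by
    refine (hp' _ _).trans ?_
    rw [← enorm_coe_inv_mul hK]
    exact mul_le_mul' le_rfl ((h t).trans (mul_le_of_le_one_right' ht))
  have h2 : (ψ ∘ₗ f) t = ((K : ℝ≥0) : ℂ) * ψ (((K⁻¹ : ℝ≥0) : ℂ) • f t) := by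
    have : ((K : ℝ≥0) : ℂ) ≠ 0 := by exact_mod_cast hK.ne'
    rw [map_smul, smul_eq_mul, NNReal.coe_inv, Complex.ofReal_inv, mul_inv_cancel_left₀ this]
    rfl
  rw [h2, enorm_mul, enorm_coe_nnreal]
  exact mul_le_mul' le_rfl (le_iSup_of_le _ (le_iSup_of_le h1 le_rfl))

/-- Precomposition with a completely bounded map is completely bounded on dual spaces. -/
theorem dualMatrixNorm_comp_le {V W : Type*} [AddCommGroup V] [Module ℂ V] [AddCommGroup W]
    [Module ℂ W] {N : MatrixNorm V} {N' : MatrixNorm W} {Φ : V →ₗ[ℂ] W} {K : ℝ≥0} (hK : 0 < K)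
    (hN' : ∀ (m : ℕ) (c : ℂ) (v : Matrix (Fin m) (Fin m) W), N' m (c • v) ≤ ‖c‖ₑ * N' m v)
    (h : CBBound N N' Φ K) {n : ℕ} (F : Matrix (Fin n) (Fin n) (Module.Dual ℂ W)) :
    dualMatrixNorm N n (F.map fun ψ => ψ ∘ₗ Φ) ≤ K * dualMatrixNorm N' n F := by
  refine iSup_le fun m => iSup_le fun v => iSup_le fun hv => ?_
  have h1 : N' m (((K⁻¹ : ℝ≥0) : ℂ) • v.map Φ) ≤ 1 := by
    refine (hN' _ _ _).trans ?_
    rw [← enorm_coe_inv_mul hK]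
    exact mul_le_mul' le_rfl ((h m v).trans (mul_le_of_le_one_right' hv))
  have h2 : (Matrix.of fun r s : Fin n × Fin m => (F.map fun ψ => ψ ∘ₗ Φ) r.1 s.1 (v r.2 s.2)) =
      ((K : ℝ≥0) : ℂ) • Matrix.of fun r s : Fin n × Fin m =>
        F r.1 s.1 ((((K⁻¹ : ℝ≥0) : ℂ) • v.map Φ) r.2 s.2) := by
    have : ((K : ℝ≥0) : ℂ) ≠ 0 := by exact_mod_cast hK.ne'
    ext r s
    simp only [Matrix.of_apply, Matrix.map_apply, Matrix.smul_apply, map_smul, smul_eq_mul,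
      NNReal.coe_inv, Complex.ofReal_inv, mul_inv_cancel_left₀ this]
    rfl
  rw [h2, matENorm_smul, enorm_coe_nnreal]
  exact mul_le_mul' le_rfl (le_iSup_of_le m (le_iSup_of_le _ (le_iSup_of_le h1 le_rfl)))

theorem dualMatrixNorm_add_le {V : Type*} [AddCommGroup V] [Module ℂ V] (N : MatrixNorm V) {n : ℕ}
    (F F' : Matrix (Fin n) (Fin n) (Module.Dual ℂ V)) :
    dualMatrixNorm N n (F + F') ≤ dualMatrixNorm N n F + dualMatrixNorm N n F' := by
  refine iSup_le fun m => iSup_le fun v => iSup_le fun hv => ?_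
  refine (matENorm_add_le (Matrix.of fun r s : Fin n × Fin m => F r.1 s.1 (v r.2 s.2))
    (Matrix.of fun r s : Fin n × Fin m => F' r.1 s.1 (v r.2 s.2))).trans (add_le_add ?_ ?_)
  · exact le_iSup_of_le m (le_iSup_of_le v (le_iSup_of_le hv le_rfl))
  · exact le_iSup_of_le m (le_iSup_of_le v (le_iSup_of_le hv le_rfl))

theorem dualMatrixNorm_zero {V : Type*} [AddCommGroup V] [Module ℂ V] (N : MatrixNorm V) (n : ℕ) :
    dualMatrixNorm N n 0 = 0 :=
  le_antisymm (iSup_le fun m => iSup_le fun _ => iSup_le fun _ =>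
    (matENorm_zero (ι := Fin n × Fin m) (κ := Fin n × Fin m)).le) bot_le

section OpProj

variable {V W : Type*} [AddCommGroup V] [Module ℂ V] [AddCommGroup W] [Module ℂ W]

theorem le_mul_opProjNorm {N : MatrixNorm V} {n : ℕ} {t : Matrix (Fin n) (Fin n) (V ⊗[ℂ] V)}
    {y C : ℝ≥0∞} (hC0 : C ≠ 0) (hC : C ≠ ∞)
    (h : ∀ (p q : ℕ) (α : Matrix (Fin n) (Fin p × Fin q) ℂ) (v : Matrix (Fin p) (Fin p) V)
      (w : Matrix (Fin q) (Fin q) V) (β : Matrix (Fin p × Fin q) (Fin n) ℂ),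
      (∀ i j, t i j = ∑ r, ∑ s, (α i r * β s j) • (v r.1 s.1 ⊗ₜ[ℂ] w r.2 s.2)) →
      y ≤ C * (matENorm α * N p v * N q w * matENorm β)) : y ≤ C * opProjNorm N n t := by
  rw [mul_comm, ← ENNReal.div_le_iff_le_mul (Or.inl hC0) (Or.inl hC)]
  refine le_iInf fun p => le_iInf fun q => le_iInf fun α => le_iInf fun v => le_iInf fun w =>
    le_iInf fun β => le_iInf fun ht => ?_
  rw [ENNReal.div_le_iff_le_mul (Or.inl hC0) (Or.inl hC), mul_comm]
  exact h p q α v w β ht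

theorem opProjNorm_le {N : MatrixNorm V} {n : ℕ} {t : Matrix (Fin n) (Fin n) (V ⊗[ℂ] V)}
    {p q : ℕ} {α : Matrix (Fin n) (Fin p × Fin q) ℂ} {v : Matrix (Fin p) (Fin p) V}
    {w : Matrix (Fin q) (Fin q) V} {β : Matrix (Fin p × Fin q) (Fin n) ℂ}
    (ht : ∀ i j, t i j = ∑ r, ∑ s, (α i r * β s j) • (v r.1 s.1 ⊗ₜ[ℂ] w r.2 s.2)) :
    opProjNorm N n t ≤ matENorm α * N p v * N q w * matENorm β :=
  iInf_le_of_le p (iInf_le_of_le q (iInf_le_of_le α (iInf_le_of_le v (iInf_le_of_le w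
    (iInf_le_of_le β (iInf_le _ ht))))))

/-- The constants are positive so that they pass through the infimum in `opProjNorm`. -/
theorem cbBound_tensorMap {N : MatrixNorm V} {N' : MatrixNorm W} {Φ Ψ : V →ₗ[ℂ] W} {K K' : ℝ≥0}
    (hK : 0 < K) (hK' : 0 < K') (hΦ : CBBound N N' Φ K) (hΨ : CBBound N N' Ψ K') :
    CBBound (opProjNorm N) (opProjNorm N') (TensorProduct.map Φ Ψ) (K * K') := by
  intro n t
  refine le_mul_opProjNorm (by simp [hK.ne', hK'.ne']) ENNReal.coe_ne_top fun p q α v w β ht => ?_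
  refine (opProjNorm_le (α := α) (v := v.map Φ) (w := w.map Ψ) (β := β) fun i j => ?_).trans ?_
  · simp [Matrix.map_apply, ht]
  · calc matENorm α * N' p (v.map Φ) * N' q (w.map Ψ) * matENorm β
        ≤ matENorm α * (K * N p v) * (K' * N q w) * matENorm β := by
          gcongr
          · exact hΦ p v
          · exact hΨ q w
      _ = _ := by rw [ENNReal.coe_mul]; ring

theorem opProjNorm_smul_le {N : MatrixNorm V} {n : ℕ} (c : ℂ)
    (t : Matrix (Fin n) (Fin n) (V ⊗[ℂ] V)) :
    opProjNorm N n (c • t) ≤ ‖c‖ₑ * opProjNorm N n t := by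
  by_cases hc : c = 0
  -- the zero tensor has the empty expansion, of norm zero
  · refine (opProjNorm_le (p := 0) (q := 0) (α := 0) (v := 0) (w := 0) (β := 0) fun i j => ?_).trans
      ?_
    · simp [hc]
    · simp [matENorm_zero]
  refine le_mul_opProjNorm (by simpa using hc) enorm_ne_top fun p q α v w β ht => ?_
  refine (opProjNorm_le (α := c • α) (v := v) (w := w) (β := β) fun i j => ?_).trans ?_
  · simp only [Matrix.smul_apply, ht, Finset.smul_sum, smul_smul, smul_eq_mul, mul_assoc]
  · rw [matENorm_smul]
    exact le_of_eq (by ring)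

theorem CBBound.id (N : MatrixNorm V) : CBBound N N LinearMap.id 1 := fun n v => by
  have : v.map (LinearMap.id : V →ₗ[ℂ] V) = v := by ext; rfl
  rw [this]; simp

theorem CBBound.mono {N : MatrixNorm V} {N' : MatrixNorm W} {Φ : V →ₗ[ℂ] W} {K K' : ℝ≥0}
    (h : CBBound N N' Φ K) (hK : K ≤ K') : CBBound N N' Φ K' := fun n v =>
  (h n v).trans (mul_le_mul' (by exact_mod_cast hK) le_rfl)

theorem CBBound.comp {U : Type*} [AddCommGroup U] [Module ℂ U] {N : MatrixNorm V}
    {N' : MatrixNorm W} {N'' : MatrixNorm U} {Φ : V →ₗ[ℂ] W} {Ψ : W →ₗ[ℂ] U} {K K' : ℝ≥0}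
    (hΨ : CBBound N' N'' Ψ K') (hΦ : CBBound N N' Φ K) : CBBound N N'' (Ψ ∘ₗ Φ) (K' * K) := by
  intro n v
  refine (hΨ n (v.map Φ)).trans ?_
  rw [ENNReal.coe_mul, mul_assoc]
  exact mul_le_mul' le_rfl (hΦ n v)

/-- Completely bounded maps induce maps of the duals of operator projective tensor products. -/
theorem comp_tensorMap_mem_opProjDual {N : MatrixNorm V} {N' : MatrixNorm W} {Φ Ψ : V →ₗ[ℂ] W}
    {K K' : ℝ≥0} (hΦ : CBBound N N' Φ K) (hΨ : CBBound N N' Ψ K')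
    {ψ : Module.Dual ℂ (W ⊗[ℂ] W)} (hψ : ψ ∈ OpProjDual N') :
    ψ ∘ₗ TensorProduct.map Φ Ψ ∈ OpProjDual N :=
  boundedDual_comp (fun t => cbBound_tensorMap (K := K + 1) (K' := K' + 1) (by positivity)
    (by positivity) (hΦ.mono (by simp)) (hΨ.mono (by simp)) 1 (Matrix.of fun _ _ => t)) hψ

end OpProj

section Proj

variable {A B : Type*} [NonUnitalNormedRing A] [NormedSpace ℂ A] [NonUnitalNormedRing B]
  [NormedSpace ℂ B]

theorem le_mul_projENorm {t : A ⊗[ℂ] A} {y C : ℝ≥0∞} (hC0 : C ≠ 0) (hC : C ≠ ∞)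
    (h : ∀ (n : ℕ) (a b : Fin n → A), t = ∑ i, a i ⊗ₜ[ℂ] b i → y ≤ C * ∑ i, ‖a i‖ₑ * ‖b i‖ₑ) :
    y ≤ C * projENorm t := by
  rw [mul_comm, ← ENNReal.div_le_iff_le_mul (Or.inl hC0) (Or.inl hC)]
  refine le_iInf fun n => le_iInf fun a => le_iInf fun b => le_iInf fun ht => ?_
  rw [ENNReal.div_le_iff_le_mul (Or.inl hC0) (Or.inl hC), mul_comm]
  exact h n a b ht

theorem projENorm_le {t : A ⊗[ℂ] A} {n : ℕ} {a b : Fin n → A} (ht : t = ∑ i, a i ⊗ₜ[ℂ] b i) :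
    projENorm t ≤ ∑ i, ‖a i‖ₑ * ‖b i‖ₑ :=
  iInf_le_of_le n (iInf_le_of_le a (iInf_le_of_le b (iInf_le _ ht)))

/-- The summands `1` keep the constant from vanishing, as `le_mul_projENorm` requires. -/
theorem projENorm_tensorMap_le {Φ Ψ : A →L[ℂ] B} (t : A ⊗[ℂ] A) :
    projENorm (TensorProduct.map (Φ : A →ₗ[ℂ] B) (Ψ : A →ₗ[ℂ] B) t) ≤
      ((‖Φ‖₊ + 1) * (‖Ψ‖₊ + 1) : ℝ≥0) * projENorm t := by
  refine le_mul_projENorm (by simp) ENNReal.coe_ne_top fun n a b ht => ?_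
  refine (projENorm_le (a := fun i => Φ (a i)) (b := fun i => Ψ (b i)) (by simp [ht])).trans ?_
  rw [Finset.mul_sum]
  refine Finset.sum_le_sum fun i _ => ?_
  rw [ENNReal.coe_mul, mul_mul_mul_comm]
  have key : ∀ (Φ : A →L[ℂ] B) (a : A), ‖Φ a‖ₑ ≤ ((‖Φ‖₊ + 1 : ℝ≥0) : ℝ≥0∞) * ‖a‖ₑ := by
    intro Φ a
    have : ‖Φ a‖₊ ≤ (‖Φ‖₊ + 1) * ‖a‖₊ :=
      (Φ.le_opNNNorm a).trans (mul_le_mul' (by simp) le_rfl)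
    rw [enorm_eq_nnnorm, enorm_eq_nnnorm]
    exact_mod_cast this
  exact mul_le_mul' (key _ _) (key _ _)

theorem projENorm_smul_le (c : ℂ) (t : A ⊗[ℂ] A) : projENorm (c • t) ≤ ‖c‖ₑ * projENorm t := by
  by_cases hc : c = 0
  -- the zero tensor has the empty expansion, of norm zero
  · refine (projENorm_le (n := 0) (a := fun _ => 0) (b := fun _ => 0) (by simp [hc])).trans ?_
    simp
  refine le_mul_projENorm (by simpa using hc) enorm_ne_top fun n a b ht => ?_
  refine (projENorm_le (a := fun i => c • a i) (b := b) ?_).trans ?_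
  · simp [ht, Finset.smul_sum, TensorProduct.smul_tmul']
  · simp [Finset.mul_sum, enorm_smul, mul_assoc]

theorem comp_tensorMap_mem_projDual (Φ Ψ : A →L[ℂ] B) {ψ : Module.Dual ℂ (B ⊗[ℂ] B)}
    (hψ : ψ ∈ ProjDual B) :
    ψ ∘ₗ TensorProduct.map (Φ : A →ₗ[ℂ] B) (Ψ : A →ₗ[ℂ] B) ∈ ProjDual A :=
  boundedDual_comp projENorm_tensorMap_le hψ

variable [IsScalarTower ℂ A A] [SMulCommClass ℂ A A]

theorem tensorLeft_mem_projDual (a : A) {ψ : Module.Dual ℂ (A ⊗[ℂ] A)} (hψ : ψ ∈ ProjDual A) :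
    tensorLeft a ψ ∈ ProjDual A :=
  comp_tensorMap_mem_projDual (ContinuousLinearMap.id ℂ A) ((ContinuousLinearMap.mul ℂ A).flip a) hψ

theorem tensorRight_mem_projDual (a : A) {ψ : Module.Dual ℂ (A ⊗[ℂ] A)} (hψ : ψ ∈ ProjDual A) :
    tensorRight ψ a ∈ ProjDual A :=
  comp_tensorMap_mem_projDual (ContinuousLinearMap.mul ℂ A a) (ContinuousLinearMap.id ℂ A) hψ

theorem mulPullback_mem_projDual (φ : StrongDual ℂ A) : mulPullback φ ∈ ProjDual A := by
  refine ⟨‖φ‖₊ + 1, fun t => le_mul_projENorm (by simp) ENNReal.coe_ne_top fun n a b ht => ?_⟩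
  have h1 : ‖mulPullback φ t‖₊ ≤ (‖φ‖₊ + 1) * ∑ i, ‖a i‖₊ * ‖b i‖₊ := by
    have : mulPullback φ t = φ (∑ i, a i * b i) := by simp [mulPullback, ht]
    rw [this]
    refine (φ.le_opNNNorm _).trans (mul_le_mul' (by simp) ((nnnorm_sum_le _ _).trans
      (Finset.sum_le_sum fun i _ => nnnorm_mul_le _ _)))
  have h2 : ((‖mulPullback φ t‖₊ : ℝ≥0) : ℝ≥0∞) ≤
    (((‖φ‖₊ + 1) * ∑ i, ‖a i‖₊ * ‖b i‖₊ : ℝ≥0) : ℝ≥0∞) := by exact_mod_cast h1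
  push_cast at h2 ⊢
  exact h2

end Proj

end TensorNorms

section OpDualModule

variable {G : Type*} [Group G] [TopologicalSpace G] [IsTopologicalGroup G]
  [LocallyCompactSpace G] [MeasurableSpace G] [BorelSpace G]

theorem tensorLeft_mem_opProjDual (a : S1A G) {ψ : Module.Dual ℂ (S1A G ⊗[ℂ] S1A G)}
    (hψ : ψ ∈ OpProjDual (S1A.matrixNorm G)) :
    tensorLeft a ψ ∈ OpProjDual (S1A.matrixNorm G) := by
  have h := S1A.cbBound_mulLeft a
  have e : LinearMap.mulLeft ℂ a = LinearMap.mulRight ℂ a := by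
    ext1 b; exact mul_comm a b
  rw [e] at h
  exact comp_tensorMap_mem_opProjDual (CBBound.id _) h hψ

theorem tensorRight_mem_opProjDual (a : S1A G) {ψ : Module.Dual ℂ (S1A G ⊗[ℂ] S1A G)}
    (hψ : ψ ∈ OpProjDual (S1A.matrixNorm G)) :
    tensorRight ψ a ∈ OpProjDual (S1A.matrixNorm G) :=
  comp_tensorMap_mem_opProjDual (S1A.cbBound_mulLeft a) (CBBound.id _) hψ

theorem l2_row_le {p : Type*} [Fintype p] [DecidableEq p] (α : Matrix (Fin 1) p ℂ) :
    l2 (α 0) ≤ (matENorm α).toReal := by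
  have h1 := MatBound.of_matENorm_le (M := α) ENNReal.toReal_nonneg
    (ENNReal.ofReal_toReal (matENorm_ne_top α)).ge (fun r => star (α 0 r)) 1
  have h2 : ∑ i : Fin 1, ∑ r, (1 : Fin 1 → ℂ) i * α i r * star (α 0 r) =
      ((l2 (α 0) ^ 2 : ℝ) : ℂ) := by
    rw [l2_sq]
    push_cast
    simp only [Finset.univ_unique, Fin.default_eq_zero, Finset.sum_singleton, Pi.one_apply, one_mul]
    exact Finset.sum_congr rfl fun r _ => Complex.mul_conj' _
  have h3 : l2 (1 : Fin 1 → ℂ) = 1 := by simp [l2]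
  rw [h2, l2_star, h3, Complex.norm_real, Real.norm_of_nonneg (sq_nonneg _), mul_one, sq] at h1
  rcases (l2_nonneg (α 0)).eq_or_lt' with h0 | h0
  · rw [h0]; exact ENNReal.toReal_nonneg
  · exact le_of_mul_le_mul_right h1 h0

theorem l2_column_le {p : Type*} [Fintype p] (β : Matrix p (Fin 1) ℂ) :
    l2 (fun s => β s 0) ≤ (matENorm β).toReal := by
  have h1 := (MatBound.of_matENorm_le (M := β) ENNReal.toReal_nonneg
    (ENNReal.ofReal_toReal (matENorm_ne_top β)).ge).l2_le ENNReal.toReal_nonneg 1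
  have h3 : l2 (1 : Fin 1 → ℂ) = 1 := by simp [l2]
  simpa [h3] using h1

/-- The two summands of the norm of `S¹A(G)` account for the factor `2`. -/
theorem S1A.norm_sum_mul_le {p q : ℕ} (v : Matrix (Fin p) (Fin p) (S1A G))
    (w : Matrix (Fin q) (Fin q) (S1A G)) (α β : Fin p × Fin q → ℂ) :
    ‖∑ r, ∑ s, (α r * β s) • (v r.1 s.1 * w r.2 s.2)‖ ≤
      2 * (l2 α * (S1A.matrixNorm G p v).toReal * (S1A.matrixNorm G q w).toReal * l2 β) := by
  have h1 := (VNBound.mul ENNReal.toReal_nonneg (vnBound_matrixNorm v)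
    (vnBound_matrixNorm w)).norm_sum_le α β
  have h2 := (LBound.mul ENNReal.toReal_nonneg (vnBound_matrixNorm v)
    (lBound_matrixNorm w)).integral_norm_sum_le α β
  rw [S1A.norm_eq]
  simp only [map_sum, map_smul, toFourier_mul]
  linarith

/-- Multiplication on `S¹A(G)` is bounded on the operator projective tensor product. -/
theorem mulPullback_mem_opProjDual (φ : StrongDual ℂ (S1A G)) :
    mulPullback φ ∈ OpProjDual (S1A.matrixNorm G) := by
  refine ⟨2 * (‖φ‖₊ + 1), fun t => le_mul_opProjNorm (by simp) ENNReal.coe_ne_top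
    fun p q α v w β ht => ?_⟩
  have hu : mulPullback φ t = φ (∑ r, ∑ s, (α 0 r * β s 0) • (v r.1 s.1 * w r.2 s.2)) := by
    have h1 : t = _ := ht 0 0
    rw [h1]
    simp only [mulPullback, LinearMap.comp_apply, map_sum, map_smul, LinearMap.mul'_apply]
    rfl
  have h1 := S1A.norm_sum_mul_le v w (α 0) fun s => β s 0
  rw [hu]
  generalize (∑ r, ∑ s, (α 0 r * β s 0) • (v r.1 s.1 * w r.2 s.2) : S1A G) = u at h1 ⊢
  have hα := l2_row_le α
  have hβ := l2_column_le β
  have hfin := S1A.matrixNorm_ne_top v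
  have hfin' := S1A.matrixNorm_ne_top w
  generalize S1A.matrixNorm G p v = c at h1 hfin ⊢
  generalize S1A.matrixNorm G q w = d at h1 hfin' ⊢
  have h2 : ‖u‖ ≤ 2 * ((matENorm α).toReal * c.toReal * d.toReal * (matENorm β).toReal) := by
    refine h1.trans ?_
    have := l2_nonneg fun s => β s 0
    gcongr
  have h4 : ‖φ u‖ ≤ (2 * (‖φ‖ + 1)) *
      ((matENorm α).toReal * c.toReal * d.toReal * (matENorm β).toReal) := by
    refine (φ.le_opNorm u).trans ?_
    refine (mul_le_mul (le_add_of_nonneg_right zero_le_one) h2 (norm_nonneg _)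
      (by positivity)).trans_eq (by ring)
  rw [← ofReal_norm]
  refine (ENNReal.ofReal_le_ofReal h4).trans_eq ?_
  have h5 : ((2 * (‖φ‖₊ + 1) : ℝ≥0) : ℝ≥0∞) = ENNReal.ofReal (2 * (‖φ‖ + 1)) := by
    rw [← ENNReal.ofReal_coe_nnreal]; simp
  rw [h5, ENNReal.ofReal_mul (by positivity), ENNReal.ofReal_mul (by positivity),
    ENNReal.ofReal_mul (by positivity), ENNReal.ofReal_mul (by positivity),
    ENNReal.ofReal_mul (by positivity), ENNReal.ofReal_toReal (matENorm_ne_top α),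
    ENNReal.ofReal_toReal (matENorm_ne_top β), ENNReal.ofReal_toReal hfin,
    ENNReal.ofReal_toReal hfin']

end OpDualModule

/-! ### Transfer of approximate biflatness -/

section Transfer

universe u

variable {A B : Type u} [NonUnitalNormedCommRing A] [NormedSpace ℂ A] [IsScalarTower ℂ A A]
  [SMulCommClass ℂ A A] [NonUnitalNormedCommRing B] [NormedSpace ℂ B]

/-- The map `ψ ↦ θ(ψ ∘ (j ⊗ j)) ∘ r ∘ (multiplication by w)` from functionals on `A ⊗ A` to `A*`,
made from a map `θ` of functionals on `B ⊗ B` to `B*` and from maps `j : B → A`, `r : A → B`. -/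
def transferMap {DA : Submodule ℂ (Module.Dual ℂ (A ⊗[ℂ] A))}
    {DB : Submodule ℂ (Module.Dual ℂ (B ⊗[ℂ] B))} {j : B →L[ℂ] A}
    (hj : ∀ ψ ∈ DA, ψ ∘ₗ TensorProduct.map (j : B →ₗ[ℂ] A) (j : B →ₗ[ℂ] A) ∈ DB)
    (r : A →L[ℂ] B) (w : A) (θ : DB →ₗ[ℂ] StrongDual ℂ B) : DA →ₗ[ℂ] StrongDual ℂ A where
  toFun ψ := (θ ⟨_, hj ψ ψ.2⟩).comp (r.comp (ContinuousLinearMap.mul ℂ A w))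
  map_add' ψ ψ' := by
    have : (⟨_, hj _ (ψ + ψ').2⟩ : DB) = ⟨_, hj _ ψ.2⟩ + ⟨_, hj _ ψ'.2⟩ := Subtype.ext rfl
    rw [this, map_add]; rfl
  map_smul' c ψ := by
    have : (⟨_, hj _ (c • ψ).2⟩ : DB) = c • ⟨_, hj _ ψ.2⟩ := Subtype.ext rfl
    rw [this, map_smul]; rfl

theorem transferMap_apply {DA : Submodule ℂ (Module.Dual ℂ (A ⊗[ℂ] A))}
    {DB : Submodule ℂ (Module.Dual ℂ (B ⊗[ℂ] B))} {j : B →L[ℂ] A}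
    (hj : ∀ ψ ∈ DA, ψ ∘ₗ TensorProduct.map (j : B →ₗ[ℂ] A) (j : B →ₗ[ℂ] A) ∈ DB)
    (r : A →L[ℂ] B) (w : A) (θ : DB →ₗ[ℂ] StrongDual ℂ B) (ψ : DA) (a : A) :
    transferMap hj r w θ ψ a = θ ⟨_, hj ψ ψ.2⟩ (r (w * a)) := rfl

variable [IsScalarTower ℂ B B] [SMulCommClass ℂ B B]

/-- Transfer of nets of bimodule maps along a family of homomorphisms `j_x : B → A`, `r_x : A → B` with
`j_x (b r_x(a)) = j_x(b) a`, such that finite sums of the `j_x r_x` fix the multiples of some `w` that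
acts nearly as the identity on a given finite set. The maps for `A` are the finite sums
`ψ ↦ ∑_x θ(ψ ∘ (j_x ⊗ j_x)) ∘ r_x ∘ w`; the identity that links `j_x` and `r_x` makes them bimodule
maps. The new net is indexed by finite sets of pairs `(φ, b)` to be approximated, with a precision. -/
theorem HasBiflatNet.transfer {DA : Submodule ℂ (Module.Dual ℂ (A ⊗[ℂ] A))}
    {DB : Submodule ℂ (Module.Dual ℂ (B ⊗[ℂ] B))} {PA : (DA →ₗ[ℂ] StrongDual ℂ A) → Prop}
    {PB : (DB →ₗ[ℂ] StrongDual ℂ B) → Prop}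
    (hl : ∀ (a : A), ∀ ψ ∈ DA, tensorLeft a ψ ∈ DA)
    (hr : ∀ (a : A), ∀ ψ ∈ DA, tensorRight ψ a ∈ DA)
    (hπ : ∀ φ : StrongDual ℂ A, mulPullback φ ∈ DA)
    {X : Type*} (j : X → B →L[ℂ] A) (r : X → A →L[ℂ] B)
    (hjm : ∀ x b b', j x (b * b') = j x b * j x b')
    (hrm : ∀ x a a', r x (a * a') = r x a * r x a')
    (hjr : ∀ x b a, j x (b * r x a) = j x b * a)
    (hj : ∀ x, ∀ ψ ∈ DA, ψ ∘ₗ TensorProduct.map (j x : B →ₗ[ℂ] A) (j x : B →ₗ[ℂ] A) ∈ DB)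
    (hP0 : PA 0) (hPadd : ∀ θ θ', PA θ → PA θ' → PA (θ + θ'))
    (hP : ∀ x w θ, PB θ → PA (transferMap (hj x) (r x) w θ))
    (hd : ∀ (S : Finset A) (ε : ℝ), 0 < ε → ∃ (w : A) (F : Finset X),
      (∀ a, ∑ x ∈ F, j x (r x (w * a)) = w * a) ∧ ∀ a ∈ S, ‖w * a - a‖ < ε)
    (hB : HasBiflatNet DB PB) : HasBiflatNet DA PA := by
  classical
  obtain ⟨hlB, hrB, hπB, Δ, _, _, _, θ, hθP, hθl, hθr, hθ⟩ := hB
  refine ⟨hl, hr, hπ, ?_⟩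
  -- approximation on finitely many functionals and vectors
  have key : ∀ (S : Finset (StrongDual ℂ A × A)) (ε : ℝ), 0 < ε → ∃ Θ : DA →ₗ[ℂ] StrongDual ℂ A,
      PA Θ ∧ (∀ (a : A) (ψ : DA), Θ ⟨tensorLeft a ψ, hl a ψ ψ.2⟩ = dualLeft a (Θ ψ)) ∧
      (∀ (a : A) (ψ : DA), Θ ⟨tensorRight ψ a, hr a ψ ψ.2⟩ = dualRight (Θ ψ) a) ∧
      ∀ p ∈ S, ‖Θ ⟨mulPullback p.1, hπ p.1⟩ p.2 - p.1 p.2‖ < ε := by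
    intro S ε hε
    let M : ℝ := ∑ p ∈ S, ‖p.1‖
    have hM : 0 ≤ M := Finset.sum_nonneg fun _ _ => norm_nonneg _
    obtain ⟨w, F, hF, hw⟩ := hd (S.image Prod.snd) (ε / 2 / (M + 1)) (by positivity)
    -- for fixed `w` the sums converge weak* to `φ ↦ φ(w ·)`
    have hlim : ∀ φ a, Tendsto (fun δ => (∑ x ∈ F, transferMap (hj x) (r x) w (θ δ))
        ⟨mulPullback φ, hπ φ⟩ a) atTop (𝓝 (φ (w * a))) := by
      intro φ a
      have h1 : ∀ x, Tendsto (fun δ => transferMap (hj x) (r x) w (θ δ) ⟨mulPullback φ, hπ φ⟩ a)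
          atTop (𝓝 (φ (j x (r x (w * a))))) := by
        intro x
        have h2 : ∀ h, (⟨mulPullback φ ∘ₗ TensorProduct.map (j x : B →ₗ[ℂ] A) (j x : B →ₗ[ℂ] A),
            h⟩ : DB) = ⟨mulPullback (φ.comp (j x)), hπB _⟩ := fun h => by
          refine Subtype.ext (TensorProduct.ext' fun b c => ?_)
          simp [mulPullback, hjm]
        simp only [transferMap_apply, h2]
        exact hθ (φ.comp (j x)) (r x (w * a))
      have h3 := tendsto_finsetSum F fun x _ => h1 x
      rw [← map_sum, hF] at h3
      refine h3.congr fun δ => ?_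
      simp
    have hev : ∀ᶠ δ in atTop, ∀ p ∈ S, ‖(∑ x ∈ F, transferMap (hj x) (r x) w (θ δ))
        ⟨mulPullback p.1, hπ p.1⟩ p.2 - p.1 (w * p.2)‖ < ε / 2 := by
      rw [Filter.eventually_all_finset]
      intro p _
      have := (hlim p.1 p.2).sub_const (p.1 (w * p.2))
      rw [sub_self] at this
      exact this.norm.eventually (gt_mem_nhds (by simpa using half_pos hε))
    obtain ⟨δ, hδ⟩ := hev.exists
    refine ⟨∑ x ∈ F, transferMap (hj x) (r x) w (θ δ), ?_, fun a ψ => ?_, fun a ψ => ?_,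
      fun p hp => ?_⟩
    · exact Finset.sum_induction _ PA hPadd hP0 fun x _ => hP x w _ (hθP δ)
    · ext b
      simp only [LinearMap.sum_apply, _root_.sum_apply, transferMap_apply, dualLeft,
        ContinuousLinearMap.comp_apply, ContinuousLinearMap.flip_apply,
        ContinuousLinearMap.mul_apply']
      refine Finset.sum_congr rfl fun x _ => ?_
      have h2 : ∀ h, (⟨tensorLeft a (ψ : Module.Dual ℂ (A ⊗[ℂ] A)) ∘ₗ
          TensorProduct.map (j x : B →ₗ[ℂ] A) (j x : B →ₗ[ℂ] A), h⟩ : DB) =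
          ⟨tensorLeft (r x a) (ψ ∘ₗ TensorProduct.map (j x : B →ₗ[ℂ] A) (j x : B →ₗ[ℂ] A)),
            hlB _ _ (hj x ψ ψ.2)⟩ := fun h => by
        refine Subtype.ext (TensorProduct.ext' fun b c => ?_)
        simp [tensorLeft, hjr]
      rw [h2, hθl δ (r x a) ⟨_, hj x ψ ψ.2⟩]
      simp only [dualLeft, ContinuousLinearMap.comp_apply, ContinuousLinearMap.flip_apply,
        ContinuousLinearMap.mul_apply']
      rw [← hrm, mul_assoc]
    · ext b
      simp only [LinearMap.sum_apply, _root_.sum_apply, transferMap_apply, dualRight,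
        ContinuousLinearMap.comp_apply, ContinuousLinearMap.mul_apply']
      refine Finset.sum_congr rfl fun x _ => ?_
      have h2 : ∀ h, (⟨tensorRight (ψ : Module.Dual ℂ (A ⊗[ℂ] A)) a ∘ₗ
          TensorProduct.map (j x : B →ₗ[ℂ] A) (j x : B →ₗ[ℂ] A), h⟩ : DB) =
          ⟨tensorRight (ψ ∘ₗ TensorProduct.map (j x : B →ₗ[ℂ] A) (j x : B →ₗ[ℂ] A)) (r x a),
            hrB _ _ (hj x ψ ψ.2)⟩ := fun h => by
        refine Subtype.ext (TensorProduct.ext' fun b c => ?_)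
        simp [tensorRight, mul_comm _ b, mul_comm a, hjr]
      rw [h2, hθr δ (r x a) ⟨_, hj x ψ ψ.2⟩]
      simp only [dualRight, ContinuousLinearMap.comp_apply, ContinuousLinearMap.mul_apply']
      rw [← hrm, mul_left_comm]
    · have h1 : ‖p.1 (w * p.2) - p.1 p.2‖ ≤ ε / 2 := by
        rw [← map_sub]
        refine (p.1.le_opNorm _).trans ?_
        have h2 := (hw p.2 (Finset.mem_image_of_mem _ hp)).le
        have h3 : ‖p.1‖ ≤ M + 1 :=
          (Finset.single_le_sum (f := fun p : StrongDual ℂ A × A => ‖p.1‖)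
            (fun _ _ => norm_nonneg _) hp).trans (by simp [M])
        calc ‖p.1‖ * ‖w * p.2 - p.2‖ ≤ (M + 1) * (ε / 2 / (M + 1)) := by gcongr
          _ = ε / 2 := by field_simp
      have h2 := hδ p hp
      calc _ ≤ _ + _ := norm_sub_le_norm_sub_add_norm_sub _ (p.1 (w * p.2)) _
        _ < ε := by linarith
  choose Θ hΘP hΘl hΘr hΘ using fun d : Finset (StrongDual ℂ A × A) × ℕ =>
    key d.1 (1 / ((d.2 : ℝ) + 1)) Nat.one_div_pos_of_nat
  refine ⟨Finset (StrongDual ℂ A × A) × ℕ, inferInstance, inferInstance, inferInstance, Θ,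
    hΘP, hΘl, hΘr, fun φ b => ?_⟩
  rw [Metric.tendsto_atTop]
  intro ε hε
  obtain ⟨n, hn⟩ := exists_nat_one_div_lt hε
  refine ⟨({(φ, b)}, n), fun d hd => ?_⟩
  rw [dist_eq_norm]
  refine (hΘ d (φ, b) (hd.1 (Finset.mem_singleton_self _))).trans_le ((one_div_le_one_div_of_le
    (by positivity) ?_).trans hn.le)
  have : (n : ℝ) ≤ d.2 := by exact_mod_cast hd.2
  linarith

end Transfer

/-! ### Weighted composition maps between Lebesgue-Fourier algebras -/

section WeightedComposition

variable {G G' : Type*} [Group G] [TopologicalSpace G] [IsTopologicalGroup G]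
  [LocallyCompactSpace G] [MeasurableSpace G] [BorelSpace G] [Group G'] [TopologicalSpace G']
  [IsTopologicalGroup G'] [LocallyCompactSpace G'] [MeasurableSpace G'] [BorelSpace G']

/-- The map `u ↦ w · (u ∘ p)` sends coefficients of continuous vectors of compact support to sums
of coefficients without increasing the square sums of the vectors. The expansion is required for
finite families of vectors at once, which makes the map completely contractive on `A(G)`. -/
def ExpandsCoeff (w : G' → ℂ) (p : G' → G) : Prop :=
  ∀ (κ : Type) [Fintype κ] (x y : κ → L2 G), (∀ k, IsCc (x k)) → (∀ k, IsCc (y k)) →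
    ∃ (ι : Type) (_ : Countable ι) (ξ η : ι → κ → L2 G'),
      (∀ k (S : Finset ι), ∑ i ∈ S, ‖ξ i k‖ ^ 2 ≤ ‖x k‖ ^ 2) ∧
      (∀ k (S : Finset ι), ∑ i ∈ S, ‖η i k‖ ^ 2 ≤ ‖y k‖ ^ 2) ∧
      ∀ k l s, w s * coeff (x l) (y k) (leftReg (p s)) =
        ∑' i, coeff (ξ i l) (η i k) (leftReg s)

theorem ExpandsCoeff.fourierENorm_coeff_le {w : G' → ℂ} {p : G' → G} (h : ExpandsCoeff w p)
    {ξ η : L2 G} (hξ : IsCc ξ) (hη : IsCc η) :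
    fourierENorm (fun s => w s * coeff ξ η (leftReg (p s))) ≤ ‖ξ‖ₑ * ‖η‖ₑ := by
  obtain ⟨ι, _, ξ', η', h1, h2, h3⟩ := h Unit (fun _ => ξ) (fun _ => η) (fun _ => hξ) fun _ => hη
  refine (fourierENorm_le_of_countable (fun i => ξ' i ()) (fun i => η' i ())
    fun s => h3 () () s).trans (tsum_mul_le_of_sq ?_ ?_)
  all_goals
    rw [ENNReal.tsum_eq_iSup_sum]
    refine iSup_le fun S => ?_
    simp only [← ofReal_norm, ← ENNReal.ofReal_pow (norm_nonneg _)]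
    rw [← ENNReal.ofReal_sum_of_nonneg fun _ _ => sq_nonneg _]
    refine ENNReal.ofReal_le_ofReal ?_
  · exact h1 () S
  · exact h2 () S

theorem ExpandsCoeff.fourierENorm_le {w : G' → ℂ} {p : G' → G} (h : ExpandsCoeff w p)
    (u : FourierAlg G) : fourierENorm (fun s => w s * u (p s)) ≤ ‖u‖ₑ := by
  refine ENNReal.le_of_forall_pos_le_add fun ε hε _ => ?_
  obtain ⟨ξ, η, hξ, hη, hu, hle⟩ := u.exists_isCc_rep hε
  refine le_trans ?_ hle
  refine (fourierENorm_le_tsum (fun i s => w s * coeff (ξ i) (η i) (leftReg (p s)))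
    fun s => ?_).trans (ENNReal.tsum_le_tsum fun i => h.fourierENorm_coeff_le (hξ i) (hη i))
  rw [tsum_mul_left, hu]

/-- `u ↦ w · (u ∘ p)` as a contraction between Fourier algebras. -/
def FourierAlg.wcomp {w : G' → ℂ} {p : G' → G} (h : ExpandsCoeff w p) :
    FourierAlg G →L[ℂ] FourierAlg G' :=
  LinearMap.mkContinuous
    { toFun := fun u => ⟨fun s => w s * u (p s),
        ne_top_of_le_ne_top enorm_ne_top (h.fourierENorm_le u)⟩
      map_add' := fun _ _ => FourierAlg.ext fun _ => mul_add _ _ _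
      map_smul' := fun _ _ => FourierAlg.ext fun _ => mul_left_comm _ _ _ } 1 fun u => by
    have := ENNReal.toReal_mono enorm_ne_top (h.fourierENorm_le u)
    rw [toReal_enorm] at this
    rw [one_mul]
    exact this

theorem FourierAlg.norm_wcomp_le {w : G' → ℂ} {p : G' → G} (h : ExpandsCoeff w p)
    (u : FourierAlg G) : ‖wcomp h u‖ ≤ ‖u‖ := by
  have := ENNReal.toReal_mono enorm_ne_top (h.fourierENorm_le u)
  rwa [toReal_enorm] at this

/-- Weighted composition maps that expand coefficients are complete contractions: the adjoint maps
contractive matrices over `VN(G')` to contractive matrices over `VN(G)`. -/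
theorem VNBound.wcomp {w : G' → ℂ} {p : G' → G} (h : ExpandsCoeff w p) {ι : Type*} [Fintype ι]
    {u : ι → ι → FourierAlg G} {c : ℝ} (hu : VNBound u c) :
    VNBound (fun i j => FourierAlg.wcomp h (u i j)) c := by
  intro κ _ T hT hb
  obtain ⟨S, hS, hSb, hSv⟩ := exists_vn_matrix (c := 1)
    (fun k l => (vnFunctional (T k l) (hT k l)).comp (FourierAlg.wcomp h)) fun x y hx hy => by
      obtain ⟨ι, _, ξ, η, h1, h2, h3⟩ := h κ x y hx hy
      have h4 := norm_sum_vnPairing_le hT zero_le_one hb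
        (u := fun k l => FourierAlg.wcomp h (FourierAlg.ofCoeff (x l) (y k)))
        (A := fun k => ‖x k‖) (B := fun k => ‖y k‖) h1 h2 h3
      have h5 : ∀ z : κ → L2 G, l2 (fun k => ‖z k‖) = l2 z := fun z => by simp [l2]
      rwa [h5, h5] at h4
  have := hu κ S hS hSb
  simpa only [hSv, ContinuousLinearMap.comp_apply, vnFunctional_apply] using this

/-- The change of variables that describes `u ↦ w · (u ∘ p)` on `L¹`: its adjoint on `L^∞` is
`f ↦ d · w' · (f ∘ p')`. -/
structure TransposesTo (w : G' → ℂ) (p : G' → G) (w' : G → ℂ) (p' : G → G') (d : ℝ≥0) : Prop where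
  measurable_weight : Measurable w'
  norm_weight_le : ∀ t, ‖w' t‖ ≤ 1
  measurable_map : Measurable p'
  integrable : ∀ u : S1A G, Integrable (fun s => w s * u (p s)) (Measure.haar : Measure G')
  integral_eq : ∀ (u : S1A G) (f : G' → ℂ), ∫ s, f s * (w s * u (p s)) ∂(Measure.haar : Measure G')
    = d * ∫ t, w' t * f (p' t) * u t ∂(Measure.haar : Measure G)

/-- `u ↦ w · (u ∘ p)` as a linear map between Lebesgue-Fourier algebras. -/
def S1A.wcompₗ {w : G' → ℂ} {p : G' → G} (h : ExpandsCoeff w p) {w' : G → ℂ} {p' : G → G'} {d : ℝ≥0}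
    (h' : TransposesTo w p w' p' d) : S1A G →ₗ[ℂ] S1A G' where
  toFun u := ⟨fun s => w s * u (p s), (FourierAlg.wcomp h (S1A.toFourier u)).2, h'.integrable u⟩
  map_add' _ _ := S1A.ext fun _ => mul_add _ _ _
  map_smul' _ _ := S1A.ext fun _ => mul_left_comm _ _ _

theorem LBound.wcomp {w : G' → ℂ} {p : G' → G} (h : ExpandsCoeff w p) {w' : G → ℂ} {p' : G → G'}
    {d : ℝ≥0} (h' : TransposesTo w p w' p' d) {ι : Type*} [Fintype ι] {u : ι → ι → S1A G} {c : ℝ}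
    (hu : LBound u c) : LBound (fun i j => S1A.wcompₗ h h' (u i j)) (d * c) := by
  intro κ _ φ hφ hb
  have h1 := hu κ (fun t k l => w' t * φ (p' t) k l)
    (fun k l => h'.measurable_weight.mul ((hφ k l).comp h'.measurable_map)) fun t =>
      ((hb (p' t)).smul (w' t)).mono (by rw [mul_one]; exact h'.norm_weight_le t)
  have h2 := h1.smul ((d : ℝ) : ℂ)
  rw [Complex.norm_real, Real.norm_of_nonneg (NNReal.coe_nonneg _)] at h2
  convert! h2 using 3 with r s
  exact h'.integral_eq _ _

theorem S1A.cbBound_wcomp {w : G' → ℂ} {p : G' → G} (h : ExpandsCoeff w p) {w' : G → ℂ}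
    {p' : G → G'} {d : ℝ≥0} (h' : TransposesTo w p w' p' d) :
    CBBound (S1A.matrixNorm G) (S1A.matrixNorm G') (S1A.wcompₗ h h') (1 + (d : ℝ)).toNNReal :=
  S1A.cbBound zero_le_one (NNReal.coe_nonneg d)
    (fun n u c _ hu => by rw [one_mul]; exact hu.wcomp h) fun n u c _ hu => hu.wcomp h h'

theorem S1A.norm_wcomp_le {w : G' → ℂ} {p : G' → G} (h : ExpandsCoeff w p) {w' : G → ℂ}
    {p' : G → G'} {d : ℝ≥0} (h' : TransposesTo w p w' p' d) (u : S1A G) :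
    ‖S1A.wcompₗ h h' u‖ ≤ (1 + d) * ‖u‖ := by
  have h1 : ‖S1A.toFourier (S1A.wcompₗ h h' u)‖ ≤ ‖S1A.toFourier u‖ :=
    FourierAlg.norm_wcomp_le h (S1A.toFourier u)
  have h2 := ((lBound_of_norm fun _ _ : Unit => u).wcomp h h').integral_norm_sum_le
    (fun _ => 1) (fun _ => 1)
  have h3 : l2 (fun _ : Unit => (1 : ℂ)) = 1 := by simp [l2]
  simp only [Finset.univ_unique, Finset.sum_singleton, mul_one, one_smul, h3] at h2
  have h4 : 0 ≤ ∫ x, ‖u x‖ ∂(Measure.haar : Measure G) := integral_nonneg fun _ => norm_nonneg _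
  rw [S1A.norm_eq, S1A.norm_eq]
  nlinarith [mul_nonneg (NNReal.coe_nonneg d) (norm_nonneg (S1A.toFourier u))]

/-- `u ↦ w · (u ∘ p)` as a bounded linear map between Lebesgue-Fourier algebras. -/
def S1A.wcomp {w : G' → ℂ} {p : G' → G} (h : ExpandsCoeff w p) {w' : G → ℂ} {p' : G → G'} {d : ℝ≥0}
    (h' : TransposesTo w p w' p' d) : S1A G →L[ℂ] S1A G' :=
  (S1A.wcompₗ h h').mkContinuous (1 + d) (S1A.norm_wcomp_le h h')

end WeightedComposition

/-! ### Integration over the cosets of an open subgroup -/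

section TopologicalCosets

theorem range_coset {G : Type*} [Group G] (K : Subgroup G) (y : G) :
    Set.range (fun h : K => (h : G) * y) = {t | t * y⁻¹ ∈ K} := by
  ext t
  refine ⟨?_, fun ht => ⟨⟨_, ht⟩, inv_mul_cancel_right t y⟩⟩
  rintro ⟨h, rfl⟩
  simp

variable {G : Type*} [Group G] [TopologicalSpace G] [IsTopologicalGroup G] {K : Subgroup G}

theorem isOpenEmbedding_coset (hK : IsOpen (K : Set G)) (y : G) :
    Topology.IsOpenEmbedding fun h : K => (h : G) * y :=
  (Homeomorph.mulRight y).isOpenEmbedding.comp hK.isOpenEmbedding_subtypeVal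

theorem isClosedEmbedding_coset (hK : IsOpen (K : Set G)) (y : G) :
    Topology.IsClosedEmbedding fun h : K => (h : G) * y :=
  (Homeomorph.mulRight y).isClosedEmbedding.comp
    (K.isClosed_of_isOpen hK).isClosedEmbedding_subtypeVal

theorem isOpen_coset (hK : IsOpen (K : Set G)) (y : G) : IsOpen {t | t * y⁻¹ ∈ K} :=
  hK.preimage (continuous_mul_const y⁻¹)

/-- A compact set meets only finitely many right cosets of an open subgroup. -/
theorem exists_coset_cover (hK : IsOpen (K : Set G)) {C : Set G} (hC : IsCompact C) :
    ∃ (n : ℕ) (y : Fin n → G), (∀ t ∈ C, ∃ i, t * (y i)⁻¹ ∈ K) ∧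
      ∀ t i j, t * (y i)⁻¹ ∈ K → t * (y j)⁻¹ ∈ K → i = j := by
  classical
  let q : G → Quotient (QuotientGroup.rightRel K) := fun t => ⟦t⟧
  have hq : ∀ t s, q t = q s ↔ t * s⁻¹ ∈ K := fun t s => by
    rw [eq_comm, ← QuotientGroup.rightRel_apply]
    exact Quotient.eq
  obtain ⟨T, hT⟩ := hC.elim_finite_subcover (fun y => {t | t * y⁻¹ ∈ K}) (isOpen_coset hK)
    fun t _ => Set.mem_iUnion.2 ⟨t, by simp⟩
  let e := (T.image q).equivFin
  refine ⟨_, fun i => (e.symm i : Quotient (QuotientGroup.rightRel K)).out, fun t ht => ?_,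
    fun t i j hi hj => ?_⟩
  · obtain ⟨s, hs, hts⟩ := Set.mem_iUnion₂.1 (hT ht)
    refine ⟨e ⟨q s, Finset.mem_image_of_mem q hs⟩, ?_⟩
    beta_reduce
    rw [← hq, Equiv.symm_apply_apply, (hq t s).2 hts]
    exact (Quotient.out_eq _).symm
  · rw [← hq] at hi hj
    have h : ∀ i, q (e.symm i : Quotient (QuotientGroup.rightRel K)).out = e.symm i :=
      fun i => Quotient.out_eq _
    rw [h] at hi hj
    exact e.symm.injective (Subtype.ext (hi.symm.trans hj))

end TopologicalCosets

section Cosets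

variable {G : Type*} [Group G] [TopologicalSpace G] [IsTopologicalGroup G]
  [LocallyCompactSpace G] [MeasurableSpace G] [BorelSpace G] {K : Subgroup G} [LocallyCompactSpace K]

/-- The pullback of Haar measure to `K` along `h ↦ h y` is left invariant, hence a multiple of the
Haar measure of `K`. -/
theorem exists_comap_coset_eq_smul (hK : IsOpen (K : Set G)) (y : G) :
    ∃ c : ℝ≥0, c ≠ 0 ∧ Measure.comap (fun h : K => (h : G) * y) Measure.haar =
      c • (Measure.haar : Measure K) := by
  have he := isOpenEmbedding_coset hK y
  have h1 : (Measure.comap (fun h : K => (h : G) * y) Measure.haar).IsMulLeftInvariant := by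
    refine ⟨fun g => Measure.ext fun s hs => ?_⟩
    rw [Measure.map_apply (measurable_const_mul g) hs, he.measurableEmbedding.comap_apply,
      he.measurableEmbedding.comap_apply, ← measure_preimage_mul Measure.haar (g : G) (_ '' s)]
    congr 1
    ext t
    constructor
    · rintro ⟨h, hh, rfl⟩
      exact ⟨g * h, hh, mul_assoc _ _ _⟩
    · rintro ⟨h, hh, hht⟩
      refine ⟨g⁻¹ * h, by simpa using hh, ?_⟩
      have hht : (h : G) * y = g * t := hht
      simp [mul_assoc, hht]
  have h2 : (Measure.comap (fun h : K => (h : G) * y) Measure.haar).Regular :=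
    Measure.Regular.comap' _ he
  refine ⟨_, fun h0 => ?_, Measure.isMulLeftInvariant_eq_smul_of_regular _ Measure.haar⟩
  have h3 := Measure.isMulLeftInvariant_eq_smul_of_regular
    (Measure.comap (fun h : K => (h : G) * y) Measure.haar) Measure.haar
  rw [h0, zero_smul] at h3
  have h4 := he.measurableEmbedding.comap_apply Measure.haar Set.univ
  rw [h3, Set.image_univ, range_coset] at h4
  exact ((isOpen_coset hK y).measure_pos Measure.haar ⟨y, by simp⟩).ne h4

/-- The ratio of the Haar measure of `G` on the coset `K y` to the Haar measure of `K`. -/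
def cosetModulus (hK : IsOpen (K : Set G)) (y : G) : ℝ≥0 := (exists_comap_coset_eq_smul hK y).choose

theorem cosetModulus_ne_zero (hK : IsOpen (K : Set G)) (y : G) : cosetModulus hK y ≠ 0 :=
  (exists_comap_coset_eq_smul hK y).choose_spec.1

theorem map_coset_haar (hK : IsOpen (K : Set G)) (y : G) :
    (cosetModulus hK y • (Measure.haar : Measure K)).map (fun h : K => (h : G) * y) =
      Measure.haar.restrict {t | t * y⁻¹ ∈ K} := by
  rw [cosetModulus, ← (exists_comap_coset_eq_smul hK y).choose_spec.2,
    (isOpenEmbedding_coset hK y).measurableEmbedding.map_comap, range_coset]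

theorem integral_coset (hK : IsOpen (K : Set G)) (y : G) {E : Type*} [NormedAddCommGroup E]
    [NormedSpace ℝ E] {F : G → E} (hF : ∀ t, t * y⁻¹ ∉ K → F t = 0) :
    ∫ t, F t ∂Measure.haar = cosetModulus hK y • ∫ h : K, F (h * y) ∂Measure.haar := by
  rw [← setIntegral_eq_integral_of_forall_compl_eq_zero (s := {t | t * y⁻¹ ∈ K}) hF,
    ← map_coset_haar hK, (isOpenEmbedding_coset hK y).measurableEmbedding.integral_map,
    integral_smul_nnreal_measure]

theorem integrableOn_coset_iff (hK : IsOpen (K : Set G)) (y : G) {E : Type*} [NormedAddCommGroup E]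
    {F : G → E} : IntegrableOn F {t | t * y⁻¹ ∈ K} Measure.haar ↔
      Integrable (fun h : K => F (h * y)) Measure.haar := by
  rw [IntegrableOn, ← map_coset_haar hK,
    (isOpenEmbedding_coset hK y).measurableEmbedding.integrable_map_iff]
  exact integrable_smul_measure (c := (cosetModulus hK y : ℝ≥0∞))
    (by simpa using cosetModulus_ne_zero hK y) ENNReal.coe_ne_top

end Cosets

/-! ### Translation, extension by zero and restriction -/

section Translation

variable {G : Type*} [Group G] [TopologicalSpace G] [IsTopologicalGroup G]
  [LocallyCompactSpace G] [MeasurableSpace G] [BorelSpace G]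

/-- Translation by `x` is absorbed by the second vector: `⟨λ(x s) ξ, η⟩ = ⟨λ(s) ξ, λ(x⁻¹) η⟩`. -/
theorem expandsCoeff_translation (x : G) : ExpandsCoeff (fun _ => 1) fun s : G => x * s := by
  intro κ _ ξ η _ _
  refine ⟨Unit, inferInstance, fun _ => ξ, fun _ k => leftReg x⁻¹ (η k), fun k S => ?_,
    fun k S => ?_, fun k l s => ?_⟩
  · exact Finset.sum_le_univ_sum_of_nonneg (fun _ => sq_nonneg _) |>.trans_eq (by simp)
  · exact Finset.sum_le_univ_sum_of_nonneg (fun _ => sq_nonneg _) |>.trans_eq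
      (by simp [norm_leftReg])
  · rw [tsum_fintype, Finset.univ_unique, Finset.sum_singleton, one_mul, coeff, coeff,
      ← inner_leftReg x (leftReg x⁻¹ (η k)), ← leftReg_mul, ← leftReg_mul, mul_inv_cancel,
      leftReg_one]

theorem transposesTo_translation (x : G) :
    TransposesTo (fun _ => 1) (fun s : G => x * s) (fun _ => 1) (fun t => x⁻¹ * t) 1 where
  measurable_weight := measurable_const
  norm_weight_le _ := by simp
  measurable_map := measurable_const_mul _
  integrable u := by simpa using u.integrable.comp_mul_left x
  integral_eq u f := by
    rw [← integral_mul_left_eq_self (fun t => (fun _ => 1 : G → ℂ) t * f (x⁻¹ * t) * u t) x]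
    simp

end Translation

section Retraction

variable {G : Type*} [Group G] {K : Subgroup G}

open Classical in
/-- The map `G → K` that fixes the points of `K` and sends the other points to `1`. -/
def retract (K : Subgroup G) (s : G) : K := if hs : s ∈ K then ⟨s, hs⟩ else 1

/-- The characteristic function of a subgroup, with complex values. -/
def oneOn (K : Subgroup G) : G → ℂ := (K : Set G).indicator 1

@[simp] theorem retract_coe (h : K) : retract K h = h := by simp [retract]

theorem oneOn_of_mem {s : G} (hs : s ∈ K) : oneOn K s = 1 := Set.indicator_of_mem hs _

theorem oneOn_of_notMem {s : G} (hs : s ∉ K) : oneOn K s = 0 := Set.indicator_of_notMem hs _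

variable [TopologicalSpace G] [IsTopologicalGroup G]

theorem continuous_retract (hK : IsOpen (K : Set G)) : Continuous (retract K) := by
  rw [continuous_iff_continuousAt]
  intro s
  by_cases hs : s ∈ K
  · have h : ContinuousOn (retract K) K := by
      rw [continuousOn_iff_continuous_domRestrict]
      exact (continuous_id (X := K)).congr fun h => (retract_coe h).symm
    exact h.continuousAt (hK.mem_nhds hs)
  · refine (continuousAt_const (y := 1)).congr ?_
    filter_upwards [(K.isClosed_of_isOpen hK).isOpen_compl.mem_nhds hs] with t ht
    have ht' : t ∉ K := ht
    simp [retract, ht']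

theorem continuous_oneOn (hK : IsOpen (K : Set G)) : Continuous (oneOn K) :=
  IsClopen.continuous_indicator ⟨K.isClosed_of_isOpen hK, hK⟩ continuous_one

theorem continuous_extension (hK : IsOpen (K : Set G)) {f : K → ℂ} (hf : Continuous f) :
    Continuous fun s => oneOn K s * f (retract K s) :=
  (continuous_oneOn hK).mul (hf.comp (continuous_retract hK))

theorem hasCompactSupport_extension {f : K → ℂ} (hf : HasCompactSupport f) :
    HasCompactSupport fun s => oneOn K s * f (retract K s) := by
  refine HasCompactSupport.intro (hf.isCompact.image continuous_subtype_val) fun s hs => ?_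
  by_cases h : s ∈ K
  · have : f ⟨s, h⟩ = 0 := image_eq_zero_of_notMem_tsupport fun h' => hs ⟨_, h', rfl⟩
    simpa [retract, h] using Or.inr this
  · rw [oneOn_of_notMem h, zero_mul]

end Retraction

section Subgroups

variable {G : Type*} [Group G] [TopologicalSpace G] [IsTopologicalGroup G]
  [LocallyCompactSpace G] [MeasurableSpace G] [BorelSpace G] {K : Subgroup G}
  [LocallyCompactSpace K]

theorem integral_subgroup (hK : IsOpen (K : Set G)) {E : Type*} [NormedAddCommGroup E]
    [NormedSpace ℝ E] {F : G → E} (hF : ∀ t ∉ K, F t = 0) :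
    ∫ t, F t ∂Measure.haar = cosetModulus hK 1 • ∫ h : K, F h ∂Measure.haar := by
  rw [integral_coset hK 1 (by simpa using hF)]
  simp

theorem transposesTo_restriction (hK : IsOpen (K : Set G)) :
    TransposesTo (fun _ : K => 1) Subtype.val (oneOn K) (retract K) (cosetModulus hK 1)⁻¹ where
  measurable_weight := (continuous_oneOn hK).measurable
  norm_weight_le t := by
    by_cases h : t ∈ K
    · simp [oneOn_of_mem h]
    · simp [oneOn_of_notMem h]
  measurable_map := (continuous_retract hK).measurable
  integrable u := by simpa using (integrableOn_coset_iff hK 1).1 u.integrable.integrableOn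
  integral_eq u f := by
    rw [integral_subgroup hK fun t ht => by rw [oneOn_of_notMem ht, zero_mul, zero_mul],
      NNReal.smul_def, Complex.real_smul, ← mul_assoc, NNReal.coe_inv, Complex.ofReal_inv,
      inv_mul_cancel₀ (by simpa using cosetModulus_ne_zero hK 1), one_mul]
    simp [oneOn_of_mem]

theorem transposesTo_extension (hK : IsOpen (K : Set G)) :
    TransposesTo (oneOn K) (retract K) (fun _ : K => 1) Subtype.val (cosetModulus hK 1) where
  measurable_weight := measurable_const
  norm_weight_le t := by simp
  measurable_map := measurable_subtype_coe
  integrable u := by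
    have h : (fun s => oneOn K s * u (retract K s)) =
        (K : Set G).indicator fun s => u (retract K s) := by
      ext s
      by_cases h : s ∈ K
      · simp [oneOn_of_mem h, h]
      · simp [oneOn_of_notMem h, h]
    rw [h, integrable_indicator_iff hK.measurableSet]
    have := (integrableOn_coset_iff hK 1 (F := fun s => u (retract K s))).2
      (by simpa using u.integrable)
    simpa using this
  integral_eq u f := by
    rw [integral_subgroup hK fun t ht => by rw [oneOn_of_notMem ht, zero_mul, mul_zero],
      NNReal.smul_def, Complex.real_smul]
    simp [oneOn_of_mem]

/-- Extension by zero multiplies the square of the `L²`-norm by the modulus of `K`. -/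
theorem norm_toLp_extension_sq (hK : IsOpen (K : Set G)) {f : K → ℂ} (hf : Continuous f)
    (hc : HasCompactSupport f) :
    ‖(memLp_two (continuous_extension hK hf) (hasCompactSupport_extension hc)).toLp _‖ ^ 2 =
      cosetModulus hK 1 * ‖(memLp_two hf hc).toLp f‖ ^ 2 := by
  rw [norm_toLp_sq, norm_toLp_sq, integral_subgroup hK fun t ht => by simp [oneOn_of_notMem ht],
    NNReal.smul_def, smul_eq_mul]
  simp [oneOn_of_mem]

theorem coeff_extension (hK : IsOpen (K : Set G)) {f g : K → ℂ} (hf : Continuous f)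
    (hfc : HasCompactSupport f) (hg : Continuous g) (hgc : HasCompactSupport g) (s : G) :
    coeff ((memLp_two (continuous_extension hK hf) (hasCompactSupport_extension hfc)).toLp _)
      ((memLp_two (continuous_extension hK hg) (hasCompactSupport_extension hgc)).toLp _)
      (leftReg s) = (cosetModulus hK 1 : ℝ) * (oneOn K s *
        coeff ((memLp_two hf hfc).toLp f) ((memLp_two hg hgc).toLp g) (leftReg (retract K s))) := by
  rw [coeff, coeff, leftReg_toLp, leftReg_toLp, inner_toLp, inner_toLp,
    integral_subgroup hK fun t ht => by simp [oneOn_of_notMem ht], NNReal.smul_def,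
    Complex.real_smul]
  congr 1
  by_cases hs : s ∈ K
  · lift s to K using hs
    rw [retract_coe, oneOn_of_mem s.2, one_mul]
    refine integral_congr_ae (Eventually.of_forall fun h => ?_)
    have h1 : (s : G)⁻¹ * h = ((s⁻¹ * h : K) : G) := rfl
    simp only [h1, retract_coe, oneOn_of_mem (SetLike.coe_mem _), one_mul]
  · rw [oneOn_of_notMem hs, zero_mul]
    have h2 : ∀ h : K, oneOn K (s⁻¹ * h) = 0 := fun h => oneOn_of_notMem fun h' => hs <| by
      rw [K.mul_mem_cancel_right h.2] at h'
      exact K.inv_mem_iff.1 h'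
    simp [h2]

/-- Extension by zero from `K`: the vectors are extended by zero as well. -/
theorem expandsCoeff_extension (hK : IsOpen (K : Set G)) :
    ExpandsCoeff (oneOn K) (retract K) := by
  intro κ _ ξ η hξ hη
  choose f hf hfc hfξ using hξ
  choose g hg hgc hgη using hη
  -- the scaling that makes extension by zero isometric
  obtain ⟨a, ha⟩ : ∃ a : ℝ, a ^ 2 * cosetModulus hK 1 = 1 := by
    refine ⟨Real.sqrt (cosetModulus hK 1 : ℝ)⁻¹, ?_⟩
    rw [Real.sq_sqrt (by positivity)]
    exact inv_mul_cancel₀ (by simpa using cosetModulus_ne_zero hK 1)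
  refine ⟨Unit, inferInstance, fun _ k => (a : ℂ) • (memLp_two (continuous_extension hK (hf k))
      (hasCompactSupport_extension (hfc k))).toLp _,
    fun _ k => (a : ℂ) • (memLp_two (continuous_extension hK (hg k))
      (hasCompactSupport_extension (hgc k))).toLp _, fun k S => ?_, fun k S => ?_,
    fun k l s => ?_⟩
  · refine (Finset.sum_le_univ_sum_of_nonneg fun _ => sq_nonneg _).trans_eq ?_
    rw [Finset.univ_unique, Finset.sum_singleton, norm_smul, mul_pow,
      norm_toLp_extension_sq hK (hf k) (hfc k), Complex.norm_real, Real.norm_eq_abs, sq_abs,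
      ← mul_assoc, ha, one_mul, hfξ]
  · refine (Finset.sum_le_univ_sum_of_nonneg fun _ => sq_nonneg _).trans_eq ?_
    rw [Finset.univ_unique, Finset.sum_singleton, norm_smul, mul_pow,
      norm_toLp_extension_sq hK (hg k) (hgc k), Complex.norm_real, Real.norm_eq_abs, sq_abs,
      ← mul_assoc, ha, one_mul, hgη]
  · have h := coeff_extension hK (hf l) (hfc l) (hg k) (hgc k) s
    rw [hfξ, hgη] at h
    have h1 : ∀ v v' : L2 G, coeff ((a : ℂ) • v) ((a : ℂ) • v') (leftReg s) =
        ((a ^ 2 : ℝ) : ℂ) * coeff v v' (leftReg s) := fun v v' => by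
      rw [coeff, coeff, map_smul, inner_smul_left, inner_smul_right, Complex.conj_ofReal,
        ← mul_assoc, ← sq, Complex.ofReal_pow]
    rw [tsum_fintype, Finset.univ_unique, Finset.sum_singleton, h1, h, ← mul_assoc,
      ← Complex.ofReal_mul, ha, Complex.ofReal_one, one_mul]

/-- Integration over finitely many disjoint right cosets of `K` that cover the support. -/
theorem integral_eq_sum_coset (hK : IsOpen (K : Set G)) {E : Type*} [NormedAddCommGroup E]
    [NormedSpace ℝ E] {F : G → E} (hF : Integrable F Measure.haar) {n : ℕ} {y : Fin n → G}
    (hy : ∀ t, F t ≠ 0 → ∃ i, t * (y i)⁻¹ ∈ K)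
    (hy' : ∀ t i j, t * (y i)⁻¹ ∈ K → t * (y j)⁻¹ ∈ K → i = j) :
    ∫ t, F t ∂Measure.haar = ∑ i, cosetModulus hK (y i) • ∫ h : K, F (h * y i) ∂Measure.haar := by
  have h1 : F = fun t => ∑ i, Set.indicator {t | t * (y i)⁻¹ ∈ K} F t := by
    ext t
    by_cases ht : F t = 0
    · rw [ht]
      refine (Finset.sum_eq_zero fun i _ => ?_).symm
      exact Set.indicator_apply_eq_zero.2 fun _ => ht
    · obtain ⟨i, hi⟩ := hy t ht
      rw [Finset.sum_eq_single i _ (by simp)]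
      · exact (Set.indicator_of_mem (s := {t | t * (y i)⁻¹ ∈ K}) hi F).symm
      · intro j _ hj
        exact Set.indicator_of_notMem (s := {t | t * (y j)⁻¹ ∈ K}) (fun h => hj (hy' t j i h hi)) F
  conv_lhs => rw [h1]
  rw [integral_finsetSum _ fun i _ => hF.indicator (isOpen_coset hK (y i)).measurableSet]
  refine Finset.sum_congr rfl fun i _ => ?_
  rw [integral_coset hK (y i) (F := Set.indicator {t | t * (y i)⁻¹ ∈ K} F) fun t ht =>
    Set.indicator_of_notMem (s := {t | t * (y i)⁻¹ ∈ K}) ht F]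
  congr 2
  ext h
  exact Set.indicator_of_mem (s := {t | t * (y i)⁻¹ ∈ K}) (by simp) F

/-- Right translation of a function by `y`, restricted to `K` and scaled so that it is isometric
from `L²(K y)` to `L²(K)`. -/
def cosetPart (hK : IsOpen (K : Set G)) (y : G) (f : G → ℂ) (h : K) : ℂ :=
  ((Real.sqrt (cosetModulus hK y) : ℝ) : ℂ) * f (h * y)

theorem continuous_cosetPart (hK : IsOpen (K : Set G)) (y : G) {f : G → ℂ} (hf : Continuous f) :
    Continuous (cosetPart hK y f) :=
  continuous_const.mul (hf.comp (isOpenEmbedding_coset hK y).continuous)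

theorem hasCompactSupport_cosetPart (hK : IsOpen (K : Set G)) (y : G) {f : G → ℂ}
    (hf : HasCompactSupport f) : HasCompactSupport (cosetPart hK y f) :=
  (HasCompactSupport.comp_isClosedEmbedding hf (isClosedEmbedding_coset hK y)).mul_left

theorem norm_toLp_cosetPart_sq (hK : IsOpen (K : Set G)) (y : G) {f : G → ℂ} (hf : Continuous f)
    (hc : HasCompactSupport f) :
    ‖(memLp_two (continuous_cosetPart hK y hf) (hasCompactSupport_cosetPart hK y hc)).toLp _‖ ^ 2 =
      cosetModulus hK y • ∫ h : K, ‖f (h * y)‖ ^ 2 ∂Measure.haar := by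
  simp only [norm_toLp_sq, cosetPart, norm_mul, mul_pow, integral_const_mul, Complex.norm_real,
    NNReal.smul_def, smul_eq_mul, Real.norm_eq_abs, sq_abs, Real.sq_sqrt (NNReal.coe_nonneg _)]

theorem coeff_cosetPart (hK : IsOpen (K : Set G)) (y : G) {f g : G → ℂ} (hf : Continuous f)
    (hfc : HasCompactSupport f) (hg : Continuous g) (hgc : HasCompactSupport g) (s : K) :
    coeff
      ((memLp_two (continuous_cosetPart hK y hf) (hasCompactSupport_cosetPart hK y hfc)).toLp _)
      ((memLp_two (continuous_cosetPart hK y hg) (hasCompactSupport_cosetPart hK y hgc)).toLp _)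
      (leftReg s) = cosetModulus hK y •
        ∫ h : K, f ((s : G)⁻¹ * (h * y)) * star (g (h * y)) ∂Measure.haar := by
  rw [coeff, leftReg_toLp, inner_toLp, NNReal.smul_def, Complex.real_smul, ← integral_const_mul]
  refine integral_congr_ae (Eventually.of_forall fun h => ?_)
  have h1 : ((cosetModulus hK y : ℝ) : ℂ) = (Real.sqrt (cosetModulus hK y) : ℂ) ^ 2 := by
    rw [← Complex.ofReal_pow, Real.sq_sqrt (NNReal.coe_nonneg _)]
  simp only [h1, cosetPart, star_mul', RCLike.star_def, Complex.conj_ofReal, Subgroup.coe_mul,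
    Subgroup.coe_inv, mul_assoc]
  ring

/-- Restriction to `K`: the finitely many right cosets `K y_i` that meet the supports of the vectors
are invariant under left translation by `K`, and each contributes one coefficient of `K`. -/
theorem expandsCoeff_restriction (hK : IsOpen (K : Set G)) :
    ExpandsCoeff (fun _ : K => 1) Subtype.val := by
  intro κ _ ξ η hξ hη
  choose f hf hfc hfξ using hξ
  choose g hg hgc hgη using hη
  obtain ⟨n, y, hy, hy'⟩ := exists_coset_cover hK (C := ⋃ k, tsupport (f k) ∪ tsupport (g k))
    (isCompact_iUnion fun k => (hfc k).isCompact.union (hgc k).isCompact)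
  have hf0 : ∀ k t, f k t ≠ 0 → ∃ i, t * (y i)⁻¹ ∈ K := fun k t ht =>
    hy t (Set.mem_iUnion.2 ⟨k, Or.inl (subset_tsupport _ ht)⟩)
  have hg0 : ∀ k t, g k t ≠ 0 → ∃ i, t * (y i)⁻¹ ∈ K := fun k t ht =>
    hy t (Set.mem_iUnion.2 ⟨k, Or.inr (subset_tsupport _ ht)⟩)
  have hnorm : ∀ {f : G → ℂ} (hf : Continuous f) (hc : HasCompactSupport f),
      (∀ t, f t ≠ 0 → ∃ i, t * (y i)⁻¹ ∈ K) →
      ∑ i, ‖(memLp_two (continuous_cosetPart hK (y i) hf)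
        (hasCompactSupport_cosetPart hK (y i) hc)).toLp _‖ ^ 2 =
        ‖(memLp_two hf hc).toLp f‖ ^ 2 := by
    intro f hf hc h0
    rw [norm_toLp_sq, integral_eq_sum_coset hK ((memLp_two hf hc).integrable_norm_pow two_ne_zero)
      (fun t ht => h0 t fun h => ht (by simp [h])) hy']
    exact Finset.sum_congr rfl fun i _ => norm_toLp_cosetPart_sq hK (y i) hf hc
  refine ⟨Fin n, inferInstance,
    fun i k => (memLp_two (continuous_cosetPart hK (y i) (hf k))
      (hasCompactSupport_cosetPart hK (y i) (hfc k))).toLp _,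
    fun i k => (memLp_two (continuous_cosetPart hK (y i) (hg k))
      (hasCompactSupport_cosetPart hK (y i) (hgc k))).toLp _, fun k S => ?_, fun k S => ?_,
    fun k l s => ?_⟩
  · refine (Finset.sum_le_univ_sum_of_nonneg fun _ => sq_nonneg _).trans_eq ?_
    rw [hnorm (hf k) (hfc k) (hf0 k), hfξ]
  · refine (Finset.sum_le_univ_sum_of_nonneg fun _ => sq_nonneg _).trans_eq ?_
    rw [hnorm (hg k) (hgc k) (hg0 k), hgη]
  · rw [tsum_fintype, one_mul, ← hfξ, ← hgη, coeff, leftReg_toLp, inner_toLp,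
      integral_eq_sum_coset hK _ _ hy']
    · exact Finset.sum_congr rfl fun i _ => (coeff_cosetPart hK (y i) (hf l) (hfc l) (hg k) (hgc k) s).symm
    · refine (((hf l).comp (continuous_const_mul _)).mul
        (continuous_star.comp (hg k))).integrable_of_hasCompactSupport ?_
      exact HasCompactSupport.mul_left ((hgc k).comp_left (star_zero ℂ))
    · exact fun t ht => hg0 k t fun h => ht (by rw [h, star_zero, mul_zero])

end Subgroups

/-! ### Approximation by functions supported in finitely many cosets -/

/-- A compact set meets only finitely many left cosets of an open subgroup. -/
theorem exists_finset_leftCosets {G : Type*} [Group G] [TopologicalSpace G] [IsTopologicalGroup G]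
    {K : Subgroup G} (hK : IsOpen (K : Set G)) {C : Set G} (hC : IsCompact C) :
    ∃ F : Finset (G ⧸ K), ∀ s ∈ C, (s : G ⧸ K) ∈ F := by
  have : DiscreteTopology (G ⧸ K) := QuotientGroup.discreteTopology hK
  have h := (hC.image (QuotientGroup.continuous_mk (N := K))).finite_of_discrete
  exact ⟨h.toFinset, fun s hs => h.mem_toFinset.2 ⟨s, hs, rfl⟩⟩

section Density

variable {G : Type*} [Group G] [TopologicalSpace G] [IsTopologicalGroup G]
  [LocallyCompactSpace G] [MeasurableSpace G] [BorelSpace G] {K : Subgroup G}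

/-- `⟨λ(s) ξ, η⟩` vanishes unless `s` moves the support of `ξ` onto a set meeting that of `η`. -/
theorem IsCc.exists_compact_support {ξ η : L2 G} (hξ : IsCc ξ) (hη : IsCc η) :
    ∃ C : Set G, IsCompact C ∧ ∀ s ∉ C, FourierAlg.ofCoeff ξ η s = 0 := by
  obtain ⟨f, hf, hfc, rfl⟩ := hξ
  obtain ⟨g, hg, hgc, rfl⟩ := hη
  refine ⟨(fun p : G × G => p.1 * p.2⁻¹) '' (tsupport g ×ˢ tsupport f),
    (hgc.isCompact.prod hfc.isCompact).image (continuous_fst.mul continuous_snd.inv),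
    fun s hs => ?_⟩
  rw [FourierAlg.ofCoeff_apply, coeff, leftReg_toLp, inner_toLp]
  refine integral_eq_zero_of_ae (Eventually.of_forall fun x => ?_)
  by_cases hx : x ∈ tsupport g
  · have : f (s⁻¹ * x) = 0 := image_eq_zero_of_notMem_tsupport fun h => hs
      ⟨(x, s⁻¹ * x), ⟨hx, h⟩, by simp⟩
    simp [this]
  · simp [image_eq_zero_of_notMem_tsupport hx]

/-- The functions supported in finitely many cosets are dense in the Fourier algebra, since the
coefficients of continuous vectors of compact support have compact support. -/
theorem FourierAlg.exists_near_supported (hK : IsOpen (K : Set G)) (u : FourierAlg G) {ε : ℝ}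
    (hε : 0 < ε) : ∃ (v : FourierAlg G) (F : Finset (G ⧸ K)),
      (∀ s : G, (s : G ⧸ K) ∉ F → v s = 0) ∧ ‖u - v‖ < ε := by
  classical
  obtain ⟨ξ, η, hξ, hη, hu, hle⟩ := u.exists_isCc_rep one_pos
  have hsum := hasSum_ofCoeff (ne_top_of_le_ne_top (by simp) hle) hu
  obtain ⟨S, hS⟩ := (Metric.tendsto_nhds.1 hsum ε hε).exists
  choose C hC hC0 using fun i => (hξ i).exists_compact_support (hη i)
  choose F hF using fun i => exists_finset_leftCosets hK (hC i)
  refine ⟨_, S.biUnion F, fun s hs => ?_, by rwa [dist_comm, dist_eq_norm] at hS⟩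
  rw [FourierAlg.sum_apply]
  refine Finset.sum_eq_zero fun i hi => hC0 i s fun h => hs ?_
  exact Finset.mem_biUnion.2 ⟨i, hi, hF i s h⟩

/-- `S¹A(G)` is an ideal of the Fourier algebra. -/
def S1A.mulFourier (e : S1A G) (v : FourierAlg G) : S1A G :=
  ⟨fun s => e s * v s, (toFourier e * v).2,
    e.integrable.mul_bdd (c := ‖v‖) v.continuous.aestronglyMeasurable
      (Eventually.of_forall v.norm_apply_le)⟩

@[simp] theorem S1A.mulFourier_apply (e : S1A G) (v : FourierAlg G) (s : G) :
    mulFourier e v s = e s * v s := rfl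

theorem S1A.norm_mulFourier_le (e : S1A G) (v : FourierAlg G) : ‖mulFourier e v‖ ≤ ‖e‖ * ‖v‖ := by
  have h1 : ‖toFourier (mulFourier e v)‖ ≤ ‖toFourier e‖ * ‖v‖ :=
    _root_.norm_mul_le (toFourier e) v
  rw [norm_eq, norm_eq, add_mul, ← integral_mul_const]
  refine add_le_add h1 (integral_mono (mulFourier e v).integrable.norm
    (e.integrable.norm.mul_const _) fun s => ?_)
  simp only [mulFourier_apply, norm_mul]
  gcongr
  exact v.norm_apply_le s

/-- With an approximate identity `e`, the functions supported in finitely many cosets are dense in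
`S¹A(G)`: such functions `v` in `A(G)` give `e v`, which is integrable and close to `e u` in both
norms when `v` is close to `u` in `A(G)`. -/
theorem S1A.exists_near_supported (hK : IsOpen (K : Set G)) (hG : HasApproxIdentity (S1A G))
    (u : S1A G) {ε : ℝ} (hε : 0 < ε) : ∃ (w : S1A G) (F : Finset (G ⧸ K)),
      (∀ s : G, (s : G ⧸ K) ∉ F → w s = 0) ∧ ‖u - w‖ < ε := by
  obtain ⟨Λ, _, _, _, e, he⟩ := hG
  obtain ⟨i, hi⟩ := (Metric.tendsto_nhds.1 (he u).1 (ε / 2) (half_pos hε)).exists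
  obtain ⟨v, F, hv, huv⟩ := (toFourier u).exists_near_supported hK
    (ε := ε / 2 / (‖e i‖ + 1)) (by positivity)
  refine ⟨mulFourier (e i) v, F, fun s hs => by simp [hv s hs], ?_⟩
  have h1 : e i * u - mulFourier (e i) v = mulFourier (e i) (toFourier u - v) := by
    ext s; simp [mul_sub]
  have h2 : ‖e i * u - mulFourier (e i) v‖ ≤ ε / 2 := by
    rw [h1]
    refine (norm_mulFourier_le _ _).trans ?_
    calc ‖e i‖ * ‖toFourier u - v‖ ≤ (‖e i‖ + 1) * (ε / 2 / (‖e i‖ + 1)) := by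
          gcongr; linarith
      _ = ε / 2 := by field_simp
  rw [dist_comm, dist_eq_norm] at hi
  calc ‖u - mulFourier (e i) v‖ ≤ ‖u - e i * u‖ + ‖e i * u - mulFourier (e i) v‖ :=
        norm_sub_le_norm_sub_add_norm_sub _ _ _
    _ < ε := by linarith

/-- With an approximate identity, some multiplier supported in finitely many cosets is nearly the
identity on a given finite set. -/
theorem S1A.exists_supported_approxIdentity (hK : IsOpen (K : Set G))
    (hG : HasApproxIdentity (S1A G)) (S : Finset (S1A G)) {ε : ℝ} (hε : 0 < ε) :
    ∃ (w : S1A G) (F : Finset (G ⧸ K)),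
      (∀ s : G, (s : G ⧸ K) ∉ F → w s = 0) ∧ ∀ a ∈ S, ‖w * a - a‖ < ε := by
  obtain ⟨Λ, _, _, _, e, he⟩ := id hG
  have h : ∀ᶠ i in atTop, ∀ a ∈ S, dist (e i * a) a < ε / 2 := by
    rw [Filter.eventually_all_finset]
    exact fun a _ => Metric.tendsto_nhds.1 (he a).1 (ε / 2) (half_pos hε)
  obtain ⟨i, hi⟩ := h.exists
  let M : ℝ := ∑ a ∈ S, ‖a‖
  have hM : 0 ≤ M := Finset.sum_nonneg fun _ _ => norm_nonneg _
  obtain ⟨w, F, hw, hew⟩ := exists_near_supported hK hG (e i)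
    (ε := ε / 2 / (M + 1)) (by positivity)
  refine ⟨w, F, hw, fun a ha => ?_⟩
  have h1 : ‖w * a - e i * a‖ ≤ ε / 2 := by
    rw [← sub_mul]
    refine (_root_.norm_mul_le _ _).trans ?_
    have h2 : ‖a‖ ≤ M + 1 :=
      (Finset.single_le_sum (f := fun a : S1A G => ‖a‖) (fun _ _ => norm_nonneg _) ha).trans
        (by simp [M])
    rw [norm_sub_rev]
    calc ‖e i - w‖ * ‖a‖ ≤ (ε / 2 / (M + 1)) * (M + 1) := by gcongr
      _ = ε / 2 := by field_simp
  have h2 := hi a ha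
  rw [dist_eq_norm] at h2
  calc ‖w * a - a‖ ≤ ‖w * a - e i * a‖ + ‖e i * a - a‖ := norm_sub_le_norm_sub_add_norm_sub _ _ _
    _ < ε := by linarith

end Density

/-! ### Embeddings and restrictions along the left cosets -/

section CosetMaps

variable {G : Type*} [Group G] [TopologicalSpace G] [IsTopologicalGroup G]
  [LocallyCompactSpace G] [MeasurableSpace G] [BorelSpace G] {K : Subgroup G}
  [LocallyCompactSpace K]

/-- Extension by zero to `G` followed by left translation: functions on `K` become functions on the
coset `x K`. -/
def S1A.cosetEmbed (hK : IsOpen (K : Set G)) (x : G) : S1A K →L[ℂ] S1A G :=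
  (S1A.wcomp (expandsCoeff_translation x⁻¹) (transposesTo_translation x⁻¹)).comp
    (S1A.wcomp (expandsCoeff_extension hK) (transposesTo_extension hK))

/-- Restriction to the coset `x K`, read as a function on `K`. -/
def S1A.cosetRestrict (hK : IsOpen (K : Set G)) (x : G) : S1A G →L[ℂ] S1A K :=
  (S1A.wcomp (expandsCoeff_restriction hK) (transposesTo_restriction hK)).comp
    (S1A.wcomp (expandsCoeff_translation x) (transposesTo_translation x))

theorem S1A.cosetEmbed_apply (hK : IsOpen (K : Set G)) (x : G) (b : S1A K) (s : G) :
    cosetEmbed hK x b s = oneOn K (x⁻¹ * s) * b (retract K (x⁻¹ * s)) := one_mul _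

theorem S1A.cosetRestrict_apply (hK : IsOpen (K : Set G)) (x : G) (a : S1A G) (h : K) :
    cosetRestrict hK x a h = a (x * h) := (one_mul _).trans (one_mul _)

theorem S1A.cosetEmbed_mul (hK : IsOpen (K : Set G)) (x : G) (b b' : S1A K) :
    cosetEmbed hK x (b * b') = cosetEmbed hK x b * cosetEmbed hK x b' := by
  ext s
  by_cases hs : x⁻¹ * s ∈ K
  · simp [cosetEmbed_apply, oneOn_of_mem hs]
  · simp [cosetEmbed_apply, oneOn_of_notMem hs]

theorem S1A.cosetRestrict_mul (hK : IsOpen (K : Set G)) (x : G) (a a' : S1A G) :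
    cosetRestrict hK x (a * a') = cosetRestrict hK x a * cosetRestrict hK x a' := by
  ext s
  simp [cosetRestrict_apply]

theorem S1A.cosetEmbed_mul_cosetRestrict (hK : IsOpen (K : Set G)) (x : G) (b : S1A K)
    (a : S1A G) : cosetEmbed hK x (b * cosetRestrict hK x a) = cosetEmbed hK x b * a := by
  ext s
  by_cases hs : x⁻¹ * s ∈ K
  · simp [cosetEmbed_apply, cosetRestrict_apply, oneOn_of_mem hs, retract, hs]
  · simp [cosetEmbed_apply, oneOn_of_notMem hs]

theorem S1A.cosetEmbed_cosetRestrict_apply (hK : IsOpen (K : Set G)) (x : G) (a : S1A G) (s : G) :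
    cosetEmbed hK x (cosetRestrict hK x a) s = oneOn K (x⁻¹ * s) * a s := by
  by_cases hs : x⁻¹ * s ∈ K
  · simp [cosetEmbed_apply, cosetRestrict_apply, oneOn_of_mem hs, retract, hs]
  · simp [cosetEmbed_apply, oneOn_of_notMem hs]

/-- A function supported in finitely many cosets is the sum of its parts. -/
theorem S1A.sum_cosetEmbed_cosetRestrict (hK : IsOpen (K : Set G)) {F : Finset (G ⧸ K)} {a : S1A G}
    (ha : ∀ s : G, (s : G ⧸ K) ∉ F → a s = 0) :
    ∑ c ∈ F, cosetEmbed hK c.out (cosetRestrict hK c.out a) = a := by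
  ext s
  simp only [S1A.sum_apply, cosetEmbed_cosetRestrict_apply]
  have hc : ∀ c : G ⧸ K, c.out⁻¹ * s ∈ K ↔ c = s := fun c => by
    rw [← QuotientGroup.eq, QuotientGroup.out_eq']
  by_cases hs : (s : G ⧸ K) ∈ F
  · rw [Finset.sum_eq_single_of_mem _ hs, oneOn_of_mem ((hc _).2 rfl), one_mul]
    intro c _ hne
    rw [oneOn_of_notMem (mt (hc c).1 hne), zero_mul]
  · simp [ha s hs]

theorem S1A.exists_cbBound_cosetEmbed (hK : IsOpen (K : Set G)) (x : G) : ∃ C : ℝ≥0, 0 < C ∧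
    CBBound (S1A.matrixNorm K) (S1A.matrixNorm G) (cosetEmbed hK x : S1A K →ₗ[ℂ] S1A G) C :=
  -- `1` is added to make the constant positive
  ⟨_, add_pos_of_nonneg_of_pos bot_le one_pos,
    ((S1A.cbBound_wcomp (expandsCoeff_translation x⁻¹) (transposesTo_translation x⁻¹)).comp
    (S1A.cbBound_wcomp (expandsCoeff_extension hK) (transposesTo_extension hK))).mono
      (le_add_of_nonneg_right zero_le_one)⟩

theorem S1A.exists_cbBound_cosetRestrict (hK : IsOpen (K : Set G)) (x : G) (w : S1A G) :
    ∃ C : ℝ≥0, 0 < C ∧ CBBound (S1A.matrixNorm G) (S1A.matrixNorm K)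
      ((cosetRestrict hK x : S1A G →ₗ[ℂ] S1A K) ∘ₗ LinearMap.mulLeft ℂ w) C :=
  -- `1` is added to make the constant positive
  ⟨_, add_pos_of_nonneg_of_pos bot_le one_pos,
    (((S1A.cbBound_wcomp (expandsCoeff_restriction hK) (transposesTo_restriction hK)).comp
    (S1A.cbBound_wcomp (expandsCoeff_translation x) (transposesTo_translation x))).comp
      (S1A.cbBound_mulLeft w)).mono (le_add_of_nonneg_right zero_le_one)⟩

end CosetMaps

/-! ### Passage from an open subgroup to the group -/

section OpenSubgroups

universe u

variable {G : Type u} [Group G] [TopologicalSpace G] [IsTopologicalGroup G]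
  [LocallyCompactSpace G] [MeasurableSpace G] [BorelSpace G] {K : Subgroup G}
  [LocallyCompactSpace K]

theorem S1A.exists_sum_cosetEmbed_cosetRestrict (hK : IsOpen (K : Set G))
    (hG : HasApproxIdentity (S1A G)) (S : Finset (S1A G)) (ε : ℝ) (hε : 0 < ε) :
    ∃ (w : S1A G) (F : Finset (G ⧸ K)),
      (∀ a, ∑ c ∈ F, cosetEmbed hK c.out (cosetRestrict hK c.out (w * a)) = w * a) ∧
      ∀ a ∈ S, ‖w * a - a‖ < ε := by
  obtain ⟨w, F, hw, h⟩ := S1A.exists_supported_approxIdentity hK hG S hε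
  exact ⟨w, F, fun a => S1A.sum_cosetEmbed_cosetRestrict hK fun s hs => by simp [hw s hs], h⟩

/-- Approximate biflatness passes from an open subgroup to the group. -/
theorem isApproxBiflat_of_isOpen (hK : IsOpen (K : Set G)) (hG : HasApproxIdentity (S1A G))
    (h : IsApproxBiflat (S1A K)) : IsApproxBiflat (S1A G) := by
  refine HasBiflatNet.transfer (fun a _ hψ => tensorLeft_mem_projDual a hψ)
    (fun a _ hψ => tensorRight_mem_projDual a hψ) mulPullback_mem_projDual
    (fun c : G ⧸ K => S1A.cosetEmbed hK c.out) (fun c => S1A.cosetRestrict hK c.out)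
    (fun c => S1A.cosetEmbed_mul hK c.out) (fun c => S1A.cosetRestrict_mul hK c.out)
    (fun c => S1A.cosetEmbed_mul_cosetRestrict hK c.out)
    (fun c _ hψ => comp_tensorMap_mem_projDual _ _ hψ) ⟨0, fun _ => ?_⟩ ?_ ?_
    (S1A.exists_sum_cosetEmbed_cosetRestrict hK hG) h
  · rw [LinearMap.zero_apply, enorm_eq_nnnorm, nnnorm_zero]
    exact bot_le
  · rintro θ θ' ⟨C, hC⟩ ⟨C', hC'⟩
    refine ⟨C + C', fun ψ => ?_⟩
    rw [ENNReal.coe_add, add_mul]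
    exact (ENNReal.coe_le_coe.2 (nnnorm_add_le (θ ψ) (θ' ψ))).trans (add_le_add (hC ψ) (hC' ψ))
  · rintro c w θ ⟨C, hC⟩
    let R := (S1A.cosetRestrict hK c.out).comp (ContinuousLinearMap.mul ℂ (S1A G) w)
    let J := S1A.cosetEmbed hK c.out
    refine ⟨‖R‖₊ * (C * ((‖J‖₊ + 1) * (‖J‖₊ + 1))), fun ψ => ?_⟩
    have h1 := hC ⟨_, comp_tensorMap_mem_projDual J J ψ.2⟩
    have h2 := dualENorm_comp_le (p := projENorm) (p' := projENorm)
      (f := TensorProduct.map (J : S1A K →ₗ[ℂ] S1A G) (J : S1A K →ₗ[ℂ] S1A G))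
      (K := (‖J‖₊ + 1) * (‖J‖₊ + 1)) (by positivity) projENorm_smul_le projENorm_tensorMap_le ψ
    have h3 : ∀ φ : StrongDual ℂ (S1A K), ‖φ.comp R‖ₑ ≤ ‖R‖₊ * ‖φ‖ₑ := fun φ => by
      rw [mul_comm, enorm_eq_nnnorm, enorm_eq_nnnorm, ← ENNReal.coe_mul]
      exact ENNReal.coe_le_coe.2 (φ.opNNNorm_comp_le R)
    refine (h3 _).trans ?_
    rw [ENNReal.coe_mul, ENNReal.coe_mul, mul_assoc, mul_assoc]
    exact mul_le_mul' le_rfl (h1.trans (mul_le_mul' le_rfl h2))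

/-- Operator approximate biflatness passes from an open subgroup to the group. -/
theorem isOpApproxBiflat_of_isOpen (hK : IsOpen (K : Set G)) (hG : HasApproxIdentity (S1A G))
    (h : IsOpApproxBiflat (S1A.matrixNorm K)) : IsOpApproxBiflat (S1A.matrixNorm G) := by
  refine HasBiflatNet.transfer (fun a _ hψ => tensorLeft_mem_opProjDual a hψ)
    (fun a _ hψ => tensorRight_mem_opProjDual a hψ) mulPullback_mem_opProjDual
    (fun c : G ⧸ K => S1A.cosetEmbed hK c.out) (fun c => S1A.cosetRestrict hK c.out)
    (fun c => S1A.cosetEmbed_mul hK c.out) (fun c => S1A.cosetRestrict_mul hK c.out)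
    (fun c => S1A.cosetEmbed_mul_cosetRestrict hK c.out)
    (fun c _ hψ => comp_tensorMap_mem_opProjDual
      (S1A.exists_cbBound_cosetEmbed hK c.out).choose_spec.2
      (S1A.exists_cbBound_cosetEmbed hK c.out).choose_spec.2 hψ) ⟨0, fun n F => ?_⟩ ?_ ?_
    (S1A.exists_sum_cosetEmbed_cosetRestrict hK hG) h
  · exact (dualMatrixNorm_zero (S1A.matrixNorm G) n).trans_le bot_le
  · rintro θ θ' ⟨C, hC⟩ ⟨C', hC'⟩
    refine ⟨C + C', fun n F => ?_⟩
    rw [ENNReal.coe_add, add_mul]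
    exact (dualMatrixNorm_add_le _ (F.map fun ψ => (θ ψ : S1A G →ₗ[ℂ] ℂ))
      (F.map fun ψ => (θ' ψ : S1A G →ₗ[ℂ] ℂ))).trans (add_le_add (hC n F) (hC' n F))
  · rintro c w θ ⟨C, hC⟩
    obtain ⟨R, hR, hRb⟩ := S1A.exists_cbBound_cosetRestrict hK c.out w
    obtain ⟨J, hJ, hJb⟩ := S1A.exists_cbBound_cosetEmbed hK c.out
    refine ⟨R * (C * (J * J)), fun n F => ?_⟩
    have h1 := hC n (F.map fun ψ => ⟨_, comp_tensorMap_mem_opProjDual hJb hJb ψ.2⟩)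
    have h2 := dualMatrixNorm_comp_le (mul_pos hJ hJ) (fun _ c v => opProjNorm_smul_le c v)
      (cbBound_tensorMap hJ hJ hJb hJb)
      (F.map fun ψ => (ψ : Module.Dual ℂ (S1A G ⊗[ℂ] S1A G)))
    have h3 := dualMatrixNorm_comp_le hR (fun _ c v => S1A.matrixNorm_smul_le c v) hRb
      ((F.map fun ψ => (⟨_, comp_tensorMap_mem_opProjDual hJb hJb ψ.2⟩ :
        OpProjDual (S1A.matrixNorm K))).map fun ψ => (θ ψ : S1A K →ₗ[ℂ] ℂ))
    refine h3.trans ?_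
    rw [ENNReal.coe_mul, ENNReal.coe_mul, mul_assoc, mul_assoc]
    exact mul_le_mul' le_rfl (h1.trans (mul_le_mul' le_rfl h2))

end OpenSubgroups

end FourierSegal
end

theorem mainTheorem10 {G : Type*} [Group G] [TopologicalSpace G] [IsTopologicalGroup G]
    [LocallyCompactSpace G] [T2Space G] [MeasurableSpace G] [BorelSpace G]
    (hG : FourierSegal.HasApproxIdentity (FourierSegal.S1A G)) (H : OpenSubgroup G) :
    (FourierSegal.IsApproxBiflat (FourierSegal.S1A H.toSubgroup) →
      FourierSegal.IsApproxBiflat (FourierSegal.S1A G)) ∧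
    (FourierSegal.IsOpApproxBiflat (FourierSegal.S1A.matrixNorm H.toSubgroup) →
      FourierSegal.IsOpApproxBiflat (FourierSegal.S1A.matrixNorm G)) :=
  ⟨FourierSegal.isApproxBiflat_of_isOpen H.isOpen hG,
    FourierSegal.isOpApproxBiflat_of_isOpen H.isOpen hG⟩
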